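/- **Setting.** Let $\Bbbk$ be an algebraically closed field, $\Lambda$ a nonempty finite set with a preorder $\preceq$ (a reflexive and transitive relation; $\lambda\prec\mu$ means $\lambda\preceq\mu$ and $\mu\not\preceq\lambda$), and let $A=\bigoplus_{i\ge 0}A_i$ be a positively graded algebra: a graded $\Bbbk$-algebra with $\dim_\Bbbk A_i<\infty$ for all $i$ and $A_0=\bigoplus_{\lambda\in\Lambda}\Bbbk e_\lambda$ for pairwise orthogonal nonzero idempotents $e_\lambda$. Modules are $\mathbb Z$-graded left $A$-modules, morphisms are homogeneous of degree $0$, and $M\langle j\rangle_i=M_{i+j}$. Let $A^{\downarrow}\text{-gmod}$ be the category of modules $M$ with all $M_i$ finite dimensional and $M_i=0$ for $i\ll 0$; for such $M\neq0$ let $\mathfrak b(M)=\min\{n: M_n\ne 0\}$, and $\mathfrak b(0)=+\infty$. Let $P(\lambda)=Ae_\lambda$, let $L(\lambda)$ be its simple top and $I(\lambda)$ the injective envelope of $L(\lambda)$ in the category of graded modules with finite dimensional homogeneous components (that is, the graded dual of the right module $e_\lambda A$). The standard module $\Delta(\lambda)$ is the quotient of $P(\lambda)$ by the submodule $K(\lambda)$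 generated by the images of all morphisms $P(\mu)\langle i\rangle\to P(\lambda)$ with $\lambda\prec\mu$, $i\in\mathbb Z$. The proper costandard module $\overline\nabla(\lambda)$ is the intersection of the kernels of all morphisms $I(\lambda)\to I(\mu)\langle i\rangle$ with $\lambda\preceq\mu$, $i>0$. The algebra $A$ is *standardly stratified* if for every $\lambda$: (a) every composition factor of $\Delta(\lambda)$ is, up to shift, some $L(\mu)$ with $\mu\preceq\lambda$ (that is, $e_\mu\Delta(\lambda)\neq0$ implies $\mu\preceq\lambda$; this is automatic if any two elements of $\Lambda$ are comparable); (b) $K(\lambda)$ has a finite filtration whose subquotients are, up to shift, standard modules. For a family $S=(S(\lambda))_{\lambda\in\Lambda}$ of modules let $\mathcal C(S)$ be the class of all $M\in A^{\downarrow}\text{-gmod}$ having a finite or infinite filtration $M=M^{(0)}\supseteq M^{(1)}\supseteq\cdots$ by graded submodules whose subquotients are isomorphic, up to shift, to modules $S(\lambda)$ and for which $\mathfrak b(M^{(i)})\to+\infty$ (a finite filtration is one that reaches $0$ and is continued by $0$). Let $\mathcal F^{\downarrow}(S)$ be the class of all $M\in A^{\downarrow}\text{-gmod}$ having a finite filtration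 with subquotients in $\mathcal C(S)$. Indecomposable modules are nonzero. **Theorem (Construction of tilting modules).** Let $A$ be a positively graded standardly stratified algebra, and let $\mathcal T=\mathcal F^{\downarrow}(\Delta)\cap\mathcal F^{\downarrow}(\overline\nabla)$. (i) $\mathcal T$ is closed under direct summands and under direct sums: every finite direct sum of objects of $\mathcal T$ lies in $\mathcal T$, and so does every infinite direct sum of objects of $\mathcal T$ that belongs to $A^{\downarrow}\text{-gmod}$. (ii) For every $\lambda\in\Lambda$ there is an indecomposable object $T(\lambda)\in\mathcal T$, unique up to isomorphism, for which there exists a short exact sequence $\Delta(\lambda)\hookrightarrow T(\lambda)\twoheadrightarrow \mathrm{Coker}$ with $\mathrm{Coker}\in\mathcal F^{\downarrow}(\Delta)$. (iii) Every indecomposable object of $\mathcal T$ is isomorphic to $T(\lambda)\langle j\rangle$ for some $\lambda\in\Lambda$ and $j\in\mathbb Z$. -/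

import Mathlib

universe u

noncomputable section

namespace StratTilting

/-- A criterion for a family of subspaces to be a direct sum decomposition. -/
theorem isInternal_of_proj {k V V' : Type*} [Field k] [AddCommGroup V] [Module k V]
    [AddCommGroup V'] [Module k V'] (D : ℤ → Submodule k V) (p : ℤ → V →ₗ[k] V')
    (h0 : ∀ n, ∀ x ∈ D n, p n x = 0 → x = 0)
    (h1 : ∀ m n, m ≠ n → ∀ x ∈ D m, p n x = 0)
    (h2 : ∀ x, x ∈ ⨆ n, D n) : DirectSum.IsInternal D := by
  rw [DirectSum.isInternal_submodule_iff_iSupIndep_and_iSup_eq_top]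
  refine ⟨fun n => ?_, eq_top_iff.2 fun x _ => h2 x⟩
  rw [Submodule.disjoint_def]
  intro x hx hx'
  refine h0 n x hx ?_
  have hle : (⨆ j, ⨆ (_ : j ≠ n), D j) ≤ LinearMap.ker (p n) :=
    iSup_le fun j => iSup_le fun hj y hy => h1 j n hj y hy
  exact hle hx'

section

variable {k A : Type u} [Field k] [Ring A] [Algebra k A]

/-- A `ℤ`-graded left module over the `k`-algebra `A` with grading `𝒜`. -/
structure GrMod (𝒜 : ℤ → Submodule k A) where
  /-- the underlying module -/
  carrier : Type u
  [addCommGroup : AddCommGroup carrier]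
  [moduleA : Module A carrier]
  [moduleK : Module k carrier]
  [tower : IsScalarTower k A carrier]
  /-- the homogeneous components -/
  deg : ℤ → Submodule k carrier
  isInternal : DirectSum.IsInternal deg
  smul_mem_deg : ∀ {i j : ℤ} {a : A} {x : carrier}, a ∈ 𝒜 i → x ∈ deg j → a • x ∈ deg (i + j)

namespace GrMod

instance (𝒜 : ℤ → Submodule k A) : CoeSort (GrMod 𝒜) (Type u) := ⟨carrier⟩

attribute [instance] addCommGroup moduleA moduleK tower

variable {𝒜 : ℤ → Submodule k A}

instance decomposition (M : GrMod 𝒜) : DirectSum.Decomposition M.deg :=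
  M.isInternal.chooseDecomposition

instance gradedSMul (M : GrMod 𝒜) : SetLike.GradedSMul 𝒜 M.deg :=
  ⟨fun {_ _ _ _} ha hx => M.smul_mem_deg ha hx⟩

/-- The projection onto the homogeneous component of degree `n`. -/
def proj (M : GrMod 𝒜) (n : ℤ) : M →ₗ[k] M :=
  (M.deg n).subtype ∘ₗ DirectSum.component k ℤ (fun i => M.deg i) n ∘ₗ
    (DirectSum.decomposeLinearEquiv M.deg).toLinearMap

theorem proj_apply (M : GrMod 𝒜) (n : ℤ) (x : M) :
    M.proj n x = (DirectSum.decompose M.deg x n : M) := rfl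

theorem proj_mem (M : GrMod 𝒜) (n : ℤ) (x : M) : M.proj n x ∈ M.deg n :=
  (DirectSum.decompose M.deg x n).2

theorem proj_same (M : GrMod 𝒜) {n : ℤ} {x : M} (hx : x ∈ M.deg n) : M.proj n x = x :=
  DirectSum.decompose_of_mem_same _ hx

theorem proj_ne (M : GrMod 𝒜) {m n : ℤ} {x : M} (hx : x ∈ M.deg m) (h : m ≠ n) :
    M.proj n x = 0 :=
  DirectSum.decompose_of_mem_ne _ hx h

theorem mem_iSup_deg (M : GrMod 𝒜) (x : M) : x ∈ ⨆ n, M.deg n := by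
  rw [M.isInternal.submodule_iSup_eq_top]; trivial

theorem sum_proj (M : GrMod 𝒜) (x : M) : ∃ s : Finset ℤ, x = ∑ n ∈ s, M.proj n x := by
  classical
  exact ⟨_, (DirectSum.sum_support_decompose M.deg x).symm⟩

/-- The grading shift `M⟨i⟩`, with `M⟨i⟩_j = M_{i+j}`. -/
def shift (M : GrMod 𝒜) (i : ℤ) : GrMod 𝒜 where
  carrier := M
  deg j := M.deg (i + j)
  isInternal := by
    refine isInternal_of_proj _ (fun j => M.proj (i + j)) (fun n x hx h => ?_)
      (fun m n hmn x hx => ?_) (fun x => ?_)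
    · rwa [M.proj_same hx] at h
    · exact M.proj_ne hx (by omega)
    · have := M.mem_iSup_deg x
      have hle : (⨆ n, M.deg n) ≤ ⨆ n, M.deg (i + n) := by
        refine iSup_le fun n => ?_
        have := le_iSup (fun n => M.deg (i + n)) (n - i)
        simpa using this
      exact hle this
  smul_mem_deg := by
    intro j l a x ha hx
    have := M.smul_mem_deg ha hx
    rwa [show i + (j + l) = j + (i + l) by ring]

/-- Morphisms of graded modules: homogeneous `A`-linear maps of degree zero. -/
structure Hom (M N : GrMod 𝒜) extends M →ₗ[A] N where
  map_deg : ∀ (n : ℤ) (x : M), x ∈ M.deg n → toLinearMap x ∈ N.deg n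

theorem Hom.proj_comm {M N : GrMod 𝒜} (f : Hom M N) (n : ℤ) (x : M) :
    N.proj n (f.toLinearMap x) = f.toLinearMap (M.proj n x) := by
  have hx := M.mem_iSup_deg x
  induction hx using Submodule.iSup_induction' with
  | mem m x hx =>
    by_cases h : m = n
    · subst h
      rw [M.proj_same hx, N.proj_same (f.map_deg _ _ hx)]
    · rw [M.proj_ne hx h, N.proj_ne (f.map_deg _ _ hx) h, map_zero]
  | zero => simp
  | add x y _ _ hx hy => simp [hx, hy]

/-- Isomorphism of graded modules. -/
def IsIsomorphic (M N : GrMod 𝒜) : Prop :=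
  ∃ f : M ≃ₗ[A] N, ∀ (n : ℤ) (x : M), x ∈ M.deg n ↔ f x ∈ N.deg n

variable [GradedAlgebra 𝒜]

theorem proj_smul_of_mem_zero (M : GrMod 𝒜) (a : A) {x : M} (hx : x ∈ M.deg 0) (n : ℤ) :
    M.proj n (a • x) = (DirectSum.decompose 𝒜 a n : A) • x := by
  induction a using DirectSum.Decomposition.inductionOn 𝒜 with
  | zero => simp
  | add a b ha hb => simp [add_smul, ha, hb]
  | @homogeneous m a =>
    have h := M.smul_mem_deg a.2 hx
    rw [add_zero] at h
    by_cases hm : m = n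
    · subst hm
      rw [M.proj_same h, DirectSum.decompose_of_mem_same _ a.2]
    · rw [M.proj_ne h hm, DirectSum.decompose_of_mem_ne _ a.2 hm, zero_smul]

/-- Graded (homogeneous) submodules. -/
abbrev HSub (M : GrMod 𝒜) : Type u := HomogeneousSubmodule 𝒜 M.deg

/-- A submodule closed under taking homogeneous components, as a graded submodule. -/
def HSub.mk' (M : GrMod 𝒜) (p : Submodule A M) (h : ∀ x ∈ p, ∀ n, M.proj n x ∈ p) : M.HSub where
  toSubmodule := p
  is_homogeneous' := fun n x hx => h x hx n

theorem HSub.proj_mem {M : GrMod 𝒜} (N : M.HSub) (n : ℤ) {x : M} (hx : x ∈ N.toSubmodule) :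
    M.proj n x ∈ N.toSubmodule :=
  N.is_homogeneous' n hx

/-- A graded submodule, as a graded module. -/
def sub (M : GrMod 𝒜) (N : M.HSub) : GrMod 𝒜 where
  carrier := N.toSubmodule
  deg n := (M.deg n).comap (N.toSubmodule.subtype.restrictScalars k)
  isInternal := by
    refine isInternal_of_proj _ (fun j => M.proj j ∘ₗ N.toSubmodule.subtype.restrictScalars k)
      (fun n x hx h => ?_) (fun m n hmn x hx => ?_) (fun x => ?_)
    · have hx' : (x : M) ∈ M.deg n := hx
      have h' : M.proj n (x : M) = 0 := h
      rw [M.proj_same hx'] at h'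
      exact Subtype.ext h'
    · exact M.proj_ne (x := (x : M)) hx hmn
    · obtain ⟨s, hs⟩ := M.sum_proj (x : M)
      have : x = ∑ n ∈ s, (⟨M.proj n (x : M), N.proj_mem n x.2⟩ : N.toSubmodule) := by
        apply Subtype.ext
        rw [AddSubmonoidClass.coe_finsetSum]
        exact hs
      rw [this]
      refine Submodule.sum_mem _ fun n _ => Submodule.mem_iSup_of_mem n ?_
      exact M.proj_mem n (x : M)
  smul_mem_deg := by
    intro i j a x ha hx
    exact M.smul_mem_deg (x := (x : M)) ha hx

/-- The quotient of a graded module by a graded submodule. -/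
def quot (M : GrMod 𝒜) (N : M.HSub) : GrMod 𝒜 where
  carrier := M ⧸ N.toSubmodule
  deg n := (M.deg n).map (N.toSubmodule.mkQ.restrictScalars k)
  isInternal := by
    have hN : ∀ n, N.toSubmodule.restrictScalars k ≤
        (N.toSubmodule.restrictScalars k).comap (M.proj n) := fun n x hx => N.proj_mem n hx
    refine isInternal_of_proj _ (fun j => Submodule.mapQ (N.toSubmodule.restrictScalars k)
        (N.toSubmodule.restrictScalars k) (M.proj j) (hN j))
      (fun n x hx h => ?_) (fun m n hmn x hx => ?_) (fun x => ?_)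
    · obtain ⟨y, hy, rfl⟩ := hx
      have h' : (Submodule.Quotient.mk (M.proj n y) : M ⧸ N.toSubmodule.restrictScalars k) = 0 := h
      rw [M.proj_same hy, Submodule.Quotient.mk_eq_zero] at h'
      exact (Submodule.Quotient.mk_eq_zero N.toSubmodule).2 h'
    · obtain ⟨y, hy, rfl⟩ := hx
      have : (Submodule.Quotient.mk (M.proj n y) : M ⧸ N.toSubmodule.restrictScalars k) = 0 := by
        rw [M.proj_ne hy hmn]; rfl
      exact this
    · obtain ⟨y, rfl⟩ := N.toSubmodule.mkQ_surjective x
      obtain ⟨s, hs⟩ := M.sum_proj y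
      rw [hs, map_sum]
      refine Submodule.sum_mem _ fun n _ => Submodule.mem_iSup_of_mem n ?_
      exact ⟨M.proj n y, M.proj_mem n y, rfl⟩
  smul_mem_deg := by
    rintro i j a _ ha ⟨y, hy, rfl⟩
    exact ⟨a • y, M.smul_mem_deg ha hy, rfl⟩

/-- The subquotient `N / (N ∩ N')` of two graded submodules; equal to `N / N'` if `N' ⊆ N`. -/
def subquot (M : GrMod 𝒜) (N N' : M.HSub) : GrMod 𝒜 :=
  (M.sub N).quot <| HSub.mk' (M.sub N) (N'.toSubmodule.comap N.toSubmodule.subtype) <| by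
    intro x hx n
    have h : ((M.sub N).proj n x : N.toSubmodule).1 = M.proj n (x : N.toSubmodule).1 :=
      ((⟨N.toSubmodule.subtype, fun _ _ h => h⟩ : Hom (M.sub N) M).proj_comm n x).symm
    change ((M.sub N).proj n x : N.toSubmodule).1 ∈ N'.toSubmodule
    rw [h]
    exact N'.proj_mem n hx

/-- The image of a morphism, as a graded submodule. -/
def Hom.range {M N : GrMod 𝒜} (f : Hom M N) : N.HSub :=
  HSub.mk' N (LinearMap.range f.toLinearMap) <| by
    rintro _ ⟨x, rfl⟩ n
    exact ⟨M.proj n x, (f.proj_comm n x).symm⟩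

/-- The kernel of a morphism, as a graded submodule. -/
def Hom.ker {M N : GrMod 𝒜} (f : Hom M N) : M.HSub :=
  HSub.mk' M (LinearMap.ker f.toLinearMap) <| by
    intro x hx n
    rw [LinearMap.mem_ker] at hx ⊢
    rw [← f.proj_comm, hx, map_zero]

/-- The sum of a family of graded submodules. -/
def HSub.sum {M : GrMod 𝒜} {ι : Type*} (N : ι → M.HSub) : M.HSub :=
  HSub.mk' M (⨆ i, (N i).toSubmodule) <| by
    intro x hx n
    induction hx using Submodule.iSup_induction' with
    | mem i x hx => exact Submodule.mem_iSup_of_mem i ((N i).proj_mem n hx)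
    | zero => simp
    | add x y _ _ hx hy => rw [map_add]; exact add_mem hx hy

/-- The intersection of a family of graded submodules. -/
def HSub.inter {M : GrMod 𝒜} {ι : Type*} (N : ι → M.HSub) : M.HSub :=
  HSub.mk' M (⨅ i, (N i).toSubmodule) <| by
    intro x hx n
    rw [Submodule.mem_iInf] at hx ⊢
    exact fun i => (N i).proj_mem n (hx i)

/-- The direct sum of a family of graded modules. -/
def directSum {ι : Type u} (M : ι → GrMod 𝒜) : GrMod 𝒜 where
  carrier := Π₀ i, M i
  deg n := ⨅ i, ((M i).deg n).comap (DFinsupp.lapply i)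
  isInternal := by
    classical
    refine isInternal_of_proj _ (fun n => DFinsupp.mapRange.linearMap fun i => (M i).proj n)
      (fun n x hx h => ?_) (fun m n hmn x hx => ?_) (fun x => ?_)
    · rw [Submodule.mem_iInf] at hx
      ext i
      have h' := DFunLike.congr_fun h i
      have hxi : x i ∈ (M i).deg n := hx i
      simpa [(M i).proj_same hxi] using h'
    · rw [Submodule.mem_iInf] at hx
      ext i
      have hxi : x i ∈ (M i).deg m := hx i
      simp [(M i).proj_ne hxi hmn]
    · induction x using DFinsupp.induction with
      | h0 => exact zero_mem _
      | ha i b f _ _ hf =>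
        refine add_mem ?_ hf
        obtain ⟨s, hs⟩ := (M i).sum_proj b
        have : DFinsupp.single i b =
            ∑ n ∈ s, (DFinsupp.single i ((M i).proj n b) : Π₀ i, M i) := by
          conv_lhs => rw [hs]
          exact map_sum (DFinsupp.singleAddHom (fun i => (M i).carrier) i) _ _
        rw [this]
        refine Submodule.sum_mem _ fun n _ => Submodule.mem_iSup_of_mem n ?_
        rw [Submodule.mem_iInf]
        intro j
        by_cases hij : i = j
        · subst hij
          simpa using (M i).proj_mem n b
        · simp [DFinsupp.single_eq_of_ne (Ne.symm hij)]
  smul_mem_deg := by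
    intro i j a x ha hx
    rw [Submodule.mem_iInf] at hx ⊢
    exact fun l => (M l).smul_mem_deg ha (hx l)

/-- `X` is (isomorphic to) a direct summand of `M`. -/
def IsSummand (X M : GrMod 𝒜) : Prop :=
  ∃ (i : Hom X M) (p : Hom M X), ∀ x : X, p.toLinearMap (i.toLinearMap x) = x

/-- `M` is nonzero and is not a direct sum of two nonzero graded submodules. -/
def Indecomposable (M : GrMod 𝒜) : Prop :=
  Nontrivial M ∧ ∀ N N' : M.HSub, IsCompl N.toSubmodule N'.toSubmodule →
    N.toSubmodule = ⊥ ∨ N'.toSubmodule = ⊥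

/-- `M` belongs to `A^↓-gmod`: all homogeneous components are finite dimensional, and they vanish
in all sufficiently small degrees. -/
def InDown (M : GrMod 𝒜) : Prop :=
  (∀ n, FiniteDimensional k (M.deg n)) ∧ ∃ n : ℤ, ∀ i < n, M.deg i = ⊥

section Filtrations

variable {Λ : Type*}

/-- `M` is isomorphic, up to shift, to a member of the family `S`. -/
def IsShiftOf (S : Λ → GrMod 𝒜) (M : GrMod 𝒜) : Prop :=
  ∃ (l : Λ) (j : ℤ), IsIsomorphic M ((S l).shift j)

/-- `M` has a finite filtration whose subquotients are, up to shift, members of `S`. -/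
def HasFiniteFiltration (S : Λ → GrMod 𝒜) (M : GrMod 𝒜) : Prop :=
  ∃ (n : ℕ) (F : ℕ → M.HSub), (F 0).toSubmodule = ⊤ ∧ (F n).toSubmodule = ⊥ ∧
    ∀ i < n, (F (i + 1)).toSubmodule ≤ (F i).toSubmodule ∧
      IsShiftOf S (M.subquot (F i) (F (i + 1)))

/-- The class `𝒞(S)`: modules `M` in `A^↓-gmod` with a finite or infinite filtration
`M = F 0 ⊇ F 1 ⊇ ⋯` whose subquotients are, up to shift, members of `S`, and such that the lowest
degree in which `F i` is nonzero tends to `+∞`. A filtration of finite length is one that is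
eventually `0`. -/
def InC (S : Λ → GrMod 𝒜) (M : GrMod 𝒜) : Prop :=
  M.InDown ∧ ∃ F : ℕ → M.HSub, (F 0).toSubmodule = ⊤ ∧
    (∀ i, (F (i + 1)).toSubmodule ≤ (F i).toSubmodule) ∧
    (∀ i, (F i).toSubmodule = ⊥ ∨ IsShiftOf S (M.subquot (F i) (F (i + 1)))) ∧
    ∀ n : ℤ, ∀ᶠ i in Filter.atTop, ∀ j < n, (M.sub (F i)).deg j = ⊥

/-- The class `ℱ^↓(S)`: modules in `A^↓-gmod` with a finite filtration whose subquotients belong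
to `𝒞(S)`. -/
def InF (S : Λ → GrMod 𝒜) (M : GrMod 𝒜) : Prop :=
  M.InDown ∧ ∃ (n : ℕ) (G : ℕ → M.HSub), (G 0).toSubmodule = ⊤ ∧ (G n).toSubmodule = ⊥ ∧
    ∀ i < n, (G (i + 1)).toSubmodule ≤ (G i).toSubmodule ∧
      InC S (M.subquot (G i) (G (i + 1)))

end Filtrations

end GrMod

/-- The `k`-linear dual of `A`, as a left `A`-module via the right multiplication of `A` on itself:
`(a • f) x = f (x * a)`. -/
def DualReg (k A : Type u) [Field k] [Ring A] [Algebra k A] : Type u := Module.Dual k A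

namespace DualReg

instance : AddCommGroup (DualReg k A) := inferInstanceAs (AddCommGroup (Module.Dual k A))

instance : Module k (DualReg k A) := inferInstanceAs (Module k (Module.Dual k A))

instance : FunLike (DualReg k A) A k := inferInstanceAs (FunLike (Module.Dual k A) A k)

instance : LinearMapClass (DualReg k A) k A k :=
  inferInstanceAs (LinearMapClass (Module.Dual k A) k A k)

@[ext] theorem ext {f g : DualReg k A} (h : ∀ x, f x = g x) : f = g := LinearMap.ext h

theorem add_apply (f g : DualReg k A) (x : A) : (f + g) x = f x + g x := rfl

theorem zero_apply (x : A) : (0 : DualReg k A) x = 0 := rfl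

theorem ksmul_apply (c : k) (f : DualReg k A) (x : A) : (c • f) x = c * f x := rfl

instance : SMul A (DualReg k A) := ⟨fun a f => LinearMap.comp f (LinearMap.mulRight k a)⟩

theorem smul_apply (a : A) (f : DualReg k A) (x : A) : (a • f) x = f (x * a) := rfl

instance : Module A (DualReg k A) where
  one_smul f := by ext x; simp [smul_apply]
  mul_smul a b f := by ext x; simp [smul_apply, mul_assoc]
  smul_zero a := by ext x; simp [smul_apply, zero_apply]
  smul_add a f g := by ext x; simp [smul_apply, add_apply]
  add_smul a b f := by ext x; simp [smul_apply, add_apply, mul_add]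
  zero_smul f := by ext x; simp [smul_apply, zero_apply]

instance : IsScalarTower k A (DualReg k A) :=
  ⟨fun c a f => by ext x; simp [smul_apply, ksmul_apply]⟩

end DualReg

/-- The data of a positively graded algebra with index set `Λ`: the `ℤ`-graded `k`-algebra `A` lives
in nonnegative degrees, has finite dimensional homogeneous components, and its degree zero part is
`⨁_{l ∈ Λ} k e_l` for pairwise orthogonal nonzero idempotents `e_l`. -/
structure PosGraded (𝒜 : ℤ → Submodule k A) (Λ : Type*) where
  /-- the idempotents -/
  e : Λ → A
  neg : ∀ i < 0, 𝒜 i = ⊥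
  locallyFinite : ∀ i, FiniteDimensional k (𝒜 i)
  idem : ∀ l, e l * e l = e l
  orth : ∀ l m, l ≠ m → e l * e m = 0
  ne_zero : ∀ l, e l ≠ 0
  span : Submodule.span k (Set.range e) = 𝒜 0

namespace PosGraded

open GrMod

variable {𝒜 : ℤ → Submodule k A} {Λ : Type*}

theorem e_mem (E : PosGraded 𝒜 Λ) (l : Λ) : E.e l ∈ 𝒜 0 := by
  rw [← E.span]; exact Submodule.subset_span ⟨l, rfl⟩

variable [GradedAlgebra 𝒜]

variable (𝒜) in
/-- The left regular module. -/
def regular : GrMod 𝒜 where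
  carrier := A
  deg := 𝒜
  isInternal := DirectSum.Decomposition.isInternal 𝒜
  smul_mem_deg := fun ha hx => SetLike.mul_mem_graded ha hx

/-- The idempotent `e_l` as an element of the regular module. -/
def eReg (E : PosGraded 𝒜 Λ) (l : Λ) : regular 𝒜 := E.e l

/-- The projective module `P(l) = A e_l`. -/
def P (E : PosGraded 𝒜 Λ) (l : Λ) : GrMod 𝒜 :=
  (regular 𝒜).sub <| HSub.mk' (regular 𝒜) (Submodule.span A {E.eReg l}) <| by
    intro x hx n
    obtain ⟨a, rfl⟩ := Submodule.mem_span_singleton.1 hx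
    have he : E.eReg l ∈ (regular 𝒜).deg 0 := E.e_mem l
    rw [proj_smul_of_mem_zero _ _ he]
    exact Submodule.mem_span_singleton.2 ⟨_, rfl⟩

/-- The degree `n` component of the graded dual of the right module `e_l A`: linear functionals
on `A` which vanish on `(1 - e_l) A` and on all homogeneous components except that of degree
`-n`. -/
def injDeg (E : PosGraded 𝒜 Λ) (l : Λ) (n : ℤ) : Submodule k (DualReg k A) where
  carrier := {f | (∀ x, f (E.e l * x) = f x) ∧ ∀ j, j ≠ -n → ∀ x ∈ 𝒜 j, f x = 0}
  zero_mem' := ⟨fun _ => rfl, fun _ _ _ _ => rfl⟩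
  add_mem' := fun {f g} hf hg => ⟨fun x => by
      rw [DualReg.add_apply, DualReg.add_apply, hf.1, hg.1],
    fun j hj x hx => by rw [DualReg.add_apply, hf.2 j hj x hx, hg.2 j hj x hx, add_zero]⟩
  smul_mem' := fun c f hf => ⟨fun x => by
      rw [DualReg.ksmul_apply, DualReg.ksmul_apply, hf.1],
    fun j hj x hx => by rw [DualReg.ksmul_apply, hf.2 j hj x hx, mul_zero]⟩

theorem smul_mem_injDeg (E : PosGraded 𝒜 Λ) (l : Λ) {i n : ℤ} {a : A} {f : DualReg k A}
    (ha : a ∈ 𝒜 i) (hf : f ∈ E.injDeg l n) : a • f ∈ E.injDeg l (i + n) := by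
  refine ⟨fun x => ?_, fun j hj x hx => ?_⟩
  · rw [DualReg.smul_apply, DualReg.smul_apply, mul_assoc, hf.1]
  · rw [DualReg.smul_apply]
    exact hf.2 (j + i) (by omega) _ (SetLike.mul_mem_graded hx ha)

/-- The underlying module of `I(l)`: the sum of the spaces `injDeg l n`. -/
def injCarrier (E : PosGraded 𝒜 Λ) (l : Λ) : Submodule A (DualReg k A) where
  carrier := (⨆ n, E.injDeg l n : Submodule k (DualReg k A))
  zero_mem' := zero_mem _
  add_mem' := fun hx hy => add_mem hx hy
  smul_mem' := by
    intro a f hf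
    have ha : a ∈ ⨆ i, 𝒜 i := by
      rw [(DirectSum.Decomposition.isInternal 𝒜).submodule_iSup_eq_top]; trivial
    change a • f ∈ (⨆ n, E.injDeg l n : Submodule k (DualReg k A))
    replace hf : f ∈ (⨆ n, E.injDeg l n : Submodule k (DualReg k A)) := hf
    induction ha using Submodule.iSup_induction' with
    | zero => rw [zero_smul]; exact zero_mem _
    | add x y _ _ hx hy => rw [add_smul]; exact add_mem hx hy
    | mem i a ha =>
      induction hf using Submodule.iSup_induction' with
      | zero => rw [smul_zero]; exact zero_mem _
      | add x y _ _ hx hy => rw [smul_add]; exact add_mem hx hy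
      | mem n f hf => exact Submodule.mem_iSup_of_mem (i + n) (E.smul_mem_injDeg l ha hf)

/-- Restriction of functionals to the component of degree `-n`. -/
def restrictDeg (𝒜 : ℤ → Submodule k A) (n : ℤ) : DualReg k A →ₗ[k] Module.Dual k (𝒜 (-n)) where
  toFun f := LinearMap.comp f (𝒜 (-n)).subtype
  map_add' _ _ := rfl
  map_smul' _ _ := rfl

/-- The indecomposable injective module `I(l)`, the injective envelope of `L(l)`, realized as the
graded dual of the right module `e_l A`. -/
def I (E : PosGraded 𝒜 Λ) (l : Λ) : GrMod 𝒜 where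
  carrier := E.injCarrier l
  deg n := (E.injDeg l n).comap ((E.injCarrier l).subtype.restrictScalars k)
  isInternal := by
    refine isInternal_of_proj _
      (V' := Π n : ℤ, Module.Dual k (𝒜 (-n)))
      (fun n => LinearMap.single k _ n ∘ₗ restrictDeg 𝒜 n ∘ₗ
        (E.injCarrier l).subtype.restrictScalars k)
      (fun n x hx h => ?_) (fun m n hmn x hx => ?_) (fun x => ?_)
    · have hr : restrictDeg 𝒜 n x.1 = 0 := by
        have := congrFun h n
        simpa using this
      apply Subtype.ext
      ext a
      have ha : a ∈ ⨆ i, 𝒜 i := by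
        rw [(DirectSum.Decomposition.isInternal 𝒜).submodule_iSup_eq_top]; trivial
      induction ha using Submodule.iSup_induction' with
      | zero => rw [map_zero, map_zero]
      | add x y _ _ hx hy => rw [map_add, map_add, hx, hy]
      | mem i a ha =>
        by_cases hi : i = -n
        · subst hi
          exact DFunLike.congr_fun hr ⟨a, ha⟩
        · exact hx.2 i hi a ha
    · have hr : restrictDeg 𝒜 n x.1 = 0 := by
        ext a
        exact hx.2 (-n) (by omega) a.1 a.2
      simp [hr]
    · obtain ⟨f, hf⟩ := x
      have hf' : f ∈ (⨆ n, E.injDeg l n : Submodule k (DualReg k A)) := hf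
      induction hf' using Submodule.iSup_induction' with
      | zero => exact zero_mem _
      | mem n f hfn => exact Submodule.mem_iSup_of_mem n hfn
      | add f g hf0 hg0 hf1 hg1 => exact add_mem (hf1 hf0) (hg1 hg0)
  smul_mem_deg := fun ha hx => E.smul_mem_injDeg l ha hx

variable [Preorder Λ]

/-- The kernel `K(l)` of `P(l) → Δ(l)`: the submodule of `P(l)` generated by the images of all
morphisms `P(m)⟨i⟩ → P(l)` with `l ≺ m`, `i ∈ ℤ`. -/
def K (E : PosGraded 𝒜 Λ) (l : Λ) : (E.P l).HSub :=
  HSub.sum fun t : (Σ m : {m : Λ // l < m}, Σ i : ℤ, Hom ((E.P m.1).shift i) (E.P l)) =>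
    t.2.2.range

/-- The standard module `Δ(l)`. -/
def Δ (E : PosGraded 𝒜 Λ) (l : Λ) : GrMod 𝒜 :=
  (E.P l).quot (E.K l)

/-- The proper costandard module: the submodule of `I(l)` which is the intersection of the kernels
of all morphisms `I(l) → I(m)⟨i⟩` with `l ⪯ m`, `i > 0`. -/
def properNabla (E : PosGraded 𝒜 Λ) (l : Λ) : GrMod 𝒜 :=
  (E.I l).sub <| HSub.inter
    fun t : (Σ m : {m : Λ // l ≤ m}, Σ i : {i : ℤ // 0 < i}, Hom (E.I l) ((E.I m.1).shift i.1)) =>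
      t.2.2.ker

/-- The algebra is standardly stratified with respect to the preorder on `Λ`: every composition
factor of `Δ(l)` is (up to shift) some `L(m)` with `m ⪯ l`, and the kernel of `P(l) → Δ(l)` has a
finite filtration whose subquotients are, up to shift, standard modules. The multiplicity of `L(m)`
in `Δ(l)` vanishes if and only if `e_m Δ(l) = 0`. -/
structure IsStandardlyStratified (E : PosGraded 𝒜 Λ) : Prop where
  factors : ∀ l m : Λ, (∃ x : E.Δ l, E.e m • x ≠ 0) → m ≤ l
  filtration : ∀ l : Λ, HasFiniteFiltration E.Δ ((E.P l).sub (E.K l))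

/-- The category `ℱ^↓(Δ) ∩ ℱ^↓(∇̄)`. -/
def IsTilting (E : PosGraded 𝒜 Λ) (M : GrMod 𝒜) : Prop :=
  InF E.Δ M ∧ InF E.properNabla M

/-- There is a short exact sequence `Δ(l) ↪ M ↠ Coker` with `Coker ∈ ℱ^↓(Δ)`. -/
def HasStandardSub (E : PosGraded 𝒜 Λ) (l : Λ) (M : GrMod 𝒜) : Prop :=
  ∃ f : Hom (E.Δ l) M, Function.Injective f.toLinearMap ∧ InF E.Δ (M.quot f.range)

end PosGraded

end

end StratTilting

end

/-! Tilting modules are recognised by the vanishing of first extension groups. The predicate `E1 M W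
c` says that Ext¹(M, W) vanishes in internal degree `c`; it is phrased as an extension property of
maps, so that no derived functors are needed. Call `M` good (`Good`) if it has no extensions by
proper costandard modules, and put `N` into `Perp` if the standard modules have no extensions by it.
The heart of the proof is that inside A^↓-gmod the class ℱ^↓(Δ) is `Good` and ℱ^↓(∇̄) is `Perp`, so
that tilting means good and perpendicular (`isTilting_iff`). Closure under summands and direct sums
is then formal, apart from the remark that K(λ) is finitely generated.

The basic orthogonality Ext¹(Δ(l), ∇̄(m)) = 0 is `E1_Δ_nabla`, proved by comparing weights. Standard
stratification also gives Ext¹(K(l), W) = 0 for every `W` in `Perp` (`E1_K`), which by dimension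
shifting is the vanishing of Ext²(Δ(l), W). An infinite filtration is truncated: its tail lives in
degrees so high that extensions vanish for degree reasons. This yields `good_of_inF` and
`perp_of_inF`.

For the converses, the preorder is measured by `level l`, the number of elements strictly below `l`.
A good module is filtered by the submodules generated by the weight spaces of level at least r. A
layer is good, concentrated in levels at most r and generated in level r, and such a module is a
direct sum of standard modules (`exists_std_decomposition`): lift a basis of the top, and show that
a lowest kernel element would be detected by a map to some ∇̄ that extends. Dually, a module in
`Perp` is filtered by the largest submodules avoiding prescribed graded weights. Refining by degree
as well, each layer has its socle in one level and one degree and is a finite direct sum of proper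
costandard modules (`exists_nabla_decomposition`).

To construct T(λ), start with Δ(λ) and, going down through the levels, form the universal extension
by standard modules that kills all Ext¹ from the standard modules of the current level
(`exists_universal_extension`). The result is tilting and contains Δ(λ) with good cokernel. Zorn's
lemma, made to work by finite dimensionality degree by degree, isolates an indecomposable summand
containing the generator of Δ(λ).

Uniqueness follows by extending the inclusions of Δ(λ) to maps in both directions, which is possible
because Ext¹ from good to perpendicular modules vanishes; the composites fix the generator, so they
are bijective by Fitting's lemma. Finally, every nonzero good module contains a shifted standard
module with good cokernel (`exists_std_submodule`), so every indecomposable tilting module is a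
shift of some T(λ). -/

set_option linter.unusedSectionVars false

noncomputable section

namespace StratTilting

/-! ### Homogeneous maps of arbitrary degree, exact sequences, sums and pushouts -/

namespace GrMod

variable {k A : Type u} [Field k] [Ring A] [Algebra k A] {𝒜 : ℤ → Submodule k A}

instance smulCommClass (M : GrMod 𝒜) : SMulCommClass A k M := IsScalarTower.to_smulCommClass'

/-- The homogeneous `A`-linear maps of degree `d`. -/
def gHom (M N : GrMod 𝒜) (d : ℤ) : Submodule k (M →ₗ[A] N) where
  carrier := {f | ∀ n, ∀ x ∈ M.deg n, f x ∈ N.deg (n + d)}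
  zero_mem' := fun _ _ _ => zero_mem _
  add_mem' := fun hf hg n x hx => add_mem (hf n x hx) (hg n x hx)
  smul_mem' := fun c _ hf n x hx => (N.deg (n + d)).smul_mem c (hf n x hx)

section

variable {M N L W X Y Z : GrMod 𝒜} {d e : ℤ}

theorem gHom_apply {f : M →ₗ[A] N} (hf : f ∈ gHom M N d) {n m : ℤ} {x : M} (hx : x ∈ M.deg n)
    (h : n + d = m) : f x ∈ N.deg m := h ▸ hf n x hx

theorem gHom_apply₀ {f : M →ₗ[A] N} (hf : f ∈ gHom M N 0) {n : ℤ} {x : M} (hx : x ∈ M.deg n) :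
    f x ∈ N.deg n := gHom_apply hf hx (add_zero n)

theorem gHom_comp {f : M →ₗ[A] N} {g : N →ₗ[A] L} (hf : f ∈ gHom M N d) (hg : g ∈ gHom N L e)
    {c : ℤ} (h : d + e = c) : g ∘ₗ f ∈ gHom M L c := fun n x hx =>
  gHom_apply hg (hf n x hx) (by omega)

theorem id_mem_gHom : (LinearMap.id : M →ₗ[A] M) ∈ gHom M M 0 := fun n x hx => by simpa using hx

theorem map_proj {f : M →ₗ[A] N} (hf : f ∈ gHom M N d) (n : ℤ) (x : M) :
    N.proj (n + d) (f x) = f (M.proj n x) := by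
  have hx := M.mem_iSup_deg x
  induction hx using Submodule.iSup_induction' with
  | mem m x hx =>
    by_cases h : m = n
    · subst h
      rw [M.proj_same hx, N.proj_same (hf _ _ hx)]
    · rw [M.proj_ne hx h, N.proj_ne (hf _ _ hx) (by omega), map_zero]
  | zero => simp
  | add x y _ _ hx hy => simp [hx, hy]

theorem map_proj₀ {f : M →ₗ[A] N} (hf : f ∈ gHom M N 0) (n : ℤ) (x : M) :
    N.proj n (f x) = f (M.proj n x) := by
  rw [← map_proj hf, add_zero]

theorem eq_zero_of_proj {x : M} (h : ∀ n, M.proj n x = 0) : x = 0 := by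
  obtain ⟨s, hs⟩ := M.sum_proj x
  rw [hs]
  exact Finset.sum_eq_zero fun n _ => h n

theorem exists_proj_ne_zero {x : M} (h : x ≠ 0) : ∃ n, M.proj n x ≠ 0 := by
  by_contra! h'
  exact h (eq_zero_of_proj h')

theorem homogeneous_induction {p : M → Prop} (h0 : p 0) (hadd : ∀ x y, p x → p y → p (x + y))
    (hdeg : ∀ n, ∀ x ∈ M.deg n, p x) (x : M) : p x := by
  have hx := M.mem_iSup_deg x
  induction hx using Submodule.iSup_induction' with
  | mem m x hx => exact hdeg m x hx
  | zero => exact h0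
  | add x y _ _ hx hy => exact hadd _ _ hx hy

theorem exists_deg_preimage {p : Y →ₗ[A] Z} (hp : p ∈ gHom Y Z e) (hs : Function.Surjective p)
    {n m : ℤ} (h : n + e = m) {z : Z} (hz : z ∈ Z.deg m) : ∃ y ∈ Y.deg n, p y = z := by
  obtain ⟨y, rfl⟩ := hs z
  subst h
  exact ⟨Y.proj n y, Y.proj_mem n y, by rw [← map_proj hp, Z.proj_same hz]⟩

theorem deg_of_map_deg {i : X →ₗ[A] Y} (hi : i ∈ gHom X Y e) (hinj : Function.Injective i)
    {n m : ℤ} (h : n + e = m) {x : X} (hx : i x ∈ Y.deg m) : x ∈ X.deg n := by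
  subst h
  have := map_proj hi n x
  rw [Y.proj_same hx] at this
  rw [hinj this]
  exact X.proj_mem n x

/-- Factorization through a surjective map of plain modules. -/
theorem exists_factor_linear {U V W : Type*} [AddCommGroup U] [AddCommGroup V] [AddCommGroup W]
    [Module A U] [Module A V] [Module A W] {p : U →ₗ[A] V} (hs : Function.Surjective p)
    (f : U →ₗ[A] W) (h : ∀ y, p y = 0 → f y = 0) : ∃ g : V →ₗ[A] W, ∀ y, g (p y) = f y := by
  refine ⟨(LinearMap.ker p).liftQ f (fun y hy => h y hy) ∘ₗ
    (p.quotKerEquivOfSurjective hs).symm.toLinearMap, fun y => ?_⟩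
  have : (p.quotKerEquivOfSurjective hs).symm (p y) = (LinearMap.ker p).mkQ y := by
    rw [LinearEquiv.symm_apply_eq]; rfl
  rw [LinearMap.comp_apply, LinearEquiv.coe_coe, this]
  rfl

theorem exists_factor {p : Y →ₗ[A] Z} (hp : p ∈ gHom Y Z e) (hs : Function.Surjective p)
    {f : Y →ₗ[A] W} (hf : f ∈ gHom Y W d) (h : ∀ y, p y = 0 → f y = 0) {c : ℤ} (hc : e + c = d) :
    ∃ g ∈ gHom Z W c, ∀ y, g (p y) = f y := by
  obtain ⟨g, hg⟩ := exists_factor_linear hs f h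
  refine ⟨g, fun n z hz => ?_, hg⟩
  obtain ⟨y, hy, rfl⟩ := exists_deg_preimage hp hs (n := n - e) (by omega) hz
  rw [hg]
  exact gHom_apply hf hy (by omega)

theorem exists_lift {i : X →ₗ[A] Y} (hi : i ∈ gHom X Y e) (hinj : Function.Injective i)
    {f : L →ₗ[A] Y} (hf : f ∈ gHom L Y d) (h : ∀ y, ∃ x, i x = f y) {c : ℤ} (hc : c + e = d) :
    ∃ g ∈ gHom L X c, ∀ y, i (g y) = f y := by
  let φ := LinearEquiv.ofInjective i hinj
  let g : L →ₗ[A] X := φ.symm.toLinearMap ∘ₗ f.codRestrict (LinearMap.range i) (fun y => h y)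
  have hg : ∀ y, i (g y) = f y := fun y => by
    have : φ (g y) = f.codRestrict (LinearMap.range i) (fun y => h y) y := by simp [g]
    exact congrArg Subtype.val this
  refine ⟨g, fun n y hy => ?_, hg⟩
  refine deg_of_map_deg hi hinj (m := n + d) (by omega) ?_
  rw [hg]
  exact hf n y hy

end

section

variable [GradedAlgebra 𝒜]

variable {M N L W X Y Z : GrMod 𝒜} {d e : ℤ}

theorem proj_smul {i : ℤ} {a : A} (ha : a ∈ 𝒜 i) (n : ℤ) (x : M) :
    M.proj (i + n) (a • x) = a • M.proj n x := by
  induction x using homogeneous_induction with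
  | h0 => simp
  | hadd x y hx hy => simp [hx, hy]
  | hdeg m x hx =>
    by_cases h : m = n
    · subst h
      rw [M.proj_same hx, M.proj_same (M.smul_mem_deg ha hx)]
    · rw [M.proj_ne hx h, M.proj_ne (M.smul_mem_deg ha hx) (by omega), smul_zero]

theorem proj_smul_zero {a : A} (ha : a ∈ 𝒜 0) (n : ℤ) (x : M) :
    M.proj n (a • x) = a • M.proj n x := by
  have := proj_smul ha n x
  rwa [zero_add] at this

/-- The kernel of a homogeneous map. -/
def kerH (f : M →ₗ[A] N) (hf : f ∈ gHom M N d) : M.HSub :=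
  HSub.mk' M (LinearMap.ker f) fun x hx n => by
    rw [LinearMap.mem_ker] at hx ⊢
    rw [← map_proj hf, hx, map_zero]

/-- The preimage of a graded submodule under a homogeneous map. -/
def comapH (f : M →ₗ[A] N) (hf : f ∈ gHom M N d) (F : N.HSub) : M.HSub :=
  HSub.mk' M (F.toSubmodule.comap f) fun x hx n => by
    rw [Submodule.mem_comap] at hx ⊢
    rw [← map_proj hf]
    exact F.proj_mem _ hx

/-- The image of a graded submodule under a homogeneous map. -/
def mapH (f : M →ₗ[A] N) (hf : f ∈ gHom M N d) (F : M.HSub) : N.HSub :=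
  HSub.mk' N (F.toSubmodule.map f) fun x hx n => by
    obtain ⟨y, hy, rfl⟩ := hx
    refine ⟨M.proj (n - d) y, F.proj_mem _ hy, ?_⟩
    rw [← map_proj hf, sub_add_cancel]

/-- The range of a homogeneous map. -/
def rangeH (f : M →ₗ[A] N) (hf : f ∈ gHom M N d) : N.HSub :=
  HSub.mk' N (LinearMap.range f) fun x hx n => by
    obtain ⟨y, rfl⟩ := hx
    refine ⟨M.proj (n - d) y, ?_⟩
    rw [← map_proj hf, sub_add_cancel]

/-- The submodule generated by a set of homogeneous elements. -/
def spanH (s : Set M) (hs : ∀ x ∈ s, ∃ n, x ∈ M.deg n) : M.HSub :=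
  HSub.mk' M (Submodule.span A s) fun x hx n => by
    induction hx using Submodule.span_induction generalizing n with
    | mem x hx =>
      obtain ⟨m, hm⟩ := hs x hx
      by_cases h : m = n
      · subst h
        rw [M.proj_same hm]
        exact Submodule.subset_span hx
      · rw [M.proj_ne hm h]
        exact zero_mem _
    | zero => simp
    | add x y _ _ hx hy => rw [map_add]; exact add_mem (hx n) (hy n)
    | smul a x _ hx =>
      induction a using DirectSum.Decomposition.inductionOn 𝒜 with
      | zero => simp
      | add a b ha hb => rw [add_smul, map_add]; exact add_mem ha hb
      | @homogeneous m a =>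
        have := proj_smul a.2 (n - m) x
        rw [add_sub_cancel] at this
        rw [this]
        exact Submodule.smul_mem _ _ (hx _)

variable (M) in
/-- The whole module as a graded submodule. -/
def topH : M.HSub := HSub.mk' M ⊤ fun _ _ _ => trivial

/-- The inclusion of a graded submodule. -/
def subι (F : M.HSub) : M.sub F →ₗ[A] M := F.toSubmodule.subtype

theorem subι_mem (F : M.HSub) : subι F ∈ gHom (M.sub F) M 0 := fun n x hx => by
  rw [add_zero]; exact hx

theorem subι_injective (F : M.HSub) : Function.Injective (subι F) := Subtype.val_injective

theorem subι_mem_sub {F : M.HSub} (x : M.sub F) : subι F x ∈ F.toSubmodule := x.2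

theorem exists_subι {F : M.HSub} {x : M} (hx : x ∈ F.toSubmodule) : ∃ y, subι F y = x :=
  ⟨⟨x, hx⟩, rfl⟩

theorem exists_subι_deg {F : M.HSub} {n : ℤ} {x : M} (hx : x ∈ F.toSubmodule)
    (hn : x ∈ M.deg n) : ∃ y ∈ (M.sub F).deg n, subι F y = x :=
  ⟨⟨x, hx⟩, hn, rfl⟩

theorem mem_sub_deg {F : M.HSub} {n : ℤ} {x : M.sub F} :
    x ∈ (M.sub F).deg n ↔ subι F x ∈ M.deg n := Iff.rfl

/-- The projection onto a quotient. -/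
def quotπ (F : M.HSub) : M →ₗ[A] M.quot F := F.toSubmodule.mkQ

theorem quotπ_mem (F : M.HSub) : quotπ F ∈ gHom M (M.quot F) 0 := fun n x hx => by
  rw [add_zero]; exact ⟨x, hx, rfl⟩

theorem quotπ_surjective (F : M.HSub) : Function.Surjective (quotπ F) :=
  F.toSubmodule.mkQ_surjective

theorem quotπ_eq_zero {F : M.HSub} {x : M} : quotπ F x = 0 ↔ x ∈ F.toSubmodule :=
  Submodule.Quotient.mk_eq_zero _

/-- Short exact sequences of graded modules in which the first map has degree zero and the second
has degree `e`. -/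
structure SES (i : X →ₗ[A] Y) (p : Y →ₗ[A] M) (e : ℤ) : Prop where
  hi : i ∈ gHom X Y 0
  hp : p ∈ gHom Y M e
  inj : Function.Injective i
  surj : Function.Surjective p
  exact : ∀ y, p y = 0 ↔ ∃ x, i x = y

theorem SES.comp_eq_zero {i : X →ₗ[A] Y} {p : Y →ₗ[A] M} (h : SES i p e) (x : X) : p (i x) = 0 :=
  (h.exact _).2 ⟨x, rfl⟩

theorem ses_sub_quot (F : M.HSub) : SES (subι F) (quotπ F) 0 where
  hi := subι_mem F
  hp := quotπ_mem F
  inj := subι_injective F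
  surj := quotπ_surjective F
  exact := fun _ => quotπ_eq_zero.trans ⟨fun h => exists_subι h, fun ⟨x, hx⟩ => hx ▸ x.2⟩

theorem ses_ker {p : Y →ₗ[A] M} (hp : p ∈ gHom Y M e) (hs : Function.Surjective p) :
    SES (subι (kerH p hp)) p e where
  hi := subι_mem _
  hp := hp
  inj := subι_injective _
  surj := hs
  exact := fun _ => ⟨fun h => exists_subι (F := kerH p hp) h, fun ⟨x, hx⟩ => hx ▸ x.2⟩

theorem ses_quot_range {i : X →ₗ[A] Y} (hi : i ∈ gHom X Y 0) (hinj : Function.Injective i) :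
    SES i (quotπ (rangeH i hi)) 0 where
  hi := hi
  hp := quotπ_mem _
  inj := hinj
  surj := quotπ_surjective _
  exact := fun _ => quotπ_eq_zero

/-- The inclusion of one graded submodule into another. -/
def subIncl {F' F : M.HSub} (h : F'.toSubmodule ≤ F.toSubmodule) : M.sub F' →ₗ[A] M.sub F :=
  Submodule.inclusion h

theorem subι_subIncl {F' F : M.HSub} (h : F'.toSubmodule ≤ F.toSubmodule) (x : M.sub F') :
    subι F (subIncl h x) = subι F' x := rfl

/-- The projection onto a subquotient. -/
def subquotπ (F F' : M.HSub) : M.sub F →ₗ[A] M.subquot F F' := quotπ _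

theorem ses_subquot {F' F : M.HSub} (h : F'.toSubmodule ≤ F.toSubmodule) :
    SES (subIncl h) (subquotπ F F') 0 where
  hi := fun n x hx => by rw [add_zero]; exact hx
  hp := quotπ_mem _
  inj := Submodule.inclusion_injective h
  surj := quotπ_surjective _
  exact := fun y => quotπ_eq_zero.trans
    ⟨fun hy => ⟨⟨subι F y, hy⟩, rfl⟩, fun ⟨x, hx⟩ => hx ▸ x.2⟩

theorem subquotπ_mem (F F' : M.HSub) : subquotπ F F' ∈ gHom (M.sub F) (M.subquot F F') 0 :=
  quotπ_mem _

theorem subquotπ_surjective (F F' : M.HSub) : Function.Surjective (subquotπ F F') :=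
  quotπ_surjective _

theorem subquotπ_eq_zero {F F' : M.HSub} {x : M.sub F} :
    subquotπ F F' x = 0 ↔ subι F x ∈ F'.toSubmodule := quotπ_eq_zero

/-- The identity map from a module to its shift. -/
def shiftEquiv (M : GrMod 𝒜) (i : ℤ) : M ≃ₗ[A] M.shift i := LinearEquiv.refl A M

theorem shiftEquiv_mem (M : GrMod 𝒜) (i : ℤ) :
    (shiftEquiv M i).toLinearMap ∈ gHom M (M.shift i) (-i) := fun n x hx => by
  change x ∈ M.deg (i + (n + -i))
  rwa [show i + (n + -i) = n by ring]

theorem shiftEquiv_symm_mem (M : GrMod 𝒜) (i : ℤ) :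
    (shiftEquiv M i).symm.toLinearMap ∈ gHom (M.shift i) M i := fun n x hx => by
  change x ∈ M.deg (n + i)
  rw [add_comm]
  exact hx

/-- The direct sum of two graded modules. -/
def prod (M N : GrMod 𝒜) : GrMod 𝒜 where
  carrier := M × N
  deg n := (M.deg n).prod (N.deg n)
  isInternal := by
    refine isInternal_of_proj _ (fun n => (M.proj n).prodMap (N.proj n)) (fun n x hx h => ?_)
      (fun m n hmn x hx => ?_) (fun x => ?_)
    · have h1 := congrArg Prod.fst h
      have h2 := congrArg Prod.snd h
      simp only [LinearMap.prodMap_apply, M.proj_same hx.1, N.proj_same hx.2] at h1 h2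
      exact Prod.ext h1 h2
    · simp [M.proj_ne hx.1 hmn, N.proj_ne hx.2 hmn]
    · obtain ⟨x, y⟩ := x
      obtain ⟨s, hs⟩ := M.sum_proj x
      obtain ⟨t, ht⟩ := N.sum_proj y
      have : (x, y) = LinearMap.inl k M N x + LinearMap.inr k M N y := by simp
      rw [this, hs, ht, map_sum, map_sum]
      refine add_mem (Submodule.sum_mem _ fun n _ => Submodule.mem_iSup_of_mem n ?_)
        (Submodule.sum_mem _ fun n _ => Submodule.mem_iSup_of_mem n ?_)
      · exact ⟨M.proj_mem n x, zero_mem _⟩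
      · exact ⟨zero_mem _, N.proj_mem n y⟩
  smul_mem_deg := fun ha hx => ⟨M.smul_mem_deg ha hx.1, N.smul_mem_deg ha hx.2⟩

variable (M N) in
/-- The first inclusion. -/
def inl : M →ₗ[A] M.prod N := LinearMap.inl A M N

variable (M N) in
/-- The second inclusion. -/
def inr : N →ₗ[A] M.prod N := LinearMap.inr A M N

variable (M N) in
/-- The first projection. -/
def fst : M.prod N →ₗ[A] M := LinearMap.fst A M N

variable (M N) in
/-- The second projection. -/
def snd : M.prod N →ₗ[A] N := LinearMap.snd A M N

theorem inl_mem : inl M N ∈ gHom M (M.prod N) 0 := fun n x hx => by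
  rw [add_zero]; exact ⟨hx, zero_mem _⟩

theorem inr_mem : inr M N ∈ gHom N (M.prod N) 0 := fun n x hx => by
  rw [add_zero]; exact ⟨zero_mem _, hx⟩

theorem fst_mem : fst M N ∈ gHom (M.prod N) M 0 := fun n x hx => by
  rw [add_zero]; exact hx.1

theorem snd_mem : snd M N ∈ gHom (M.prod N) N 0 := fun n x hx => by
  rw [add_zero]; exact hx.2

@[simp] theorem fst_inl (x : M) : fst M N (inl M N x) = x := rfl
@[simp] theorem snd_inl (x : M) : snd M N (inl M N x) = 0 := rfl
@[simp] theorem fst_inr (x : N) : fst M N (inr M N x) = 0 := rfl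
@[simp] theorem snd_inr (x : N) : snd M N (inr M N x) = x := rfl

theorem prod_ext {x y : M.prod N} (h1 : fst M N x = fst M N y) (h2 : snd M N x = snd M N y) :
    x = y := Prod.ext h1 h2

/-- The map out of a direct sum of two modules. -/
def coprodH (f : M →ₗ[A] L) (g : N →ₗ[A] L) : M.prod N →ₗ[A] L := f ∘ₗ fst M N + g ∘ₗ snd M N

@[simp] theorem coprodH_inl (f : M →ₗ[A] L) (g : N →ₗ[A] L) (x : M) :
    coprodH f g (inl M N x) = f x := by simp [coprodH]

@[simp] theorem coprodH_inr (f : M →ₗ[A] L) (g : N →ₗ[A] L) (x : N) :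
    coprodH f g (inr M N x) = g x := by simp [coprodH]

theorem coprodH_mem {f : M →ₗ[A] L} {g : N →ₗ[A] L} (hf : f ∈ gHom M L d) (hg : g ∈ gHom N L d) :
    coprodH f g ∈ gHom (M.prod N) L d :=
  add_mem (gHom_comp fst_mem hf (zero_add d)) (gHom_comp snd_mem hg (zero_add d))

/-! ### Direct sums -/

section DirectSum

variable {ι : Type u} {S T : ι → GrMod 𝒜}

variable (S) in
/-- The inclusion of a summand. -/
def dsι (i : ι) : S i →ₗ[A] directSum S := by
  classical exact DFinsupp.lsingle (R := A) (M := fun i => (S i).carrier) i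

variable (S) in
/-- The projection onto a summand. -/
def dsπ (i : ι) : directSum S →ₗ[A] S i :=
  DFinsupp.lapply (R := A) (M := fun i => (S i).carrier) i

theorem mem_directSum_deg {n : ℤ} {x : directSum S} :
    x ∈ (directSum S).deg n ↔ ∀ i, dsπ S i x ∈ (S i).deg n :=
  Submodule.mem_iInf (p := fun i => ((S i).deg n).comap
    (DFinsupp.lapply (R := k) (M := fun i => (S i).carrier) i))

theorem dsπ_mem (i : ι) : dsπ S i ∈ gHom (directSum S) (S i) 0 := fun n x hx => by
  rw [add_zero]; exact mem_directSum_deg.1 hx i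

@[simp] theorem dsπ_dsι_same (i : ι) (x : S i) : dsπ S i (dsι S i x) = x := by
  classical
  exact DFinsupp.single_eq_same (β := fun i => (S i).carrier)

theorem dsπ_dsι_ne {i j : ι} (h : j ≠ i) (x : S i) : dsπ S j (dsι S i x) = 0 := by
  classical
  exact DFinsupp.single_eq_of_ne (β := fun i => (S i).carrier) h

theorem dsι_mem (i : ι) : dsι S i ∈ gHom (S i) (directSum S) 0 := fun n x hx => by
  rw [add_zero, mem_directSum_deg]
  intro j
  by_cases h : j = i
  · subst h; simpa using hx
  · rw [dsπ_dsι_ne h]; exact zero_mem _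

theorem ds_ext {x y : directSum S} (h : ∀ i, dsπ S i x = dsπ S i y) : x = y := DFinsupp.ext h

theorem ds_finite (x : directSum S) : {i | dsπ S i x ≠ 0}.Finite := by
  classical
  have : Finite {i | DFunLike.coe (F := Π₀ i, S i) x i ≠ 0} := DFinsupp.finite_support x
  exact this

theorem ds_sum {x : directSum S} {s : Finset ι} (hs : ∀ i, dsπ S i x ≠ 0 → i ∈ s) :
    x = ∑ i ∈ s, dsι S i (dsπ S i x) := by
  classical
  refine ds_ext fun j => ?_
  rw [map_sum]
  by_cases hj : j ∈ s
  · rw [Finset.sum_eq_single j]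
    · simp
    · exact fun i _ hij => dsπ_dsι_ne hij.symm _
    · exact fun h => absurd hj h
  · rw [Finset.sum_eq_zero]
    · by_contra h
      exact hj (hs j h)
    · intro i hi
      exact dsπ_dsι_ne (ne_of_mem_of_not_mem hi hj).symm _

theorem ds_exists_sum (x : directSum S) : ∃ s : Finset ι, x = ∑ i ∈ s, dsι S i (dsπ S i x) :=
  ⟨(ds_finite x).toFinset, ds_sum fun i hi => by simpa using hi⟩

theorem ds_hom_ext {f g : directSum S →ₗ[A] N} (h : ∀ i x, f (dsι S i x) = g (dsι S i x)) :
    f = g := by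
  ext x
  obtain ⟨s, hs⟩ := ds_exists_sum x
  rw [hs, map_sum, map_sum]
  exact Finset.sum_congr rfl fun i _ => h i _

/-- The map out of a direct sum given by maps on the summands. -/
def dsDesc (g : ∀ i, S i →ₗ[A] N) : directSum S →ₗ[A] N := by
  classical exact DFinsupp.lsum ℕ (M := fun i => (S i).carrier) g

@[simp] theorem dsDesc_dsι (g : ∀ i, S i →ₗ[A] N) (i : ι) (x : S i) :
    dsDesc g (dsι S i x) = g i x := by
  classical
  exact DFinsupp.lsum_single ℕ (M := fun i => (S i).carrier) g i x

theorem dsDesc_mem {g : ∀ i, S i →ₗ[A] N} (hg : ∀ i, g i ∈ gHom (S i) N d) :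
    dsDesc g ∈ gHom (directSum S) N d := fun n x hx => by
  obtain ⟨s, hs⟩ := ds_exists_sum x
  rw [hs, map_sum]
  refine Submodule.sum_mem _ fun i _ => ?_
  rw [dsDesc_dsι]
  exact hg i n _ (mem_directSum_deg.1 hx i)

/-- The direct sum of a family of maps. -/
def dsMap (g : ∀ i, S i →ₗ[A] T i) : directSum S →ₗ[A] directSum T :=
  dsDesc fun i => dsι T i ∘ₗ g i

@[simp] theorem dsMap_dsι (g : ∀ i, S i →ₗ[A] T i) (i : ι) (x : S i) :
    dsMap g (dsι S i x) = dsι T i (g i x) := by simp [dsMap]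

@[simp] theorem dsπ_dsMap (g : ∀ i, S i →ₗ[A] T i) (i : ι) (x : directSum S) :
    dsπ T i (dsMap g x) = g i (dsπ S i x) := by
  have : dsπ T i ∘ₗ dsMap g = g i ∘ₗ dsπ S i := ds_hom_ext fun j y => by
    by_cases h : i = j
    · subst h; simp
    · simp [dsπ_dsι_ne h]
  exact LinearMap.congr_fun this x

theorem dsMap_mem {g : ∀ i, S i →ₗ[A] T i} (hg : ∀ i, g i ∈ gHom (S i) (T i) d) :
    dsMap g ∈ gHom (directSum S) (directSum T) d := fun n x hx => by
  rw [mem_directSum_deg]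
  intro i
  rw [dsπ_dsMap]
  exact hg i n _ (mem_directSum_deg.1 hx i)

theorem ds_exists_of_forall {P : ∀ i, S i → T i → Prop} (h0 : ∀ i, P i 0 0) (x : directSum T)
    (h : ∀ i, ∃ y, P i y (dsπ T i x)) : ∃ y : directSum S, ∀ i, P i (dsπ S i y) (dsπ T i x) := by
  classical
  choose y hy using h
  refine ⟨∑ i ∈ (ds_finite x).toFinset, dsι S i (y i), fun i => ?_⟩
  rw [map_sum]
  by_cases hi : i ∈ (ds_finite x).toFinset
  · rw [Finset.sum_eq_single i]
    · simpa using hy i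
    · exact fun j _ hij => dsπ_dsι_ne hij.symm _
    · exact fun h => absurd hi h
  · rw [Finset.sum_eq_zero]
    · have : dsπ T i x = 0 := by simpa using hi
      rw [this]
      exact h0 i
    · intro j hj
      exact dsπ_dsι_ne (ne_of_mem_of_not_mem hj hi).symm _

theorem ses_directSum {R : ι → GrMod 𝒜} {f : ∀ i, S i →ₗ[A] T i} {g : ∀ i, T i →ₗ[A] R i}
    (h : ∀ i, SES (f i) (g i) e) : SES (dsMap f) (dsMap g) e where
  hi := dsMap_mem fun i => (h i).hi
  hp := dsMap_mem fun i => (h i).hp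
  inj := fun x y hxy => ds_ext fun i => (h i).inj (by
    rw [← dsπ_dsMap, hxy, dsπ_dsMap])
  surj := fun z => by
    obtain ⟨y, hy⟩ := ds_exists_of_forall (S := T) (P := fun i y z => g i y = z)
      (fun i => map_zero _) z (fun i => (h i).surj _)
    exact ⟨y, ds_ext fun i => by rw [dsπ_dsMap, hy]⟩
  exact := fun y => by
    constructor
    · intro hy
      obtain ⟨x, hx⟩ := ds_exists_of_forall (S := S) (P := fun i x y => f i x = y)
        (fun i => map_zero _) y (fun i => ((h i).exact _).1 (by
          rw [← dsπ_dsMap, hy, map_zero]))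
      exact ⟨x, ds_ext fun i => by rw [dsπ_dsMap, hx]⟩
    · rintro ⟨x, rfl⟩
      refine ds_ext fun i => ?_
      rw [dsπ_dsMap, dsπ_dsMap, (h i).comp_eq_zero, map_zero]

end DirectSum

/-- Pushout of a short exact sequence. -/
theorem exists_pushout {i : X →ₗ[A] Y} {p : Y →ₗ[A] Z} (h : SES i p e) {f : X →ₗ[A] W}
    (hf : f ∈ gHom X W 0) : ∃ (V : GrMod 𝒜) (i' : W →ₗ[A] V) (q : Y →ₗ[A] V) (p' : V →ₗ[A] Z),
      SES i' p' e ∧ q ∈ gHom Y V 0 ∧ (∀ x, q (i x) = i' (f x)) ∧ ∀ y, p' (q y) = p y := by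
  let j : X →ₗ[A] W.prod Y := inr W Y ∘ₗ i - inl W Y ∘ₗ f
  have hj : j ∈ gHom X (W.prod Y) 0 :=
    sub_mem (gHom_comp h.hi inr_mem (add_zero _)) (gHom_comp hf inl_mem (add_zero _))
  have hp0 : p ∘ₗ snd W Y ∈ gHom (W.prod Y) Z e := gHom_comp snd_mem h.hp (zero_add _)
  have hj0 : ∀ v, quotπ (rangeH j hj) v = 0 ↔ ∃ x, j x = v := fun v => quotπ_eq_zero
  obtain ⟨p', hp', hpp'⟩ := exists_factor (quotπ_mem (rangeH j hj)) (quotπ_surjective _) hp0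
    (fun y hy => by
      obtain ⟨x, rfl⟩ := (hj0 y).1 hy
      simp [j, h.comp_eq_zero]) (zero_add e)
  refine ⟨(W.prod Y).quot (rangeH j hj), quotπ _ ∘ₗ inl W Y, quotπ _ ∘ₗ inr W Y, p', ⟨?_, hp',
    ?_, ?_, ?_⟩, ?_, ?_, ?_⟩
  · exact gHom_comp inl_mem (quotπ_mem _) (add_zero _)
  · rw [injective_iff_map_eq_zero]
    intro w hw
    obtain ⟨x, hx⟩ := (hj0 _).1 hw
    have h2 := congrArg (snd W Y) hx
    have h1 := congrArg (fst W Y) hx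
    have h3 : i x = 0 := by simpa [j] using h2
    have h4 : x = 0 := h.inj (by rw [h3, map_zero])
    subst h4
    simpa using h1.symm
  · intro z
    obtain ⟨y, rfl⟩ := h.surj z
    exact ⟨quotπ _ (inr W Y y), by rw [hpp']; simp⟩
  · intro v
    obtain ⟨v, rfl⟩ := quotπ_surjective _ v
    rw [hpp']
    constructor
    · intro hv
      obtain ⟨x, hx⟩ := (h.exact _).1 hv
      refine ⟨fst W Y v + f x, ?_⟩
      rw [← sub_eq_zero, LinearMap.comp_apply, ← map_sub, hj0]
      refine ⟨-x, prod_ext ?_ ?_⟩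
      · simp [j]
      · simp [j, hx]
    · rintro ⟨w, hw⟩
      rw [LinearMap.comp_apply] at hw
      have := hpp' (inl W Y w)
      rw [hw, hpp'] at this
      simpa using this
  · exact gHom_comp inr_mem (quotπ_mem _) (add_zero _)
  · intro x
    rw [← sub_eq_zero, LinearMap.comp_apply, LinearMap.comp_apply, ← map_sub, hj0]
    exact ⟨x, rfl⟩
  · intro y
    rw [LinearMap.comp_apply, hpp']
    simp

end

end GrMod

/-! ### Vanishing of Ext¹ as an extension property -/

namespace GrMod

variable {k A : Type u} [Field k] [Ring A] [Algebra k A] {𝒜 : ℤ → Submodule k A}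
variable [GradedAlgebra 𝒜]

/-- Vanishing of the first extension group, with respect to shifts by `c`: in every extension of
`M` (up to shift) by `X`, maps from `X` to `W` extend. -/
def E1 (M W : GrMod 𝒜) (c : ℤ) : Prop :=
  ∀ (X Y : GrMod 𝒜) (i : X →ₗ[A] Y) (p : Y →ₗ[A] M) (e : ℤ), SES i p e →
    ∀ f ∈ gHom X W (c + e), ∃ g ∈ gHom Y W (c + e), ∀ x, g (i x) = f x

variable {M N L W X Y Z Q : GrMod 𝒜} {c d e : ℤ}

theorem gHom_congr {f : M →ₗ[A] N} (hf : f ∈ gHom M N d) (h : d = e) : f ∈ gHom M N e := h ▸ hf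

theorem exists_inverse {q : M →ₗ[A] N} (hq : q ∈ gHom M N d) (hb : Function.Bijective q) :
    ∃ q' ∈ gHom N M (-d), (∀ x, q' (q x) = x) ∧ ∀ y, q (q' y) = y := by
  obtain ⟨q', hq', h⟩ := exists_lift hq hb.1 (id_mem_gHom (M := N)) (fun y => hb.2 y)
    (c := -d) (by omega)
  exact ⟨q', hq', fun x => hb.1 (h _), h⟩

/-- The preimage `F` of `L` in `Y` is an extension of `L` by `X`, and `Y` is an extension of `N` by
`F`. A map on `X` is extended first to `F` and then to `Y`. -/
theorem E1.ext {i₀ : L →ₗ[A] M} {p₀ : M →ₗ[A] N} (h₀ : SES i₀ p₀ 0) (hL : E1 L W c)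
    (hN : E1 N W c) : E1 M W c := by
  intro X Y i p e h f hf
  have hq : p₀ ∘ₗ p ∈ gHom Y N e := gHom_comp h.hp h₀.hp (add_zero _)
  have hqs : Function.Surjective (p₀ ∘ₗ p) := h₀.surj.comp h.surj
  have hF := ses_ker hq hqs
  set F := kerH _ hq
  have hFker : ∀ y, p₀ (p (subι F y)) = 0 := fun y => hF.comp_eq_zero y
  obtain ⟨p', hp', hp'p⟩ := exists_lift h₀.hi h₀.inj (gHom_comp (subι_mem F) h.hp (zero_add e))
    (fun y => (h₀.exact _).1 (hFker y)) (c := e) (add_zero e)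
  obtain ⟨i', hi', hi'i⟩ := exists_lift hF.hi hF.inj h.hi
    (fun x => (hF.exact _).1 (by simp [h.comp_eq_zero])) (c := 0) (add_zero 0)
  have hs' : SES i' p' e := by
    refine ⟨hi', hp', ?_, ?_, ?_⟩
    · intro x x' hx
      apply h.inj
      rw [← hi'i, hx, hi'i]
    · intro z
      obtain ⟨y, hy⟩ := h.surj (i₀ z)
      obtain ⟨y', hy'⟩ := (hF.exact y).1 (by simp [hy, h₀.comp_eq_zero])
      refine ⟨y', h₀.inj ?_⟩
      rw [hp'p, LinearMap.comp_apply, hy', hy]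
    · intro y
      rw [← map_eq_zero_iff _ h₀.inj, hp'p, LinearMap.comp_apply, h.exact]
      refine exists_congr fun x => ?_
      rw [← hi'i, hF.inj.eq_iff]
  obtain ⟨g, hg, hgf⟩ := hL _ _ i' p' e hs' f hf
  obtain ⟨g', hg', hgg'⟩ := hN _ _ _ _ e hF g hg
  exact ⟨g', hg', fun x => by rw [← hi'i, hgg', hgf]⟩

theorem E1.of_bijective {q : M →ₗ[A] N} (hq : q ∈ gHom M N d) (hb : Function.Bijective q)
    (h : E1 M W c) {c' : ℤ} (hc : c' + d = c) : E1 N W c' := by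
  intro X Y i p e hs f hf
  obtain ⟨p', hp', hpp'⟩ := exists_lift hq hb.1 hs.hp (fun y => hb.2 _) (c := e - d) (by omega)
  have hs' : SES i p' (e - d) := by
    refine ⟨hs.hi, hp', hs.inj, fun z => ?_, fun y => ?_⟩
    · obtain ⟨y, hy⟩ := hs.surj (q z)
      exact ⟨y, hb.1 (by rw [hpp', hy])⟩
    · rw [← hs.exact, ← hpp', map_eq_zero_iff _ hb.1]
  obtain ⟨g, hg, hgf⟩ := h _ _ _ _ _ hs' f (gHom_congr hf (by omega))
  exact ⟨g, gHom_congr hg (by omega), hgf⟩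

theorem E1.of_bijective' {q : M →ₗ[A] N} (hq : q ∈ gHom M N d) (hb : Function.Bijective q)
    (h : E1 N W c) {c' : ℤ} (hc : c' - d = c) : E1 M W c' := by
  obtain ⟨q', hq', h1, h2⟩ := exists_inverse hq hb
  exact h.of_bijective hq' ⟨Function.LeftInverse.injective h2,
    Function.RightInverse.surjective h1⟩ (by omega)

/-- Pullbacks of extensions. -/
theorem exists_pullback {i : X →ₗ[A] Y} {p : Y →ₗ[A] N} (h : SES i p e) {t : M →ₗ[A] N}
    (ht : t ∈ gHom M N 0) : ∃ (V : GrMod 𝒜) (i' : X →ₗ[A] V) (a : V →ₗ[A] Y) (b : V →ₗ[A] M),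
      SES i' b e ∧ a ∈ gHom V Y 0 ∧ (∀ x, a (i' x) = i x) ∧ (∀ v, p (a v) = t (b v)) ∧
      (∀ v, a v = 0 → b v = 0 → v = 0) ∧
      ∀ (L : GrMod 𝒜) (α : L →ₗ[A] Y) (β : L →ₗ[A] M), α ∈ gHom L Y 0 → β ∈ gHom L M e →
        (∀ x, p (α x) = t (β x)) → ∃ γ ∈ gHom L V 0, ∀ x, a (γ x) = α x ∧ b (γ x) = β x := by
  -- `M` is replaced by a shift so that both legs of the fibre product map to `N` in the same degree
  -- `e`; `V` is then the kernel of their difference.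
  let s : M.shift e →ₗ[A] M := (shiftEquiv M e).symm.toLinearMap
  have hs : s ∈ gHom (M.shift e) M e := shiftEquiv_symm_mem M e
  let b₀ : Y.prod (M.shift e) →ₗ[A] M := s ∘ₗ snd Y (M.shift e)
  have hb₀ : b₀ ∈ gHom (Y.prod (M.shift e)) M e := gHom_comp snd_mem hs (zero_add e)
  let δ : Y.prod (M.shift e) →ₗ[A] N := coprodH p (-(t ∘ₗ s))
  have hδ : δ ∈ gHom (Y.prod (M.shift e)) N e := coprodH_mem h.hp
    (neg_mem (gHom_comp hs ht (add_zero e)))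
  let V := (Y.prod (M.shift e)).sub (kerH δ hδ)
  have hV : ∀ v : Y.prod (M.shift e), δ v = 0 → ∃ y : V, subι (kerH δ hδ) y = v :=
    fun v hv => exists_subι (F := kerH δ hδ) hv
  have hδ' : ∀ v, δ v = p (fst _ _ v) - t (b₀ v) := fun v => (sub_eq_add_neg _ _).symm
  have hss : ∀ x, s (shiftEquiv M e x) = x := fun x => rfl
  have huniv : ∀ (L : GrMod 𝒜) (α : L →ₗ[A] Y) (β : L →ₗ[A] M), α ∈ gHom L Y 0 →
      β ∈ gHom L M e → (∀ x, p (α x) = t (β x)) → ∃ γ ∈ gHom L V 0, ∀ x,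
        fst Y (M.shift e) (subι _ (γ x)) = α x ∧ b₀ (subι _ (γ x)) = β x := by
    intro L α β hα hβ hαβ
    have hm : inl Y (M.shift e) ∘ₗ α + inr Y (M.shift e) ∘ₗ (shiftEquiv M e).toLinearMap ∘ₗ β ∈
        gHom L (Y.prod (M.shift e)) 0 := add_mem (gHom_comp hα inl_mem (add_zero 0))
      (gHom_comp (gHom_comp hβ (shiftEquiv_mem M e) (add_neg_cancel e)) inr_mem (add_zero 0))
    obtain ⟨γ, hγ, hγ'⟩ := exists_lift (subι_mem (kerH δ hδ)) (subι_injective _) hm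
      (fun x => hV _ (by simp [hδ', b₀, hαβ, hss])) (c := 0) (add_zero 0)
    exact ⟨γ, hγ, fun x => by rw [hγ']; simp [b₀, hss]⟩
  obtain ⟨i', hi', hi''⟩ := huniv X i 0 h.hi (zero_mem _) (fun x => by simp [h.comp_eq_zero])
  have hext : ∀ v : V, fst Y (M.shift e) (subι _ v) = 0 → b₀ (subι _ v) = 0 → v = 0 := by
    intro v h1 h2
    refine subι_injective _ (prod_ext ?_ ?_)
    · rw [h1, map_zero, map_zero]
    · refine (shiftEquiv M e).symm.injective ?_
      rw [map_zero, map_zero]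
      exact h2
  have hpt : ∀ v : V, p (fst Y (M.shift e) (subι _ v)) = t (b₀ (subι _ v)) := fun v =>
    sub_eq_zero.1 ((hδ' _).symm.trans (show δ (subι _ v) = 0 from v.2))
  refine ⟨V, i', fst Y (M.shift e) ∘ₗ subι _, b₀ ∘ₗ subι _, ⟨hi', ?_, ?_, ?_, ?_⟩, ?_,
    fun x => (hi'' x).1, hpt, hext, huniv⟩
  · exact gHom_comp (subι_mem _) hb₀ (zero_add e)
  · intro x x' hx
    apply h.inj
    rw [← (hi'' x).1, hx, (hi'' x').1]
  · intro m
    obtain ⟨y, hy⟩ := h.surj (t m)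
    obtain ⟨v, hv⟩ := hV (inl _ _ y + inr _ _ (shiftEquiv M e m)) (by simp [hδ', b₀, hy, hss])
    exact ⟨v, by simp [hv, b₀, hss]⟩
  · intro v
    constructor
    · intro hv
      have hv' : b₀ (subι _ v) = 0 := hv
      obtain ⟨x, hx⟩ := (h.exact (fst Y (M.shift e) (subι _ v))).1 (by rw [hpt, hv', map_zero])
      refine ⟨x, ?_⟩
      rw [← sub_eq_zero]
      refine hext _ ?_ ?_
      · rw [map_sub, map_sub, (hi'' x).1, hx, sub_self]
      · rw [map_sub, map_sub, (hi'' x).2, hv']; simp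
    · rintro ⟨x, rfl⟩
      exact (hi'' x).2
  · exact gHom_comp (subι_mem _) fst_mem (zero_add 0)

/-- If all maps from `L` extend to `M`, the connecting map Hom(L, W) → Ext¹(N, W) is zero, so
Ext¹(N, W) embeds in Ext¹(M, W). Concretely, the extension is pulled back to `M`, `f` is extended
there, and the result is corrected so as to descend. -/
theorem E1.quot {i₀ : L →ₗ[A] M} {p₀ : M →ₗ[A] N} (h₀ : SES i₀ p₀ 0) (hM : E1 M W c)
    (hL : ∀ f ∈ gHom L W c, ∃ g ∈ gHom M W c, ∀ x, g (i₀ x) = f x) : E1 N W c := by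
  intro X Y i p e h f hf
  obtain ⟨V, i', a, b, h', ha, hai, hab, hext, huniv⟩ := exists_pullback h h₀.hp
  obtain ⟨g, hg, hgf⟩ := hM _ _ _ _ _ h' f hf
  have has : Function.Surjective a := by
    intro y
    obtain ⟨m, hm⟩ := h₀.surj (p y)
    obtain ⟨v, rfl⟩ := h'.surj m
    obtain ⟨x, hx⟩ := (h.exact (y - a v)).1 (by rw [map_sub, hab, hm, sub_self])
    exact ⟨i' x + v, by rw [map_add, hai, hx, sub_add_cancel]⟩
  obtain ⟨γ, hγ, hγ'⟩ := huniv (L.shift e) 0 (i₀ ∘ₗ (shiftEquiv L e).symm.toLinearMap) (zero_mem _)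
    (gHom_comp (shiftEquiv_symm_mem L e) h₀.hi (add_zero e)) (fun x => by
      simp [h₀.comp_eq_zero])
  -- The kernel of `a : V → Y` is a shifted copy of `L`, embedded by `γ`. Subtracting an extension
  -- of `g` restricted to this copy makes `g` vanish on the kernel without changing it on `X`.
  obtain ⟨z, hz, hzg⟩ := hL (g ∘ₗ γ ∘ₗ (shiftEquiv L e).toLinearMap)
    (gHom_comp (gHom_comp (shiftEquiv_mem L e) hγ rfl) hg (by omega))
  obtain ⟨g', hg', hgg'⟩ := exists_factor ha has
    (sub_mem hg (gHom_comp h'.hp hz (add_comm e c))) (fun v hv => by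
    obtain ⟨l, hl⟩ := (h₀.exact (b v)).1 (by rw [← hab, hv, map_zero])
    have : v = γ (shiftEquiv L e l) := by
      rw [← sub_eq_zero]
      refine hext _ ?_ ?_
      · rw [map_sub, hv, (hγ' _).1]; simp
      · rw [map_sub, (hγ' _).2, ← hl]; simp
    rw [LinearMap.sub_apply, LinearMap.comp_apply, ← hl, hzg, this]
    exact sub_self _) (zero_add _)
  exact ⟨g', hg', fun x => by
    rw [← hai, hgg', LinearMap.sub_apply, LinearMap.comp_apply, h'.comp_eq_zero, map_zero, sub_zero,
      hgf]⟩

/-- Pulling the extension back along the retraction `M → N` gives an extension of `M`, and the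
section `N → M` embeds the original extension `Y` in it. -/
theorem E1.summand {i₀ : N →ₗ[A] M} {p₀ : M →ₗ[A] N} (hi : i₀ ∈ gHom N M 0)
    (hp : p₀ ∈ gHom M N 0) (hpi : ∀ x, p₀ (i₀ x) = x) (hM : E1 M W c) : E1 N W c := by
  intro X Y i p e h f hf
  obtain ⟨V, i', a, b, h', ha, hai, hab, hext, huniv⟩ := exists_pullback h hp
  obtain ⟨g, hg, hgf⟩ := hM _ _ _ _ _ h' f hf
  obtain ⟨γ, hγ, hγ'⟩ := huniv Y LinearMap.id (i₀ ∘ₗ p) id_mem_gHom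
    (gHom_comp h.hp hi (add_zero e)) (fun x => by simp [hpi])
  refine ⟨g ∘ₗ γ, gHom_comp hγ hg (zero_add _), fun x => ?_⟩
  have : γ (i x) = i' x := by
    rw [← sub_eq_zero]
    refine hext _ ?_ ?_
    · rw [map_sub, (hγ' _).1, hai]; simp
    · rw [map_sub, (hγ' _).2, h'.comp_eq_zero]; simp [h.comp_eq_zero]
  rw [LinearMap.comp_apply, this, hgf]

/-- Over each summand `S j` the extension restricts to the preimage `F j`, on which the map extends.
`Y` is a quotient of `X ⊕ ⨁ F j`, and the combined map descends because the copies of `X` in the `F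
j` are the only overlap. The index set may be infinite. -/
theorem E1.directSum {ι : Type u} {S : ι → GrMod 𝒜} (hS : ∀ i, E1 (S i) W c) :
    E1 (directSum S) W c := by
  intro X Y i p e h f hf
  let F : ι → Y.HSub := fun j => comapH p h.hp (rangeH (dsι S j) (dsι_mem j))
  have hF : ∀ j (y : Y.sub (F j)), ∃ z, dsι S j z = p (subι _ y) := fun j y => y.2
  let q : ∀ j, Y.sub (F j) →ₗ[A] S j := fun j => dsπ S j ∘ₗ p ∘ₗ subι (F j)
  have hpq : ∀ j y, p (subι _ y) = dsι S j (q j y) := fun j y => by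
    obtain ⟨z, hz⟩ := hF j y
    simp [q, ← hz]
  have hi' : ∀ j, ∃ i' ∈ gHom X (Y.sub (F j)) 0, ∀ x, subι _ (i' x) = i x := fun j =>
    exists_lift (subι_mem (F j)) (subι_injective _) h.hi
      (fun x => exists_subι (F := F j) ⟨0, by rw [h.comp_eq_zero, map_zero]⟩) (add_zero 0)
  choose i' hi' hi'i using hi'
  have hs : ∀ j, SES (i' j) (q j) e := fun j => by
    refine ⟨hi' j, gHom_comp (gHom_comp (subι_mem _) h.hp (zero_add e)) (dsπ_mem j) (add_zero e),
      fun x x' hx => h.inj ?_, fun z => ?_, fun y => ?_⟩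
    · rw [← hi'i j, hx, hi'i]
    · obtain ⟨y, hy⟩ := h.surj (dsι S j z)
      obtain ⟨y', rfl⟩ := exists_subι (F := F j) (x := y) ⟨z, hy.symm⟩
      exact ⟨y', by simp [q, hy]⟩
    · constructor
      · intro hy
        obtain ⟨x, hx⟩ := (h.exact (subι _ y)).1 (by rw [hpq, hy, map_zero])
        exact ⟨x, subι_injective _ (by rw [hi'i, hx])⟩
      · rintro ⟨x, rfl⟩
        simp [q, hi'i, h.comp_eq_zero]
  have hg := fun j => hS j _ _ _ _ _ (hs j) f hf
  choose g hg hgf using hg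
  let D := dsDesc fun j => subι (F j)
  let r := coprodH i D
  have hr := coprodH_mem h.hi (dsDesc_mem fun j => subι_mem (F j))
  let G := coprodH f (dsDesc g)
  have hG := coprodH_mem hf (dsDesc_mem hg)
  have hrs : Function.Surjective r := by
    intro y
    obtain ⟨s, hsy⟩ := ds_exists_sum (p y)
    choose t ht using fun j => (hs j).surj (dsπ S j (p y))
    obtain ⟨x, hx⟩ := (h.exact (y - ∑ j ∈ s, subι _ (t j))).1 (by
      rw [map_sub, map_sum, sub_eq_zero]
      conv_lhs => rw [hsy]
      exact Finset.sum_congr rfl fun j _ => by rw [hpq, ht])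
    refine ⟨inl _ _ x + inr _ _ (∑ j ∈ s, dsι _ j (t j)), ?_⟩
    rw [map_add, coprodH_inl, coprodH_inr, hx, map_sum, sub_add_eq_add_sub, sub_eq_iff_eq_add]
    simp [D]
  obtain ⟨g', hg', hgg'⟩ := exists_factor hr hrs hG (fun u hu => by
    obtain ⟨s, hsu⟩ := ds_exists_sum (snd _ _ u)
    have hu' : i (fst _ _ u) + ∑ j ∈ s, subι _ (dsπ _ j (snd _ _ u)) = 0 := by
      have : r u = i (fst _ _ u) + D (snd _ _ u) := rfl
      rw [hsu, map_sum, hu] at this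
      simpa [D] using this.symm
    have hx : ∀ j ∈ s, ∃ x, i' j x = dsπ _ j (snd _ _ u) := fun j hj => by
      rw [← (hs j).exact]
      have h2 := congrArg (fun y => dsπ S j (p y)) hu'
      simp only [map_add, map_sum, h.comp_eq_zero, map_zero, zero_add] at h2
      rw [Finset.sum_eq_single j] at h2
      · exact h2
      · intro l _ hl
        rw [hpq, dsπ_dsι_ne hl.symm]
      · exact fun h => absurd hj h
    choose! x hx using hx
    have h3 : fst _ _ u + ∑ j ∈ s, x j = 0 := h.inj (by
      rw [map_add, map_sum, map_zero, ← hu']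
      congr 1
      exact Finset.sum_congr rfl fun j hj => by rw [← hx j hj, hi'i])
    have h4 : G u = f (fst _ _ u) + dsDesc g (snd _ _ u) := rfl
    rw [h4, hsu, map_sum, ← map_zero f, ← h3, map_add, map_sum]
    congr 1
    exact Finset.sum_congr rfl fun j hj => by rw [dsDesc_dsι, ← hx j hj, hgf]) (zero_add _)
  refine ⟨g', hg', fun x => ?_⟩
  have : r (inl _ _ x) = i x := by simp [r]
  rw [← this, hgg']
  simp

/-- Vanishing of extensions of a submodule `Q` of `M`, when a presentation of `M / Q` has good
kernel. -/
theorem E1.of_presentation {Ω R : GrMod 𝒜} {i₀ : Q →ₗ[A] M} {p₀ : M →ₗ[A] N} (h₀ : SES i₀ p₀ 0)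
    {κ : Ω →ₗ[A] R} {π : R →ₗ[A] N} (hκ : SES κ π 0) {v : R →ₗ[A] M} (hv : v ∈ gHom R M 0)
    (hvπ : ∀ x, p₀ (v x) = π x) (hΩ : E1 Ω W c) (hM : E1 M W c) : E1 Q W c := by
  intro X Y i p e h f hf
  -- Ext¹(Q, W) sits between Ext¹(M, W) and Ext²(N, W), and the latter is governed by Ext¹(Ω, W).
  -- The map `t : Ω → Q` induced by `v` realises this: the extension of `Q` is pulled back to `Ω`,
  -- where `f` extends.
  obtain ⟨t, ht, htv⟩ := exists_lift h₀.hi h₀.inj (gHom_comp hκ.hi hv (add_zero 0))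
    (fun x => (h₀.exact _).1 (by simp [hvπ, hκ.comp_eq_zero])) (add_zero 0)
  have htv' : ∀ x, i₀ (t x) = v (κ x) := htv
  obtain ⟨V, i', a, b, h', ha, hai, hab, hext, huniv⟩ := exists_pullback h ht
  obtain ⟨g, hg, hgf⟩ := hΩ _ _ _ _ _ h' f hf
  let s := (shiftEquiv R e).symm.toLinearMap
  have hss : ∀ x, s (shiftEquiv R e x) = x := fun x => rfl
  let pU : Y.prod (R.shift e) →ₗ[A] M := coprodH (i₀ ∘ₗ p) (v ∘ₗ s)
  let iU : V →ₗ[A] Y.prod (R.shift e) := inl _ _ ∘ₗ a - inr _ _ ∘ₗ (shiftEquiv R e).toLinearMap ∘ₗ κ ∘ₗ b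
  have hiU1 : ∀ x, fst _ _ (iU x) = a x := fun x => by simp [iU]
  have hiU2 : ∀ x, s (snd _ _ (iU x)) = - κ (b x) := fun x => by simp [iU, hss]
  -- `Y ⊕ R` maps onto `M` with kernel `V`, so the map found on `V` extends to `Y ⊕ R` and can be
  -- restricted to `Y`.
  have hU : SES iU pU e := by
    refine ⟨sub_mem (gHom_comp ha inl_mem (add_zero 0)) (gHom_comp (gHom_comp (gHom_comp h'.hp hκ.hi
      (add_zero e)) (shiftEquiv_mem R e) (add_neg_cancel e)) inr_mem (add_zero 0)),
      coprodH_mem (gHom_comp h.hp h₀.hi (add_zero e))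
      (gHom_comp (shiftEquiv_symm_mem R e) hv (add_zero e)),
      ?_, ?_, ?_⟩
    · rw [injective_iff_map_eq_zero]
      intro x hx
      refine hext _ ?_ (hκ.inj ?_)
      · rw [← hiU1, hx, map_zero]
      · have := hiU2 x
        rw [hx, map_zero, map_zero, eq_comm, neg_eq_zero] at this
        rw [this, map_zero]
    · intro m
      obtain ⟨x, hx⟩ := hκ.surj (p₀ m)
      obtain ⟨q, hq⟩ := (h₀.exact (m - v x)).1 (by rw [map_sub, hvπ, hx, sub_self])
      obtain ⟨y, rfl⟩ := h.surj q
      exact ⟨inl _ _ y + inr _ _ (shiftEquiv R e x), by simp [pU, hss, hq]⟩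
    · intro y
      have hpU : ∀ y, pU y = i₀ (p (fst _ _ y)) + v (s (snd _ _ y)) := fun y => rfl
      constructor
      · intro hy
        rw [hpU] at hy
        have h1 : π (s (snd _ _ y)) = 0 := by
          have := congrArg p₀ hy
          rwa [map_add, h₀.comp_eq_zero, hvπ, zero_add, map_zero] at this
        obtain ⟨ω, hω⟩ := (hκ.exact _).1 h1
        rw [← hω, ← htv', ← map_add] at hy
        have h2 : p (fst _ _ y) = t (-ω) := by
          rw [map_neg, ← add_eq_zero_iff_eq_neg]
          exact h₀.inj (by rw [hy, map_zero])
        obtain ⟨x, hx⟩ := h'.surj (-ω)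
        obtain ⟨x', hx'⟩ := (h.exact (fst _ _ y - a x)).1 (by
          rw [map_sub, hab, hx, h2, sub_self])
        refine ⟨i' x' + x, prod_ext ?_ ((shiftEquiv R e).symm.injective ?_)⟩
        · rw [hiU1, map_add, hai, hx', sub_add_cancel]
        · have := hiU2 (i' x' + x)
          rw [map_add b, h'.comp_eq_zero, zero_add, hx, map_neg, neg_neg, hω] at this
          exact this
      · rintro ⟨x, rfl⟩
        rw [hpU, hiU1, hiU2, hab, htv', map_neg, add_neg_cancel]
  obtain ⟨G, hG, hGg⟩ := hM _ _ _ _ _ hU g hg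
  refine ⟨G ∘ₗ inl _ _, gHom_comp inl_mem hG (zero_add _), fun x => ?_⟩
  have : iU (i' x) = inl _ _ (i x) := by simp [iU, hai, h'.comp_eq_zero]
  rw [LinearMap.comp_apply, ← this, hGg, hgf]

/-- Extensions of a quotient of a projective. -/
theorem E1.of_extends {Ω R : GrMod 𝒜} {κ : Ω →ₗ[A] R} {π : R →ₗ[A] M} (hκ : SES κ π 0)
    (hR : ∀ (Y : GrMod 𝒜) (p : Y →ₗ[A] M) (e : ℤ), p ∈ gHom Y M e → Function.Surjective p →
      ∃ v ∈ gHom R Y (-e), ∀ x, p (v x) = π x)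
    (hW : ∀ f ∈ gHom Ω W c, ∃ g ∈ gHom R W c, ∀ x, g (κ x) = f x) : E1 M W c := by
  intro X Y i p e h f hf
  obtain ⟨v, hv, hvπ⟩ := hR Y p e h.hp h.surj
  obtain ⟨t, ht, htv⟩ := exists_lift h.hi h.inj (gHom_comp hκ.hi hv (zero_add _))
    (fun x => (h.exact _).1 (by simp [hvπ, hκ.comp_eq_zero])) (add_zero (-e))
  obtain ⟨w, hw, hwf⟩ := hW _ (gHom_comp ht hf (by omega))
  let s := (shiftEquiv R e).symm.toLinearMap
  have hss : ∀ x, s (shiftEquiv R e x) = x := fun x => rfl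
  -- `Y` is the quotient of `X ⊕ R` by a copy of `Ω`. The maps `f` and `w` agree on that copy, so
  -- together they descend to `Y`.
  let r := coprodH i (v ∘ₗ s)
  let G := coprodH f (w ∘ₗ s)
  have hr := coprodH_mem h.hi (gHom_comp (shiftEquiv_symm_mem R e) hv (add_neg_cancel e))
  have hG := coprodH_mem hf (gHom_comp (shiftEquiv_symm_mem R e) hw (add_comm e c))
  have hrs : Function.Surjective r := by
    intro y
    obtain ⟨b, hb⟩ := hκ.surj (p y)
    obtain ⟨x, hx⟩ := (h.exact (y - v b)).1 (by rw [map_sub, hvπ, hb, sub_self])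
    exact ⟨inl _ _ x + inr _ _ (shiftEquiv R e b), by simp [r, hss, hx]⟩
  obtain ⟨g, hg, hgG⟩ := exists_factor hr hrs hG (fun u hu => by
    have hu' : i (fst _ _ u) + v (s (snd _ _ u)) = 0 := hu
    have h1 : π (s (snd _ _ u)) = 0 := by
      have := congrArg p hu'
      rwa [map_add, h.comp_eq_zero, hvπ, zero_add, map_zero] at this
    obtain ⟨ω, hω⟩ := (hκ.exact _).1 h1
    have h2 : i (t ω) = v (κ ω) := htv ω
    rw [← hω, ← h2, ← map_add] at hu'
    have h3 : fst _ _ u + t ω = 0 := h.inj (by rw [hu', map_zero])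
    have h4 : G u = f (fst _ _ u) + w (s (snd _ _ u)) := rfl
    have h5 : w (κ ω) = f (t ω) := hwf ω
    rw [h4, ← hω, h5, ← map_add, h3, map_zero]) (zero_add _)
  refine ⟨g, hg, fun x => ?_⟩
  have : r (inl _ _ x) = i x := by simp [r]
  rw [← this, hgG]
  simp

theorem E1.extends {Ω R : GrMod 𝒜} {κ : Ω →ₗ[A] R} {π : R →ₗ[A] M} (hκ : SES κ π 0)
    (h : E1 M W c) {f : Ω →ₗ[A] W} (hf : f ∈ gHom Ω W c) :
    ∃ g ∈ gHom R W c, ∀ x, g (κ x) = f x := by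
  obtain ⟨g, hg, hgf⟩ := h _ _ _ _ _ hκ f (gHom_congr hf (add_zero c).symm)
  exact ⟨g, gHom_congr hg (add_zero c), hgf⟩

end GrMod

/-! ### Projective, injective, standard and proper costandard modules -/

namespace PosGraded

open GrMod

variable {k A : Type u} [Field k] [Ring A] [Algebra k A] {𝒜 : ℤ → Submodule k A}
variable [GradedAlgebra 𝒜] {Λ : Type*} (E : PosGraded 𝒜 Λ)
variable {M N W X Y : GrMod 𝒜} {d e n : ℤ}


theorem smul_mem_of_e {x : M} {p : Submodule k M} (h : ∀ l, E.e l • x ∈ p) {a : A}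
    (ha : a ∈ 𝒜 0) : a • x ∈ p := by
  rw [← E.span] at ha
  induction ha using Submodule.span_induction with
  | mem a ha => obtain ⟨l, rfl⟩ := ha; exact h l
  | zero => rw [zero_smul]; exact zero_mem _
  | add a b _ _ ha hb => rw [add_smul]; exact add_mem ha hb
  | smul c a _ ha => rw [smul_assoc]; exact p.smul_mem c ha

theorem mem_of_e {x : M} {p : Submodule k M} (h : ∀ l, E.e l • x ∈ p) : x ∈ p := by
  have := E.smul_mem_of_e h (SetLike.one_mem_graded 𝒜)
  rwa [one_smul] at this

theorem eq_zero_of_e {x : M} (h : ∀ l, E.e l • x = 0) : x = 0 :=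
  (Submodule.mem_bot k).1 (E.mem_of_e fun l => (Submodule.mem_bot k).2 (h l))

theorem e_smul_deg {x : M} (hx : x ∈ M.deg n) (l : Λ) : E.e l • x ∈ M.deg n := by
  have := M.smul_mem_deg (E.e_mem l) hx
  rwa [zero_add] at this

theorem e_smul_e_smul (l : Λ) (x : M) : E.e l • E.e l • x = E.e l • x := by
  rw [smul_smul, E.idem]

theorem proj_e_smul (l : Λ) (n : ℤ) (x : M) : M.proj n (E.e l • x) = E.e l • M.proj n x :=
  proj_smul_zero (E.e_mem l) n x

theorem e_smul_of_ne {l m : Λ} (h : l ≠ m) {x : M} (hx : E.e m • x = x) : E.e l • x = 0 := by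
  rw [← hx, smul_smul, E.orth l m h, zero_smul]


/-- Induction over homogeneous elements of nonnegative degree. -/
theorem smul_induction (E : PosGraded 𝒜 Λ) {p : A → Prop} (h0 : p 0) (hadd : ∀ a b, p a → p b → p (a + b))
    (hdeg : ∀ i, 0 ≤ i → ∀ a ∈ 𝒜 i, p a) (a : A) : p a := by
  induction a using DirectSum.Decomposition.inductionOn 𝒜 with
  | zero => exact h0
  | add a b ha hb => exact hadd a b ha hb
  | @homogeneous m a =>
    by_cases hm : 0 ≤ m
    · exact hdeg m hm a a.2
    · obtain ⟨a, ha⟩ := a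
      rw [E.neg m (by omega), Submodule.mem_bot] at ha
      exact ha ▸ h0

theorem exists_e_smul_ne_zero {x : M} (h : x ≠ 0) : ∃ l, E.e l • x ≠ 0 := by
  by_contra! h'
  exact h (E.eq_zero_of_e h')

/-! ### The projective modules -/

/-- The generator of `P(l)`. -/
def pgen (l : Λ) : E.P l := ⟨E.e l, Submodule.mem_span_singleton_self _⟩

theorem pgen_mem (l : Λ) : E.pgen l ∈ (E.P l).deg 0 := E.e_mem l

theorem pgen_ne_zero (l : Λ) : E.pgen l ≠ 0 := fun h => E.ne_zero l (congrArg Subtype.val h)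

theorem e_pgen (l : Λ) : E.e l • E.pgen l = E.pgen l := Subtype.ext (E.idem l)

theorem exists_pgen_deg {l : Λ} {x : E.P l} (hx : x ∈ (E.P l).deg n) :
    ∃ a ∈ 𝒜 n, a • E.pgen l = x := by
  refine ⟨x.1, hx, Subtype.ext ?_⟩
  obtain ⟨b, hb⟩ := Submodule.mem_span_singleton.1 x.2
  have hb' : b * E.e l = x.1 := hb
  have : b * E.e l * E.e l = b * E.e l := by rw [mul_assoc, E.idem]
  rw [hb'] at this
  exact this

theorem exists_pgen {l : Λ} (x : E.P l) : ∃ a : A, a • E.pgen l = x := by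
  obtain ⟨b, hb⟩ := Submodule.mem_span_singleton.1 x.2
  exact ⟨b, Subtype.ext hb⟩

theorem P_hom_ext {l : Λ} {f g : E.P l →ₗ[A] M} (h : f (E.pgen l) = g (E.pgen l)) : f = g := by
  ext x
  obtain ⟨a, rfl⟩ := E.exists_pgen x
  rw [map_smul, map_smul, h]

theorem exists_P_hom {l : Λ} {v : M} (hv : v ∈ M.deg n) (he : E.e l • v = v) :
    ∃ f ∈ gHom (E.P l) M n, f (E.pgen l) = v :=
  ⟨LinearMap.toSpanSingleton A M v ∘ₗ Submodule.subtype _, fun _ _ hx => M.smul_mem_deg hx hv, he⟩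

theorem P_lift {l : Λ} {p : Y →ₗ[A] M} (hp : p ∈ gHom Y M e) (hs : Function.Surjective p)
    {u : E.P l →ₗ[A] M} (hu : u ∈ gHom (E.P l) M d) :
    ∃ v ∈ gHom (E.P l) Y (d - e), ∀ x, p (v x) = u x := by
  obtain ⟨y, hy, hyu⟩ := exists_deg_preimage hp hs (n := d - e) (m := 0 + d) (by omega)
    (hu 0 _ (E.pgen_mem l))
  obtain ⟨v, hv, hv'⟩ := E.exists_P_hom (E.e_smul_deg hy l) (E.e_smul_e_smul l y)
  refine ⟨v, hv, fun x => ?_⟩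
  have : p ∘ₗ v = u := E.P_hom_ext (by
    rw [LinearMap.comp_apply, hv', map_smul, hyu, ← map_smul, E.e_pgen])
  exact LinearMap.congr_fun this x

theorem P_inDown (l : Λ) : (E.P l).InDown := by
  refine ⟨fun n => ?_, 0, fun i hi => ?_⟩
  · have := E.locallyFinite n
    let f : (E.P l).deg n →ₗ[k] 𝒜 n :=
      { toFun := fun x => ⟨x.1.1, x.2⟩, map_add' := fun _ _ => rfl, map_smul' := fun _ _ => rfl }
    exact FiniteDimensional.of_injective f fun x y h => by
      have h' : (f x : A) = f y := congrArg (fun z : 𝒜 n => (z : A)) h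
      exact Subtype.ext (Subtype.ext h')
  · rw [eq_bot_iff]
    intro x hx
    have : x.1 ∈ 𝒜 i := hx
    rw [E.neg i hi] at this
    exact Subtype.ext this

/-! ### The injective modules -/

/-- Evaluation at `1` on `I(l)`. -/
def evI (l : Λ) : E.I l →ₗ[k] k where
  toFun x := (x.1 : DualReg k A) 1
  map_add' _ _ := rfl
  map_smul' _ _ := rfl

theorem evI_smul {l : Λ} (a : A) (x : E.I l) : E.evI l (a • x) = (x.1 : DualReg k A) a := by
  change (x.1 : DualReg k A) (1 * a) = _
  rw [one_mul]

theorem evI_e {l : Λ} (x : E.I l) : E.evI l (E.e l • x) = E.evI l x := by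
  rw [evI_smul]
  induction x using homogeneous_induction with
  | h0 => rfl
  | hadd x y hx hy =>
    rw [map_add, ← hx, ← hy]
    rfl
  | hdeg n x hx =>
    have := hx.1 1
    rw [mul_one] at this
    exact this

theorem evI_deg {l : Λ} {x : E.I l} (hx : x ∈ (E.I l).deg n) (hn : n ≠ 0) : E.evI l x = 0 :=
  hx.2 0 (by omega) 1 (SetLike.one_mem_graded 𝒜)

theorem exists_evI_ne_zero {l : Λ} {x : E.I l} (hx : x ≠ 0) : ∃ a : A, E.evI l (a • x) ≠ 0 := by
  by_contra! h
  refine hx (Subtype.ext (DualReg.ext fun a => ?_))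
  rw [← evI_smul, h]
  rfl

/-- `I(l)` is the graded dual of `e_l A`, so a functional `φ` supported on `e_l M_{-d}` induces the
map sending `x` to the functional `a ↦ φ (a • x)`. -/
theorem exists_I_hom {l : Λ} (φ : M →ₗ[k] k) (he : ∀ x, φ (E.e l • x) = φ x)
    (hdeg : ∀ n, n ≠ -d → ∀ x ∈ M.deg n, φ x = 0) :
    ∃ f ∈ gHom M (E.I l) d, ∀ x, E.evI l (f x) = φ x := by
  let F : M → DualReg k A := fun x =>
    LinearMap.comp φ ((LinearMap.toSpanSingleton A M x).restrictScalars k)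
  have hF : ∀ x a, F x a = φ (a • x) := fun x a => rfl
  have hFdeg : ∀ n, ∀ x ∈ M.deg n, F x ∈ E.injDeg l (n + d) := by
    intro n x hx
    refine ⟨fun a => by rw [hF, hF, mul_smul, he], fun j hj a ha => ?_⟩
    rw [hF]
    exact hdeg _ (by omega) _ (M.smul_mem_deg ha hx)
  have hFadd : ∀ x y, F (x + y) = F x + F y := fun x y => by
    ext a; rw [DualReg.add_apply, hF, hF, hF, smul_add, map_add]
  have hmem : ∀ x, F x ∈ E.injCarrier l := by
    intro x
    induction x using homogeneous_induction with
    | h0 =>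
      have : F 0 = 0 := by ext a; rw [hF, smul_zero, map_zero]; rfl
      rw [this]; exact zero_mem _
    | hadd x y hx hy => rw [hFadd]; exact add_mem hx hy
    | hdeg n x hx => exact Submodule.mem_iSup_of_mem (n + d) (hFdeg n x hx)
  let f : M →ₗ[A] E.I l :=
    { toFun := fun x => ⟨F x, hmem x⟩
      map_add' := fun x y => Subtype.ext (hFadd x y)
      map_smul' := fun a x => Subtype.ext (DualReg.ext fun b => by
        change F (a • x) b = F x (b * a)
        rw [hF, hF, mul_smul]) }
  refine ⟨f, hFdeg, fun x => ?_⟩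
  change F x 1 = φ x
  rw [hF, one_smul]

variable [Preorder Λ]

/-! ### The proper costandard modules -/

/-- The inclusion of `∇̄(l)` into `I(l)`. -/
def nabι (l : Λ) : E.properNabla l →ₗ[A] E.I l := subι _

theorem nabι_mem (l : Λ) : E.nabι l ∈ gHom (E.properNabla l) (E.I l) 0 := subι_mem _

theorem nabι_injective (l : Λ) : Function.Injective (E.nabι l) := subι_injective _

theorem mem_properNabla {l : Λ} {x : E.I l}
    (h : ∀ m, l ≤ m → ∀ i > 0, ∀ f ∈ gHom (E.I l) (E.I m) i, f x = 0) :
    ∃ y : E.properNabla l, E.nabι _ y = x := by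
  refine exists_subι ?_
  refine (Submodule.mem_iInf _).2 fun t => ?_
  refine h t.1.1 t.1.2 t.2.1.1 t.2.1.2 t.2.2.toLinearMap fun n x hx => ?_
  have := t.2.2.map_deg n x hx
  rw [add_comm]
  exact this

theorem hom_properNabla_eq_zero {l m : Λ} (hm : l ≤ m) {i : ℤ} (hi : 0 < i)
    {f : E.I l →ₗ[A] E.I m} (hf : f ∈ gHom (E.I l) (E.I m) i) (x : E.properNabla l) :
    f (E.nabι _ x) = 0 := by
  let F : Hom (E.I l) ((E.I m).shift i) := ⟨f, fun n x hx => by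
    have := hf n x hx
    rw [add_comm] at this
    exact this⟩
  exact (Submodule.mem_iInf _).1 x.2 ⟨⟨m, hm⟩, ⟨i, hi⟩, F⟩

/-- The canonical functional on `∇̄(l)`, supported on the socle. -/
def ev (l : Λ) : E.properNabla l →ₗ[k] k := E.evI l ∘ₗ (E.nabι _).restrictScalars k

theorem ev_apply {l : Λ} (x : E.properNabla l) : E.ev l x = E.evI l (E.nabι _ x) := rfl

theorem ev_e {l : Λ} (x : E.properNabla l) : E.ev l (E.e l • x) = E.ev l x := by
  rw [ev_apply, map_smul, evI_e, ev_apply]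

theorem ev_deg {l : Λ} {x : E.properNabla l} (hx : x ∈ (E.properNabla l).deg n) (hn : n ≠ 0) :
    E.ev l x = 0 := E.evI_deg hx hn

theorem ev_proj {l : Λ} (x : E.properNabla l) : E.ev l ((E.properNabla l).proj 0 x) = E.ev l x := by
  induction x using homogeneous_induction with
  | h0 => simp
  | hadd x y hx hy => simp [hx, hy]
  | hdeg n x hx =>
    by_cases h : n = 0
    · subst h; rw [proj_same _ hx]
    · rw [proj_ne _ hx h, map_zero, E.ev_deg hx h]

theorem exists_ev_ne_zero {l : Λ} {x : E.properNabla l} (hx : x ≠ 0) :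
    ∃ a : A, E.ev l (a • x) ≠ 0 := by
  obtain ⟨a, ha⟩ := E.exists_evI_ne_zero (x := E.nabι _ x)
    (fun h => hx (E.nabι_injective _ (by rw [h, map_zero])))
  exact ⟨a, by rwa [ev_apply, map_smul]⟩

theorem nabla_ext {l : Λ} {x y : E.properNabla l} (h : ∀ a : A, E.ev l (a • x) = E.ev l (a • y)) :
    x = y := by
  by_contra hxy
  obtain ⟨a, ha⟩ := E.exists_ev_ne_zero (sub_ne_zero.2 hxy)
  rw [smul_sub, map_sub, h, sub_self] at ha
  exact ha rfl

theorem ev_smul_e {l m : Λ} (h : m ≠ l) (x : E.properNabla l) : E.ev l (E.e m • x) = 0 := by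
  rw [← ev_e, smul_smul, E.orth l m h.symm, zero_smul, map_zero]

theorem nabla_eq_zero_of_deg_zero {l : Λ} {x : E.properNabla l}
    (hx : x ∈ (E.properNabla l).deg 0) (h : E.ev l x = 0) : x = 0 := by
  refine E.nabla_ext fun a => ?_
  rw [smul_zero, map_zero]
  induction a using E.smul_induction with
  | h0 => rw [zero_smul, map_zero]
  | hadd a b ha hb => rw [add_smul, map_add, ha, hb, add_zero]
  | hdeg i hi a ha =>
    by_cases hi0 : i = 0
    · subst hi0
      refine LinearMap.mem_ker.1 (E.smul_mem_of_e (p := LinearMap.ker (E.ev l)) (fun m => ?_) ha)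
      rw [LinearMap.mem_ker]
      by_cases hm : m = l
      · subst hm; rw [ev_e, h]
      · exact E.ev_smul_e hm x
    · exact E.ev_deg (GrMod.smul_mem_deg _ ha hx) (by omega)

/-- The hypothesis `h` is what forces the induced map to `I(l)` to land in ∇̄(l): it must be
annihilated by all maps `I(l) → I(m)` of positive degree with `l ≤ m`, and such a map is read off on
the weight space of `m` in a single degree. -/
theorem exists_nabla_hom {l : Λ} (φ : M →ₗ[k] k) (he : ∀ x, φ (E.e l • x) = φ x)
    (hdeg : ∀ n, n ≠ -d → ∀ x ∈ M.deg n, φ x = 0)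
    (h : ∀ m, l ≤ m → ∀ n, n ≠ -d → ∀ x ∈ M.deg n, E.e m • x = x → ∀ a : A, φ (a • x) = 0) :
    ∃ f ∈ gHom M (E.properNabla l) d, ∀ x, E.ev l (f x) = φ x := by
  obtain ⟨f, hf, hfφ⟩ := E.exists_I_hom φ he hdeg
  have hmem : ∀ x, ∃ y : E.properNabla l, E.nabι _ y = f x := by
    refine fun x => E.mem_properNabla fun m hm i hi F hF => ?_
    have key : ∀ y : M, E.evI m (F (f y)) = 0 := by
      intro y
      induction y using homogeneous_induction with
      | h0 => simp
      | hadd x y hx hy => simp [hx, hy]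
      | hdeg n y hy =>
        by_cases hn : n + d + i = 0
        -- Here `n = -d - i` differs from `-d` because `i > 0`, so `h` shows that already `f` kills
        -- `e_m • y`.
        · rw [← evI_e, ← map_smul, ← map_smul]
          have : f (E.e m • y) = 0 := by
            by_contra h0
            obtain ⟨a, ha⟩ := E.exists_evI_ne_zero h0
            rw [← map_smul, hfφ] at ha
            exact ha (h m hm n (by omega) _ (E.e_smul_deg hy m) (E.e_smul_e_smul m y) a)
          rw [this, map_zero, map_zero]
        · exact E.evI_deg (hF _ _ (hf _ _ hy)) hn
    by_contra h0
    obtain ⟨a, ha⟩ := E.exists_evI_ne_zero h0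
    rw [← map_smul, ← map_smul] at ha
    exact ha (key _)
  obtain ⟨g, hg, hgf⟩ := exists_lift (E.nabι_mem _) (E.nabι_injective _) hf hmem (add_zero d)
  exact ⟨g, hg, fun x => by rw [ev_apply, hgf, hfφ]⟩

theorem exists_dual_ne_zero {V : Type*} [AddCommGroup V] [Module k V] {v : V} (hv : v ≠ 0) :
    ∃ φ : V →ₗ[k] k, φ v ≠ 0 := by
  by_contra! h
  exact hv ((Module.forall_dual_apply_eq_zero_iff k v).1 h)

variable (M) in
/-- The component of a functional supported on `e_l M_n`. -/
def component (φ : M →ₗ[k] k) (l : Λ) (n : ℤ) : M →ₗ[k] k :=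
  φ ∘ₗ DistribSMul.toLinearMap k M (E.e l) ∘ₗ M.proj n

theorem component_apply (φ : M →ₗ[k] k) (l : Λ) (n : ℤ) (x : M) :
    E.component M φ l n x = φ (E.e l • M.proj n x) := rfl

theorem component_e (φ : M →ₗ[k] k) (l : Λ) (n : ℤ) (x : M) :
    E.component M φ l n (E.e l • x) = E.component M φ l n x := by
  rw [component_apply, component_apply, proj_e_smul, e_smul_e_smul]

theorem component_of_ne (φ : M →ₗ[k] k) (l : Λ) {m : ℤ} {x : M} (hx : x ∈ M.deg m)
    (h : m ≠ n) : E.component M φ l n x = 0 := by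
  rw [component_apply, proj_ne _ hx h, smul_zero, map_zero]

theorem component_same (φ : M →ₗ[k] k) {l : Λ} {x : M} (hx : x ∈ M.deg n) (he : E.e l • x = x) :
    E.component M φ l n x = φ x := by
  rw [component_apply, proj_same _ hx, he]

/-- The elements of `∇̄(l)` of weight `m ≥ l` lie in the socle. -/
theorem nabla_eq_zero {l m : Λ} (hm : l ≤ m) (hd : d ≠ 0) {x : E.properNabla l}
    (hx : x ∈ (E.properNabla l).deg d) (he : E.e m • x = x) : x = 0 := by
  rcases lt_or_gt_of_ne hd with hd | hd
  · by_contra hx0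
    have hx0' : E.nabι _ x ≠ 0 := fun h => hx0 (E.nabι_injective _ (by rw [h, map_zero]))
    obtain ⟨φ, hφ⟩ := exists_dual_ne_zero (k := k) hx0'
    -- A functional separating `x` from zero gives a map `I(l) → I(m)` of degree `-d > 0` not
    -- killing `x`, contrary to the definition of ∇̄(l).
    obtain ⟨f, hf, hfφ⟩ := E.exists_I_hom (l := m) (d := -d) (E.component _ φ m d)
      (E.component_e φ m d) (fun n hn x hx => E.component_of_ne φ m hx (by omega))
    have h0 := E.hom_properNabla_eq_zero hm (by omega) hf x
    have h1 := hfφ (E.nabι _ x)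
    rw [h0, map_zero, component_same _ _ (gHom_apply₀ (E.nabι_mem l) hx)
      (by rw [← map_smul, he])] at h1
    exact hφ h1.symm
  -- ∇̄(l) lives in degrees at most 0: `A` only raises degrees, and `ev` only sees degree 0.
  · refine E.nabla_ext fun a => ?_
    rw [smul_zero, map_zero]
    induction a using E.smul_induction with
    | h0 => rw [zero_smul, map_zero]
    | hadd a b ha hb => rw [add_smul, map_add, ha, hb, add_zero]
    | hdeg i hi a ha => exact E.ev_deg (GrMod.smul_mem_deg _ ha hx) (by omega)

/-- The functional on `P(l)` dual to the generator satisfies the hypotheses of `exists_nabla_hom`,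
because `P(l)` lives in degrees at least 0 and what starts above degree 0 never returns to it. The
image of the generator spans the socle. -/
theorem exists_nabla_socle (l : Λ) :
    ∃ s ∈ (E.properNabla l).deg 0, E.e l • s = s ∧ E.ev l s ≠ 0 := by
  obtain ⟨φ, hφ⟩ := exists_dual_ne_zero (k := k) (E.pgen_ne_zero l)
  obtain ⟨f, hf, hfφ⟩ := E.exists_nabla_hom (l := l) (d := 0) (E.component _ φ l 0)
    (E.component_e φ l 0) (fun n hn x hx => E.component_of_ne φ l hx (by omega)) (by
      intro m hm n hn x hx he a
      obtain ⟨b, hb, rfl⟩ := E.exists_pgen_deg hx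
      by_cases hn' : n < 0
      · rw [E.neg n hn', Submodule.mem_bot] at hb
        rw [hb, zero_smul, smul_zero, map_zero]
      · induction a using E.smul_induction with
        | h0 => rw [zero_smul, map_zero]
        | hadd a b ha hb => rw [add_smul, map_add, ha, hb, add_zero]
        | hdeg i hi a ha =>
          exact E.component_of_ne φ l (GrMod.smul_mem_deg _ ha hx) (by omega))
  refine ⟨f (E.pgen l), gHom_apply₀ hf (E.pgen_mem l), ?_, ?_⟩
  · rw [← map_smul, e_pgen]
  · rwa [hfφ, E.component_same φ (E.pgen_mem l) (E.e_pgen l)]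

/-- Vanishing of extensions of `M` by `∇̄(l)` when `M` has no weights `m ≥ l` in small degrees. -/
theorem E1_nabla_of_vanish {l : Λ} {c : ℤ}
    (h : ∀ m, l ≤ m → ∀ n ≤ -c, ∀ x ∈ M.deg n, E.e m • x = x → x = 0) :
    E1 M (E.properNabla l) c := by
  intro X Y i p e hs f hf
  -- A map to ∇̄(l) is a functional on one weight space, so it suffices to extend the functional `ev
  -- ∘ f` linearly, by means of a `k`-linear retraction, and to verify the condition of
  -- `exists_nabla_hom`.
  obtain ⟨r, hr⟩ := LinearMap.exists_leftInverse_of_injective (i.restrictScalars k)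
    (LinearMap.ker_eq_bot.2 hs.inj)
  have hr' : ∀ x, r (i x) = x := fun x => LinearMap.congr_fun hr x
  let φ := E.component Y (E.ev l ∘ₗ f.restrictScalars k ∘ₗ r) l (-(c + e))
  have hφ : ∀ x, φ (i x) = E.ev l (f x) := fun x => by
    have h1 := map_proj hf (-(c + e)) x
    rw [neg_add_cancel] at h1
    rw [component_apply, map_proj₀ hs.hi, ← map_smul]
    change E.ev l (f (r (i _))) = _
    rw [hr', map_smul, ev_e, ← h1, ev_proj]
  obtain ⟨g, hg, hgφ⟩ := E.exists_nabla_hom (l := l) (d := c + e) φ (E.component_e _ _ _)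
    (fun n hn x hx => E.component_of_ne _ _ hx hn) (by
      intro m hm n hn y hy he a
      induction a using E.smul_induction with
      | h0 => rw [zero_smul, map_zero]
      | hadd a b ha hb => rw [add_smul, map_add, ha, hb, add_zero]
      | hdeg j hj a ha =>
        have hay := Y.smul_mem_deg ha hy
        by_cases hjn : j + n = -(c + e)
        -- Since `j ≥ 0`, the degree `n + e` of `p y` is at most `-c`, so the hypothesis on `M` puts
        -- `y` in `X`. There `f` sends it to weight `m ≥ l` outside the socle degree of ∇̄(l), that
        -- is, to zero.
        · have hpy : p y = 0 := h m hm (n + e) (by omega) _ (hs.hp _ _ hy) (by rw [← map_smul, he])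
          obtain ⟨x, rfl⟩ := (hs.exact y).1 hpy
          have hex : E.e m • x = x := hs.inj (by rw [map_smul, he])
          have hfx : f x = 0 := E.nabla_eq_zero hm (d := n + (c + e)) (by omega)
            (hf _ _ (deg_of_map_deg hs.hi hs.inj (add_zero n) hy))
            (by rw [← map_smul, hex])
          rw [← map_smul, hφ, map_smul, hfx, smul_zero, map_zero]
        · exact E.component_of_ne _ _ hay hjn)
  refine ⟨g, hg, fun x => E.nabla_ext fun a => ?_⟩
  rw [← map_smul, ← map_smul, hgφ, hφ, map_smul]

/-! ### The standard modules -/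

/-- The projection from `P(l)` onto `Δ(l)`. -/
def Δπ (l : Λ) : E.P l →ₗ[A] E.Δ l := quotπ _

theorem ses_Δ (l : Λ) : SES (subι (E.K l)) (E.Δπ l) 0 :=
  ses_sub_quot _

/-- The generator of `Δ(l)`. -/
def dgen (l : Λ) : E.Δ l := E.Δπ l (E.pgen l)

theorem dgen_mem (l : Λ) : E.dgen l ∈ (E.Δ l).deg 0 :=
  gHom_apply₀ (E.ses_Δ l).hp (E.pgen_mem l)

theorem e_dgen (l : Λ) : E.e l • E.dgen l = E.dgen l := by
  rw [dgen, ← map_smul, e_pgen]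

theorem exists_dgen {l : Λ} (x : E.Δ l) : ∃ a : A, a • E.dgen l = x := by
  obtain ⟨x, rfl⟩ := (E.ses_Δ l).surj x
  obtain ⟨a, rfl⟩ := E.exists_pgen x
  exact ⟨a, (map_smul _ _ _).symm⟩

theorem exists_dgen_deg {l : Λ} {x : E.Δ l} (hx : x ∈ (E.Δ l).deg n) :
    ∃ a ∈ 𝒜 n, a • E.dgen l = x := by
  obtain ⟨x, hx', rfl⟩ := exists_deg_preimage (E.ses_Δ l).hp (E.ses_Δ l).surj (add_zero n) hx
  obtain ⟨a, ha, rfl⟩ := E.exists_pgen_deg hx'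
  exact ⟨a, ha, (map_smul _ _ _).symm⟩

/-- `K(l)` is generated by the images of the generators of the `P(m)` with `l < m`, which are
elements of weight `m`. -/
theorem K_le {l : Λ} {H : Submodule A (E.P l)}
    (h : ∀ m, l < m → ∀ x ∈ (E.K l).toSubmodule, E.e m • x = x → x ∈ H) :
    (E.K l).toSubmodule ≤ H := by
  refine iSup_le fun t => ?_
  rintro _ ⟨z, rfl⟩
  obtain ⟨a, rfl⟩ := E.exists_pgen (l := t.1.1) z
  have h1 : t.2.2.toLinearMap (E.pgen t.1.1) ∈ H := by
    refine h t.1.1 t.1.2 _ ?_ ?_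
    · exact Submodule.mem_iSup_of_mem (p := fun t : (Σ m : {m : Λ // l < m}, Σ i : ℤ,
        Hom ((E.P m.1).shift i) (E.P l)) => t.2.2.range.toSubmodule) t ⟨E.pgen t.1.1, rfl⟩
    · have : t.2.2.toLinearMap (E.e t.1.1 • E.pgen t.1.1) =
        E.e t.1.1 • t.2.2.toLinearMap (E.pgen t.1.1) := map_smul t.2.2.toLinearMap _ _
      rw [← this, e_pgen]
  have h2 : t.2.2.toLinearMap (a • E.pgen t.1.1) = a • t.2.2.toLinearMap (E.pgen t.1.1) :=
    map_smul t.2.2.toLinearMap _ _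
  rw [h2]
  exact H.smul_mem a h1

/-- The top of `K(l)` has only weights `m > l`. -/
theorem K_hom_eq_zero {l : Λ} {f : (E.P l).sub (E.K l) →ₗ[A] M}
    (h : ∀ m, l < m → ∀ x : M, E.e m • x = 0) : f = 0 := by
  have hK : (E.K l).toSubmodule ≤ (LinearMap.ker f).map (subι (E.K l)) := E.K_le fun m hm x hx he => by
    obtain ⟨y, rfl⟩ := exists_subι hx
    refine ⟨y, ?_, rfl⟩
    have : E.e m • y = y := subι_injective _ (by rw [map_smul, he])
    rw [SetLike.mem_coe, LinearMap.mem_ker, ← this, map_smul, h m hm]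
  ext x
  obtain ⟨y, hy, hyx⟩ := hK x.2
  rw [subι_injective _ hyx] at hy
  exact hy

theorem exists_Δ_hom_of_P {l : Λ} {f : E.P l →ₗ[A] M} (hf : f ∈ gHom (E.P l) M n)
    (h : ∀ x, f (subι (E.K l) x) = 0) :
    ∃ g ∈ gHom (E.Δ l) M n, ∀ x, g (E.Δπ l x) = f x :=
  exists_factor (E.ses_Δ l).hp (E.ses_Δ l).surj hf (fun y hy => by
    obtain ⟨x, rfl⟩ := ((E.ses_Δ l).exact y).1 hy
    exact h x) (zero_add n)

theorem exists_Δ_hom {l : Λ} {v : M} (hv : v ∈ M.deg n) (he : E.e l • v = v)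
    (h : ∀ m, l < m → ∀ x : M, E.e m • x = 0) : ∃ f ∈ gHom (E.Δ l) M n, f (E.dgen l) = v := by
  obtain ⟨f, hf, hfv⟩ := E.exists_P_hom hv he
  obtain ⟨g, hg, hgf⟩ := E.exists_Δ_hom_of_P hf (fun x =>
    LinearMap.congr_fun (E.K_hom_eq_zero (f := f ∘ₗ subι (E.K l)) h) x)
  exact ⟨g, hg, by rw [dgen, hgf, hfv]⟩

/-- `P(l)` is projective, so Ext¹(Δ(l), W) is the cokernel of restriction Hom(P(l), W) → Hom(K(l),
W). All later statements about extensions of standard modules are reduced to maps out of `K(l)` in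
this way. -/
theorem E1_Δ_of_extends {l : Λ} {c : ℤ}
    (h : ∀ f ∈ gHom ((E.P l).sub (E.K l)) W c, ∃ g ∈ gHom (E.P l) W c, ∀ x,
      g (subι (E.K l) x) = f x) : E1 (E.Δ l) W c := by
  refine E1.of_extends (E.ses_Δ l) (fun Y p e hp hs => ?_) h
  obtain ⟨v, hv, hvp⟩ := E.P_lift hp hs (E.ses_Δ l).hp
  exact ⟨v, gHom_congr hv (zero_sub e), hvp⟩

variable {E} (hE : E.IsStandardlyStratified)
include hE

theorem Δ_weight {l m : Λ} {x : E.Δ l} (h : E.e m • x ≠ 0) : m ≤ l := hE.factors l m ⟨x, h⟩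

/-- Nonzero maps from standard to proper costandard modules. -/
theorem hom_Δ_nabla {l m : Λ} {f : E.Δ l →ₗ[A] E.properNabla m}
    (hf : f ∈ gHom (E.Δ l) (E.properNabla m) n) (h : f (E.dgen l) ≠ 0) : l = m ∧ n = 0 := by
  obtain ⟨a, ha⟩ := E.exists_ev_ne_zero h
  rw [← ev_e, ← map_smul, ← map_smul] at ha
  -- Some multiple of the image of the generator meets the socle, of weight `m`, so `m` is a weight
  -- of Δ(l). Hence the image, of weight `l ≥ m`, must itself lie in the socle.
  have hml : m ≤ l := Δ_weight hE (x := a • E.dgen l) fun h0 => by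
    rw [h0, map_zero, map_zero] at ha
    exact ha rfl
  have hfe : E.e l • f (E.dgen l) = f (E.dgen l) := by rw [← map_smul, e_dgen]
  have hn : n = 0 := by
    by_contra hn
    exact h (E.nabla_eq_zero hml hn (gHom_apply hf (E.dgen_mem l) (zero_add n)) hfe)
  refine ⟨?_, hn⟩
  by_contra hlm
  refine h (E.nabla_eq_zero_of_deg_zero (gHom_apply hf (E.dgen_mem l) (by omega)) ?_)
  rw [← hfe]
  exact E.ev_smul_e hlm _

/-- Downward induction on `l`. A vector of weight `l` gives a map `P(l) → ∇̄(m)`. If it kills `K(l)`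
it factors through Δ(l) and `l = m`; otherwise a generator of `K(l)`, of weight greater than `l`,
survives, and induction bounds that weight by `m`. -/
theorem nabla_weight [Finite Λ] {l m : Λ} {x : E.properNabla m} (h : E.e l • x ≠ 0) : l ≤ m := by
  induction l using (wellFounded_gt (α := Λ)).induction generalizing m with
  | _ l ih =>
  obtain ⟨n, hn⟩ := exists_proj_ne_zero h
  rw [proj_e_smul] at hn
  obtain ⟨f, hf, hfv⟩ := E.exists_P_hom (E.e_smul_deg (proj_mem _ n x) l) (E.e_smul_e_smul l _)
  by_cases hK : f ∘ₗ subι (E.K l) = 0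
  · obtain ⟨g, hg, hgf⟩ := E.exists_Δ_hom_of_P hf (LinearMap.congr_fun hK)
    exact (hom_Δ_nabla hE hg (by rwa [dgen, hgf, hfv])).1.le
  · by_contra hlm
    refine hK (E.K_hom_eq_zero fun ν hν y => ?_)
    by_contra hy
    exact hlm (hν.le.trans (ih ν hν hy))

/-- If `m ≤ l`, then `K(l)` is generated by weights greater than `l`, none of which occurs in ∇̄(m),
so there is no nonzero map `K(l) → ∇̄(m)`. If not, Δ(l) has no weights above `m` at all, and
`E1_nabla_of_vanish` applies. -/
theorem E1_Δ_nabla [Finite Λ] (l m : Λ) (c : ℤ) : E1 (E.Δ l) (E.properNabla m) c := by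
  by_cases hml : m ≤ l
  · refine E.E1_Δ_of_extends fun f hf => ⟨0, zero_mem _, fun x => ?_⟩
    rw [E.K_hom_eq_zero (f := f) fun ν hν y => ?_]
    · simp
    · by_contra hy
      exact (hν.trans_le (nabla_weight hE hy)).not_ge hml
  · refine E.E1_nabla_of_vanish fun α hα n _ x _ he => ?_
    by_contra hx
    rw [← he] at hx
    exact hml (hα.trans (Δ_weight hE hx))

/-- The weights greater than `l` do not occur in ∇̄(l), so its socle vector is the image of the
generator of Δ(l). -/
theorem dgen_ne_zero [Finite Λ] (l : Λ) : E.dgen l ≠ 0 := by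
  obtain ⟨s, hs, he, hev⟩ := E.exists_nabla_socle l
  obtain ⟨f, hf, hfs⟩ := E.exists_Δ_hom hs he (fun m hm x => by
    by_contra hx
    exact hm.not_ge (nabla_weight hE hx))
  intro h
  rw [← hfs, h, map_zero, map_zero] at hev
  exact hev rfl

end PosGraded

/-- A sequence whose consecutive terms are joined by nonempty finite chains refines to a chain. -/
theorem exists_chain_refinement {α : Type*} {R : α → α → Prop} {x : ℕ → α}
    (h : ∀ i, Relation.TransGen R (x i) (x (i + 1))) :
    ∃ y : ℕ → α, y 0 = x 0 ∧ (∀ n, R (y n) (y (n + 1))) ∧ ∀ i, ∃ n, y n = x i := by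
  have hc : ∀ i, ∃ (m : ℕ) (c : ℕ → α), c 0 = x i ∧ c (m + 1) = x (i + 1) ∧
      ∀ j ≤ m, R (c j) (c (j + 1)) := by
    intro i
    have := h i
    generalize x (i + 1) = b at this
    induction this with
    | @single b hb =>
      refine ⟨0, fun j => if j = 0 then x i else b, by simp, by simp, fun j hj => ?_⟩
      obtain rfl : j = 0 := by omega
      simpa using hb
    | @tail b d _ hbd ih =>
      obtain ⟨m, c, h0, h1, h2⟩ := ih
      refine ⟨m + 1, fun j => if j ≤ m + 1 then c j else d, by simpa using h0, by simp,
        fun j hj => ?_⟩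
      by_cases hjm : j = m + 1
      · subst hjm
        simpa [h1] using hbd
      · have h3 : j ≤ m + 1 := by omega
        have h4 : j + 1 ≤ m + 1 := by omega
        simpa only [h3, h4, if_true] using h2 j (by omega)
  choose m c h0 h1 h2 using hc
  -- A state `(i, j)` stands for the `j`-th entry of the chain from `x i` to `x (i + 1)`. That chain
  -- has `m i + 1` steps; its last entry is left out, being the first entry of the next chain.
  let nxt : ℕ × ℕ → ℕ × ℕ := fun t => if t.2 < m t.1 then (t.1, t.2 + 1) else (t.1 + 1, 0)
  let st : ℕ → ℕ × ℕ := fun n => nxt^[n] (0, 0)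
  have hst : ∀ n, st (n + 1) = nxt (st n) := fun n => Function.iterate_succ_apply' _ _ _
  have hle : ∀ n, (st n).2 ≤ m (st n).1 := by
    intro n
    induction n with
    | zero => exact Nat.zero_le _
    | succ n ih =>
      rw [hst]
      simp only [nxt]
      split_ifs with hlt
      · exact hlt
      · exact Nat.zero_le _
  have hreach : ∀ i n, st n = (i, 0) → ∀ j ≤ m i, st (n + j) = (i, j) := by
    intro i n hn j hj
    induction j with
    | zero => exact hn
    | succ j ih =>
      rw [← add_assoc, hst, ih (by omega)]
      have : j < m i := by omega
      simp [nxt, this]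
  have hall : ∀ i, ∃ n, st n = (i, 0) := by
    intro i
    induction i with
    | zero => exact ⟨0, rfl⟩
    | succ i ih =>
      obtain ⟨n, hn⟩ := ih
      refine ⟨n + m i + 1, ?_⟩
      rw [hst, hreach i n hn _ le_rfl]
      simp [nxt]
  refine ⟨fun n => c (st n).1 (st n).2, h0 0, fun n => ?_, fun i => ?_⟩
  · have h3 := h2 _ _ (hle n)
    simp only [hst]
    by_cases hlt : (st n).2 < m (st n).1
    · simpa [nxt, hlt] using h3
    · have : (st n).2 = m (st n).1 := le_antisymm (hle n) (not_lt.1 hlt)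
      rw [this, h1] at h3
      simp only [nxt, hlt, if_false, h0]
      rwa [this]
  · obtain ⟨n, hn⟩ := hall i
    exact ⟨n, by simp only [hn, h0]⟩

/-! ### Induction along filtrations, and their construction -/

namespace GrMod

variable {k A : Type u} [Field k] [Ring A] [Algebra k A] {𝒜 : ℤ → Submodule k A}
variable [GradedAlgebra 𝒜] {Λ : Type*} {S : Λ → GrMod 𝒜}
variable {L M N W X Y Z : GrMod 𝒜} {c d e n : ℤ}

theorem isShiftOf_iff : IsShiftOf S M ↔
    ∃ (l : Λ) (j : ℤ), ∃ q ∈ gHom M (S l) j, Function.Bijective q := by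
  constructor
  · rintro ⟨l, j, f, hf⟩
    refine ⟨l, j, (shiftEquiv (S l) j).symm.toLinearMap ∘ₗ f.toLinearMap, gHom_comp (d := 0)
      (fun n x hx => ?_) (shiftEquiv_symm_mem _ _) (zero_add j), f.bijective⟩
    rw [add_zero]
    exact (hf n x).1 hx
  · rintro ⟨l, j, q, hq, hb⟩
    refine ⟨l, j, (LinearEquiv.ofBijective q hb).trans (shiftEquiv (S l) j), fun n x => ?_⟩
    change _ ↔ q x ∈ (S l).deg (j + n)
    rw [add_comm]
    exact ⟨hq n x, deg_of_map_deg hq hb.1 rfl⟩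

theorem isIsomorphic_of_bijective {q : M →ₗ[A] N} (hq : q ∈ gHom M N 0)
    (hb : Function.Bijective q) : M.IsIsomorphic N :=
  ⟨LinearEquiv.ofBijective q hb, fun n _ =>
    ⟨gHom_apply₀ hq, deg_of_map_deg hq hb.1 (add_zero n)⟩⟩

theorem deg_eq_bot_of_injective {i : X →ₗ[A] Y} (hi : i ∈ gHom X Y d)
    (hinj : Function.Injective i) {m : ℤ} (h : n + d = m) (hY : Y.deg m = ⊥) : X.deg n = ⊥ := by
  rw [eq_bot_iff]
  intro x hx
  have := gHom_apply hi hx h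
  rw [hY, Submodule.mem_bot] at this
  rw [Submodule.mem_bot]
  exact hinj (by rw [this, map_zero])

theorem deg_eq_bot_of_surjective {p : X →ₗ[A] Y} (hp : p ∈ gHom X Y d)
    (hs : Function.Surjective p) {m : ℤ} (h : n + d = m) (hX : X.deg n = ⊥) : Y.deg m = ⊥ := by
  rw [eq_bot_iff]
  intro y hy
  obtain ⟨x, hx, rfl⟩ := exists_deg_preimage hp hs h hy
  rw [hX, Submodule.mem_bot] at hx
  rw [hx, map_zero]
  exact zero_mem _

theorem InDown.of_injective {i : X →ₗ[A] Y} (hi : i ∈ gHom X Y d)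
    (hinj : Function.Injective i) (hY : Y.InDown) : X.InDown := by
  obtain ⟨hf, b, hb⟩ := hY
  refine ⟨fun n => ?_, b - d, fun n hn =>
    deg_eq_bot_of_injective hi hinj rfl (hb _ (by omega))⟩
  have := hf (n + d)
  exact FiniteDimensional.of_injective
    ((i.restrictScalars k).restrict (p := X.deg n) (q := Y.deg (n + d)) (hi n))
    fun x y h => Subtype.ext (hinj (congrArg Subtype.val h))

theorem InDown.of_surjective {p : X →ₗ[A] Y} (hp : p ∈ gHom X Y d)
    (hs : Function.Surjective p) (hX : X.InDown) : Y.InDown := by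
  obtain ⟨hf, b, hb⟩ := hX
  refine ⟨fun n => ?_, b + d, fun n hn =>
    deg_eq_bot_of_surjective hp hs (n := n - d) (by omega) (hb _ (by omega))⟩
  have := hf (n - d)
  have hm : ∀ x ∈ X.deg (n - d), p.restrictScalars k x ∈ Y.deg n := fun x hx =>
    gHom_apply hp hx (by omega)
  refine Module.Finite.of_surjective ((p.restrictScalars k).restrict hm) fun y => ?_
  obtain ⟨x, hx, hxy⟩ := exists_deg_preimage hp hs (n := n - d) (by omega) y.2
  exact ⟨⟨x, hx⟩, Subtype.ext hxy⟩

theorem InDown.ext {i : L →ₗ[A] M} {p : M →ₗ[A] N} (h : SES i p 0) (hL : L.InDown)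
    (hN : N.InDown) : M.InDown := by
  obtain ⟨hf, b, hb⟩ := hL
  obtain ⟨hf', b', hb'⟩ := hN
  refine ⟨fun n => ?_, min b b', fun n hn => ?_⟩
  · have := hf n
    have := hf' n
    let i' : L.deg n →ₗ[k] M.deg n :=
      (i.restrictScalars k).restrict fun x hx => gHom_apply₀ h.hi hx
    let p' : M.deg n →ₗ[k] N.deg n :=
      (p.restrictScalars k).restrict fun x hx => gHom_apply₀ h.hp hx
    have hle : LinearMap.ker p' ≤ LinearMap.range i' := by
      intro x hx
      obtain ⟨y, hy⟩ := (h.exact x.1).1 (congrArg Subtype.val (LinearMap.mem_ker.1 hx))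
      exact ⟨⟨y, deg_of_map_deg h.hi h.inj (add_zero n) (hy ▸ x.2)⟩, Subtype.ext hy⟩
    have : FiniteDimensional k (LinearMap.ker p') := Submodule.finiteDimensional_of_le hle
    refine Module.finite_def.2 (Submodule.fg_of_fg_map_of_fg_inf_ker p' ?_ ?_)
    · exact IsNoetherian.noetherian _
    · rw [top_inf_eq]
      exact (Submodule.fg_iff_finiteDimensional _).2 this
  · rw [eq_bot_iff]
    intro x hx
    have h1 := gHom_apply₀ h.hp hx
    rw [hb' n (by omega), Submodule.mem_bot] at h1
    obtain ⟨y, rfl⟩ := (h.exact x).1 h1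
    have h2 := deg_of_map_deg h.hi h.inj (add_zero n) hx
    rw [hb n (by omega), Submodule.mem_bot] at h2
    rw [h2, map_zero]
    exact zero_mem _

/-! ### Induction along filtrations -/

section Induction

variable {Φ : GrMod 𝒜 → Prop}

/-- An isomorphism is an extension with zero cokernel, so invariance under isomorphism of degree
zero need not be assumed separately. -/
theorem of_bijective_of_ext
    (hext : ∀ (L M N : GrMod 𝒜) (i : L →ₗ[A] M) (p : M →ₗ[A] N), SES i p 0 → Φ L → Φ N → Φ M)
    (h0 : ∀ X : GrMod 𝒜, (∀ j, X.deg j = ⊥) → Φ X) {i : L →ₗ[A] M} (hi : i ∈ gHom L M 0)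
    (hb : Function.Bijective i) (hL : Φ L) : Φ M := by
  refine hext L M (M.quot (topH M)) i (quotπ _) ⟨hi, quotπ_mem _, hb.1, quotπ_surjective _,
    fun y => ⟨fun _ => hb.2 y, fun _ => quotπ_eq_zero.2 trivial⟩⟩ hL (h0 _ fun j => ?_)
  rw [eq_bot_iff]
  rintro _ ⟨x, _, rfl⟩
  exact (Submodule.mem_bot k).2 ((quotπ_eq_zero (F := topH M)).2 trivial)

theorem sub_deg_eq_bot {F : M.HSub} (h : F.toSubmodule = ⊥) (j : ℤ) : (M.sub F).deg j = ⊥ := by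
  rw [eq_bot_iff]
  intro x _
  have := subι_mem_sub x
  rw [h, Submodule.mem_bot] at this
  exact (Submodule.mem_bot k).2 (subι_injective F (by rw [this, map_zero]))

theorem subι_bijective {F : M.HSub} (h : F.toSubmodule = ⊤) : Function.Bijective (subι F) :=
  ⟨subι_injective F, fun _ => exists_subι (h ▸ trivial)⟩

theorem of_filtration
    (hext : ∀ (L M N : GrMod 𝒜) (i : L →ₗ[A] M) (p : M →ₗ[A] N), SES i p 0 → Φ L → Φ N → Φ M)
    (h0 : ∀ X : GrMod 𝒜, (∀ j, X.deg j = ⊥) → Φ X) {F : ℕ → M.HSub} {n : ℕ}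
    (hF0 : (F 0).toSubmodule = ⊤) (hFn : Φ (M.sub (F n)))
    (hle : ∀ i < n, (F (i + 1)).toSubmodule ≤ (F i).toSubmodule)
    (hs : ∀ i < n, (F i).toSubmodule = ⊥ ∨ Φ (M.subquot (F i) (F (i + 1)))) : Φ M := by
  have key : ∀ m i, i + m = n → Φ (M.sub (F i)) := by
    intro m
    induction m with
    | zero => rintro i rfl; exact hFn
    | succ m ih =>
      intro i hi
      rcases hs i (by omega) with h | h
      · exact h0 _ (sub_deg_eq_bot h)
      · exact hext _ _ _ _ _ (ses_subquot (hle i (by omega))) (ih (i + 1) (by omega)) h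
  exact of_bijective_of_ext hext h0 (subι_mem _) (subι_bijective hF0) (key n 0 (zero_add n))

theorem HasFiniteFiltration.induction
    (hext : ∀ (L M N : GrMod 𝒜) (i : L →ₗ[A] M) (p : M →ₗ[A] N), SES i p 0 → Φ L → Φ N → Φ M)
    (h0 : ∀ X : GrMod 𝒜, (∀ j, X.deg j = ⊥) → Φ X)
    (hS : ∀ (X : GrMod 𝒜) (l : Λ) (j : ℤ), ∀ q ∈ gHom X (S l) j, Function.Bijective q → Φ X)
    (hM : HasFiniteFiltration S M) : Φ M := by
  obtain ⟨n, F, hF0, hFn, h⟩ := hM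
  refine of_filtration hext h0 hF0 (h0 _ (sub_deg_eq_bot hFn)) (fun i hi => (h i hi).1)
    fun i hi => Or.inr ?_
  obtain ⟨l, j, q, hq, hb⟩ := isShiftOf_iff.1 (h i hi).2
  exact hS _ l j q hq hb

/-- Every infinite filtration can be cut where its tail vanishes below degree `b`; the tail is
covered by `hb`, and only finitely many extensions remain. No passage to the limit is needed. -/
theorem InF.induction
    (hext : ∀ (L M N : GrMod 𝒜) (i : L →ₗ[A] M) (p : M →ₗ[A] N), SES i p 0 → Φ L → Φ N → Φ M)
    (b : ℤ) (hb : ∀ X : GrMod 𝒜, (∀ j < b, X.deg j = ⊥) → Φ X)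
    (hS : ∀ (X : GrMod 𝒜) (l : Λ) (j : ℤ), ∀ q ∈ gHom X (S l) j, Function.Bijective q → Φ X)
    (hM : InF S M) : Φ M := by
  have h0 : ∀ X : GrMod 𝒜, (∀ j, X.deg j = ⊥) → Φ X := fun X hX => hb X fun j _ => hX j
  have hC : ∀ X : GrMod 𝒜, InC S X → Φ X := by
    rintro X ⟨_, F, hF0, hle, hs, hlim⟩
    obtain ⟨n, hn⟩ := (hlim b).exists
    refine of_filtration hext h0 hF0 (hb _ hn) (fun i _ => hle i) fun i _ => ?_
    refine (hs i).imp_right fun h => ?_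
    obtain ⟨l, j, q, hq, hb⟩ := isShiftOf_iff.1 h
    exact hS _ l j q hq hb
  obtain ⟨_, n, F, hF0, hFn, h⟩ := hM
  exact of_filtration hext h0 hF0 (h0 _ (sub_deg_eq_bot hFn)) (fun i hi => (h i hi).1)
    fun i hi => Or.inr (hC _ (h i hi).2)

end Induction

/-! ### Construction of filtrations -/

variable (S) in
/-- `F / F'` is, up to shift, a member of the family `S`. -/
def Step (F F' : M.HSub) : Prop :=
  F'.toSubmodule ≤ F.toSubmodule ∧ ∃ (l : Λ) (j : ℤ), ∃ q ∈ gHom (M.sub F) (S l) j,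
    Function.Surjective q ∧ ∀ x, q x = 0 ↔ subι F x ∈ F'.toSubmodule

theorem Step.isShiftOf {F F' : M.HSub} (h : Step S F F') : IsShiftOf S (M.subquot F F') := by
  obtain ⟨hle, l, j, q, hq, hs, hker⟩ := h
  obtain ⟨g, hg, hgq⟩ := exists_factor (subquotπ_mem F F') (subquotπ_surjective F F') hq
    (fun y hy => (hker y).2 (subquotπ_eq_zero.1 hy)) (zero_add j)
  refine isShiftOf_iff.2 ⟨l, j, g, hg, ?_, fun z => ?_⟩
  · rw [injective_iff_map_eq_zero]
    intro y hy
    obtain ⟨x, rfl⟩ := subquotπ_surjective F F' y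
    rw [hgq, hker] at hy
    exact subquotπ_eq_zero.2 hy
  · obtain ⟨x, rfl⟩ := hs z
    exact ⟨subquotπ F F' x, hgq x⟩

theorem step_le {F F' : M.HSub} (h : Relation.ReflTransGen (Step S) F F') :
    F'.toSubmodule ≤ F.toSubmodule := by
  induction h with
  | refl => exact le_rfl
  | tail _ h ih => exact h.1.trans ih

/-- Consecutive terms may be joined by any finite number of steps, including none. To obtain a
filtration with exactly one step at a time, repetitions are skipped and the remaining chains are
concatenated. -/
theorem InC.of_chain (hM : M.InDown) {F : ℕ → M.HSub} (hF0 : (F 0).toSubmodule = ⊤)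
    (hs : ∀ i, Relation.ReflTransGen (Step S) (F i) (F (i + 1)))
    (hlim : ∀ n : ℤ, ∃ i, ∀ j < n, (M.sub (F i)).deg j = ⊥) : InC S M := by
  -- As in `InC`, the zero submodule may be repeated; any other transition must be a genuine step.
  let R : M.HSub → M.HSub → Prop := fun F F' =>
    (F.toSubmodule = ⊥ ∧ F'.toSubmodule ≤ F.toSubmodule) ∨ Step S F F'
  have hgen : ∀ i j, i ≤ j → Relation.ReflTransGen (Step S) (F i) (F j) := fun i j hij => by
    induction j, hij using Nat.le_induction with
    | base => exact Relation.ReflTransGen.refl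
    | succ j _ ih => exact ih.trans (hs j)
  have hbot : ∀ {F F' : M.HSub}, F'.toSubmodule ≤ F.toSubmodule → ∀ {j : ℤ},
      (M.sub F).deg j = ⊥ → (M.sub F').deg j = ⊥ := fun h j hj =>
    deg_eq_bot_of_injective (ses_subquot h).hi (ses_subquot h).inj (add_zero j) hj
  have hnext : ∀ i : ℕ, ∃ j : ℕ, i < j ∧ Relation.TransGen R (F i) (F j) := by
    intro i
    by_cases hi : (F i).toSubmodule = ⊥
    · exact ⟨i + 1, by omega, Relation.TransGen.single (Or.inl ⟨hi, step_le (hs i)⟩)⟩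
    · obtain ⟨x, hx, hx0⟩ := Submodule.exists_mem_ne_zero_of_ne_bot hi
      obtain ⟨n, hn⟩ := exists_proj_ne_zero hx0
      obtain ⟨j, hj⟩ := hlim (n + 1)
      -- `F i` is nonzero in degree `n`, while the later terms vanish there, so the sequence cannot
      -- stall at a nonzero term.
      have hne : ∀ j', j ≤ j' → F i ≠ F j' := by
        intro j' hjj' hij
        have := hbot (step_le (hgen _ _ hjj')) (hj n (by omega))
        rw [← hij] at this
        obtain ⟨y, hy, hyx⟩ := exists_subι_deg (F := F i) ((F i).proj_mem n hx) (M.proj_mem n x)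
        rw [this, Submodule.mem_bot] at hy
        rw [← hyx, hy, map_zero] at hn
        exact hn rfl
      -- This index exceeds `i` and is at least `j`, so `hne` rules out the trivial chain.
      refine ⟨i + j + 1, by omega, ?_⟩
      rcases Relation.reflTransGen_iff_eq_or_transGen.1 (hgen i (i + j + 1) (by omega)) with h | h
      · exact absurd h.symm (hne _ (by omega))
      · exact Relation.TransGen.mono (fun _ _ hab => Or.inr hab) _ _ h
  choose nx hnx hnx' using hnext
  let t : ℕ → ℕ := fun m => nx^[m] 0
  have ht : ∀ m, t (m + 1) = nx (t m) := fun m => Function.iterate_succ_apply' _ _ _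
  have htm : ∀ m, m ≤ t m := fun m => by
    induction m with
    | zero => exact Nat.zero_le _
    | succ m ih =>
      have := hnx (t m)
      rw [ht]; omega
  obtain ⟨y, hy0, hy, hyx⟩ := exists_chain_refinement (R := R) (x := fun m => F (t m))
    (fun m => by rw [ht]; exact hnx' _)
  have hyle : ∀ i, (y (i + 1)).toSubmodule ≤ (y i).toSubmodule := fun i =>
    (hy i).elim (fun h => h.2) fun h => h.1
  have hanti : ∀ i j, i ≤ j → (y j).toSubmodule ≤ (y i).toSubmodule := fun i j hij => by
    induction j, hij using Nat.le_induction with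
    | base => exact le_rfl
    | succ j _ ih => exact (hyle j).trans ih
  refine ⟨hM, y, by rw [hy0]; exact hF0, hyle, fun i => (hy i).imp And.left Step.isShiftOf,
    fun n => ?_⟩
  obtain ⟨i, hi⟩ := hlim n
  obtain ⟨m, hm⟩ := hyx i
  refine Filter.eventually_atTop.2 ⟨m, fun m' hm' j hj => ?_⟩
  refine hbot (hanti _ _ hm') ?_
  rw [hm]
  exact hbot (step_le (hgen _ _ (htm i))) (hi j hj)

section DirectSumChain

variable {ι : Type u} {T : ι → GrMod 𝒜} {F₀ : M.HSub} {p : M.sub F₀ →ₗ[A] directSum T}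

variable (T) in
/-- The part of a direct sum indexed by a set of indices. -/
def dsPart (s : Set ι) : (directSum T).HSub :=
  HSub.mk' (directSum T) (⨅ i : ↥sᶜ, LinearMap.ker (dsπ T i)) fun x hx n => by
    rw [Submodule.mem_iInf] at hx ⊢
    intro i
    rw [LinearMap.mem_ker, ← map_proj₀ (dsπ_mem _), LinearMap.mem_ker.1 (hx i), map_zero]

theorem mem_dsPart {s : Set ι} {x : directSum T} :
    x ∈ (dsPart T s).toSubmodule ↔ ∀ i ∉ s, dsπ T i x = 0 :=
  (Submodule.mem_iInf _).trans ⟨fun h i hi => h ⟨i, hi⟩, fun h i => h i.1 i.2⟩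

/-- The preimage in `M` of a part of a direct sum decomposition of a quotient of a submodule. -/
def partPreimage (hp : p ∈ gHom (M.sub F₀) (directSum T) d) (s : Set ι) : M.HSub :=
  mapH (subι F₀) (subι_mem F₀) (comapH p hp (dsPart T s))

theorem mem_partPreimage {hp : p ∈ gHom (M.sub F₀) (directSum T) d} {s : Set ι} {x : M.sub F₀} :
    subι F₀ x ∈ (partPreimage hp s).toSubmodule ↔ ∀ i ∉ s, dsπ T i (p x) = 0 := by
  rw [← mem_dsPart]
  constructor
  · rintro ⟨y, hy, hyx⟩
    rw [subι_injective _ hyx] at hy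
    exact hy
  · exact fun h => ⟨x, h, rfl⟩

theorem partPreimage_le {hp : p ∈ gHom (M.sub F₀) (directSum T) d} {s : Set ι} :
    (partPreimage hp s).toSubmodule ≤ F₀.toSubmodule := by
  rintro _ ⟨y, _, rfl⟩
  exact y.2

theorem step_partPreimage (hp : p ∈ gHom (M.sub F₀) (directSum T) d)
    (hs : Function.Surjective p)
    (hT : ∀ i, ∃ (l : Λ) (j : ℤ), ∃ q ∈ gHom (T i) (S l) j, Function.Bijective q)
    {s : Set ι} {i : ι} (hi : i ∉ s) :
    Step S (partPreimage hp (insert i s)) (partPreimage hp s) := by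
  have hle : (partPreimage hp s).toSubmodule ≤ (partPreimage hp (insert i s)).toSubmodule := by
    intro x hx
    obtain ⟨x, rfl⟩ := exists_subι (partPreimage_le hx)
    rw [mem_partPreimage] at hx ⊢
    exact fun j hj => hx j fun h => hj (Set.mem_insert_of_mem i h)
  obtain ⟨l, j, q, hq, hb⟩ := hT i
  have hin := (ses_subquot (partPreimage_le (hp := hp) (s := insert i s))).hi
  refine ⟨hle, l, d + j, q ∘ₗ dsπ T i ∘ₗ p ∘ₗ subIncl partPreimage_le,
    gHom_comp (gHom_comp (gHom_comp hin hp (zero_add d)) (dsπ_mem i) (add_zero d)) hq rfl,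
    fun z => ?_, fun x => ?_⟩
  · obtain ⟨z, rfl⟩ := hb.2 z
    obtain ⟨x, hx⟩ := hs (dsι T i z)
    obtain ⟨y, hy⟩ := exists_subι (mem_partPreimage (hp := hp) (s := insert i s) (x := x) |>.2
      fun j hj => by
        rw [hx, dsπ_dsι_ne]
        rintro rfl
        exact hj (Set.mem_insert _ _))
    have : subIncl partPreimage_le y = x := subι_injective _ (by rw [subι_subIncl, hy])
    exact ⟨y, by simp [this, hx]⟩
  · rw [← subι_subIncl (partPreimage_le (hp := hp) (s := insert i s)) x, mem_partPreimage]
    have hx := x.2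
    have hx' : subι F₀ (subIncl (partPreimage_le (hp := hp) (s := insert i s)) x) ∈
      (partPreimage hp (insert i s)).toSubmodule := hx
    rw [mem_partPreimage] at hx'
    simp only [LinearMap.comp_apply, map_eq_zero_iff _ hb.1]
    constructor
    · intro h j hj
      by_cases hji : j = i
      · rw [hji, h]
      · exact hx' j (by simp [hji, hj])
    · exact fun h => h i hi

theorem steps_partPreimage (hp : p ∈ gHom (M.sub F₀) (directSum T) d)
    (hs : Function.Surjective p)
    (hT : ∀ i, ∃ (l : Λ) (j : ℤ), ∃ q ∈ gHom (T i) (S l) j, Function.Bijective q)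
    (s : Set ι) {t : Set ι} (ht : t.Finite) :
    Relation.ReflTransGen (Step S) (partPreimage hp (t ∪ s)) (partPreimage hp s) := by
  induction t, ht using Set.Finite.induction_on with
  | empty => rw [Set.empty_union]
  | @insert i t hi _ ih =>
    by_cases his : i ∈ s
    · rwa [Set.insert_union, Set.insert_eq_of_mem (Set.mem_union_right t his)]
    · rw [Set.insert_union]
      exact Relation.ReflTransGen.head
        (step_partPreimage hp hs hT (fun h => h.elim hi his)) ih

end DirectSumChain

/-! ### Homogeneous maps out of finitely generated modules -/

theorem exists_homogeneous_generators (h : Module.Finite A M) :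
    ∃ s : Finset (ℤ × M), (∀ t ∈ s, t.2 ∈ M.deg t.1) ∧
      Submodule.span A ((fun t : ℤ × M => t.2) '' (s : Set (ℤ × M))) = ⊤ := by
  classical
  obtain ⟨s, hs⟩ := h.fg_top
  choose t ht using fun x : M => M.sum_proj x
  refine ⟨s.biUnion fun x => (t x).image fun n => (n, M.proj n x), ?_, ?_⟩
  · intro y hy
    simp only [Finset.mem_biUnion, Finset.mem_image] at hy
    obtain ⟨x, _, n, _, rfl⟩ := hy
    exact M.proj_mem n x
  · rw [eq_top_iff, ← hs, Submodule.span_le]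
    intro x hx
    rw [ht x]
    refine Submodule.sum_mem _ fun n hn => Submodule.subset_span ⟨(n, M.proj n x), ?_, rfl⟩
    simp only [Finset.coe_biUnion, Set.mem_iUnion, Finset.mem_coe, Finset.mem_image]
    exact ⟨x, hx, n, hn, rfl⟩

theorem gHom_eq_of_generators {s : Finset (ℤ × M)}
    (hs : Submodule.span A ((fun t : ℤ × M => t.2) '' (s : Set (ℤ × M))) = ⊤)
    {f g : M →ₗ[A] N} (h : ∀ t ∈ s, f t.2 = g t.2) : f = g :=
  LinearMap.ext_on hs (by rintro _ ⟨t, ht, rfl⟩; exact h t ht)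

theorem exists_bound_gHom_eq_zero (h : Module.Finite A M) :
    ∃ b : ℤ, ∀ (N : GrMod 𝒜) (c : ℤ), (∀ j < b + c, N.deg j = ⊥) → ∀ f ∈ gHom M N c, f = 0 := by
  obtain ⟨s, hs, hspan⟩ := exists_homogeneous_generators h
  obtain ⟨b, hb⟩ := (s.image Prod.fst).bddAbove
  -- Generators have degree at most `b`, so a map of degree `c` sends them to degrees below `b + 1 +
  -- c`, where `N` vanishes.
  refine ⟨b + 1, fun N c hN f hf => gHom_eq_of_generators hspan fun t ht => ?_⟩
  have h1 := hf _ _ (hs t ht)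
  have h2 : t.1 ≤ b := hb (by simpa using ⟨_, ht⟩)
  rw [hN _ (by omega), Submodule.mem_bot] at h1
  rw [h1, LinearMap.zero_apply]

theorem finiteDimensional_gHom (h : Module.Finite A M)
    (hN : ∀ n, FiniteDimensional k (N.deg n)) (c : ℤ) : FiniteDimensional k (gHom M N c) := by
  obtain ⟨s, hs, hspan⟩ := exists_homogeneous_generators h
  have := hN
  let φ : gHom M N c →ₗ[k] ∀ t : s, N.deg (t.1.1 + c) :=
    { toFun := fun f t => ⟨f.1 t.1.2, f.2 _ _ (hs _ t.2)⟩
      map_add' := fun f g => rfl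
      map_smul' := fun c f => rfl }
  refine FiniteDimensional.of_injective φ fun f g hfg => Subtype.ext ?_
  refine gHom_eq_of_generators hspan fun t ht => ?_
  exact congrArg Subtype.val (congrFun hfg ⟨t, ht⟩)

theorem E1.target_of_bijective {q : W →ₗ[A] Z} (hq : q ∈ gHom W Z d) (hb : Function.Bijective q)
    (h : E1 M Z (c + d)) : E1 M W c := by
  intro X Y i p e hs f hf
  obtain ⟨g, hg, hgf⟩ := h X Y i p e hs (q ∘ₗ f) (gHom_comp hf hq (by omega))
  obtain ⟨g', hg', hgg'⟩ := exists_lift hq hb.1 hg (fun y => hb.2 _) (c := c + e) (by omega)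
  exact ⟨g', hg', fun x => hb.1 (by rw [hgg', hgf]; rfl)⟩

theorem finite_ext {i : L →ₗ[A] M} {p : M →ₗ[A] N} (h : SES i p e) (hL : Module.Finite A L)
    (hN : Module.Finite A N) : Module.Finite A M := by
  refine Module.finite_def.2 (Submodule.fg_of_fg_map_of_fg_inf_ker p ?_ ?_)
  · rw [Submodule.map_top, LinearMap.range_eq_top.2 h.surj]
    exact hN.fg_top
  · have : LinearMap.ker p = LinearMap.range i := by
      ext y
      rw [LinearMap.mem_ker, h.exact, LinearMap.mem_range]
    rw [top_inf_eq, this, LinearMap.range_eq_map]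
    exact hL.fg_top.map i

end GrMod

/-! ### The two orthogonal classes `Perp` and `Good` -/

namespace PosGraded

open GrMod

variable {k A : Type u} [Field k] [Ring A] [Algebra k A] {𝒜 : ℤ → Submodule k A}
variable [GradedAlgebra 𝒜] {Λ : Type*} {E : PosGraded 𝒜 Λ} [Preorder Λ] [Finite Λ]
variable {L M N W X Y : GrMod 𝒜} {c d e n : ℤ}

variable (E) in
/-- The right orthogonal of the standard modules. -/
def Perp (N : GrMod 𝒜) : Prop := ∀ l c, E1 (E.Δ l) N c

variable (E) in
/-- The left orthogonal of the proper costandard modules. -/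
def Good (M : GrMod 𝒜) : Prop := ∀ l c, E1 M (E.properNabla l) c

theorem finite_Δ (l : Λ) : Module.Finite A (E.Δ l) := by
  refine Module.finite_def.2 ⟨{E.dgen l}, ?_⟩
  rw [eq_top_iff]
  intro x _
  obtain ⟨a, rfl⟩ := E.exists_dgen x
  exact Submodule.smul_mem _ a (Submodule.subset_span (by simp))

theorem Δ_inDown (l : Λ) : (E.Δ l).InDown :=
  (E.P_inDown l).of_surjective (E.ses_Δ l).hp (E.ses_Δ l).surj

/-- A map `K(l) → M` extends to `P(l)` after projection to `N`, and this extension lifts to `M` by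
projectivity. The error on `K(l)` takes values in `L`, where it extends as well. -/
theorem E1_Δ_ext_right {l : Λ} {i : L →ₗ[A] M} {p : M →ₗ[A] N} (h : SES i p 0)
    (hL : E1 (E.Δ l) L c) (hN : E1 (E.Δ l) N c) : E1 (E.Δ l) M c := by
  refine E.E1_Δ_of_extends fun f hf => ?_
  obtain ⟨g, hg, hgf⟩ := hN.extends (E.ses_Δ l) (gHom_comp hf h.hp (add_zero c))
  obtain ⟨g', hg', hgg'⟩ := E.P_lift h.hp h.surj hg
  rw [sub_zero] at hg'
  have hd : f - g' ∘ₗ subι (E.K l) ∈ gHom _ M c :=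
    sub_mem hf (gHom_comp (subι_mem _) hg' (zero_add c))
  obtain ⟨t, ht, hti⟩ := exists_lift h.hi h.inj hd (fun y => (h.exact _).1 (by
    rw [LinearMap.sub_apply, LinearMap.comp_apply, map_sub, hgg', hgf, LinearMap.comp_apply,
      sub_self])) (add_zero c)
  obtain ⟨s, hs, hst⟩ := hL.extends (E.ses_Δ l) ht
  refine ⟨g' + i ∘ₗ s, add_mem hg' (gHom_comp hs h.hi (add_zero c)), fun x => ?_⟩
  rw [LinearMap.add_apply, LinearMap.comp_apply, hst, hti]
  simp

variable (hE : E.IsStandardlyStratified)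
include hE

theorem finite_K (l : Λ) : Module.Finite A ((E.P l).sub (E.K l)) := by
  refine HasFiniteFiltration.induction (Φ := fun X => Module.Finite A X)
    (fun L M N i p h hL hN => finite_ext h hL hN) (fun X hX => ?_) (fun X l j q hq hb => ?_)
    (hE.filtration l)
  · have : Subsingleton X := ⟨fun x y => by
      rw [← sub_eq_zero]
      refine eq_zero_of_proj fun n => ?_
      have := X.proj_mem n (x - y)
      rwa [hX, Submodule.mem_bot] at this⟩
    infer_instance
  · have := finite_Δ (E := E) l
    exact Module.Finite.equiv (LinearEquiv.ofBijective q hb).symm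

/-- This is where part (b) of standard stratification enters: `K(l)` is a finite iterated extension
of shifted standard modules. By dimension shifting the statement amounts to Ext²(Δ(l), W) = 0. -/
theorem E1_K (l : Λ) (hW : Perp E W) (c : ℤ) : E1 ((E.P l).sub (E.K l)) W c := by
  refine HasFiniteFiltration.induction (Φ := fun X => ∀ c, E1 X W c)
    (fun L M N i p h hL hN c => (hL c).ext h (hN c)) (fun X hX c => ?_)
    (fun X l j q hq hb c => (hW l _).of_bijective' hq hb rfl) (hE.filtration l) c
  intro X' Y i p e h f hf
  have hi : ∀ y, ∃ x, i x = LinearMap.id (R := A) y := fun y => (h.exact y).1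
    (eq_zero_of_proj fun n => by
      have := X.proj_mem n (p y)
      rwa [hX, Submodule.mem_bot] at this)
  obtain ⟨r, hr, hri⟩ := exists_lift h.hi h.inj id_mem_gHom hi (add_zero 0)
  exact ⟨f ∘ₗ r, gHom_comp hr hf (zero_add _), fun x => by
    rw [LinearMap.comp_apply, h.inj (hri (i x))]⟩

/-- Induction with cut-off `1 - c`: by `E1_nabla_of_vanish`, a module that vanishes in degrees at
most `-c` has no extensions by ∇̄(m) in internal degree `c`. -/
theorem good_of_inF (hM : InF E.Δ M) : Good E M := by
  intro m c
  refine InF.induction (Φ := fun X => E1 X (E.properNabla m) c)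
    (fun L M N i p h hL hN => hL.ext h hN) (1 - c)
    (fun X hX => E.E1_nabla_of_vanish fun α _ n hn x hx _ => ?_)
    (fun X l j q hq hb => (E1_Δ_nabla hE l m _).of_bijective' hq hb rfl) hM
  rwa [hX n (by omega), Submodule.mem_bot] at hx

/-- `K(l)` is finitely generated, so it has no maps of degree `c` into a module that starts high
enough. This disposes of the tail of a filtration. -/
theorem perp_of_inF (hN : InF E.properNabla N) : Perp E N := by
  intro l c
  obtain ⟨b, hb⟩ := exists_bound_gHom_eq_zero (finite_K hE l)
  refine InF.induction (Φ := fun X => E1 (E.Δ l) X c)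
    (fun L M N i p h hL hN => E1_Δ_ext_right h hL hN) (b + c)
    (fun X hX => E.E1_Δ_of_extends fun f hf => ⟨0, zero_mem _, fun x => ?_⟩)
    (fun X m j q hq hb => (E1_Δ_nabla hE l m (c + j)).target_of_bijective hq hb) hN
  rw [hb X c hX f hf]
  rfl

end PosGraded

/-! ### Sums of shifted modules, and the radical -/

namespace GrMod

variable {k A : Type u} [Field k] [Ring A] [Algebra k A] {𝒜 : ℤ → Submodule k A}
variable [GradedAlgebra 𝒜] {L M N Q W X Y Z : GrMod 𝒜} {c d e n : ℤ}

/-- A morphism of degree zero, as a morphism between shifted modules. -/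
def shiftMap (f : X →ₗ[A] Y) (j : ℤ) : X.shift j →ₗ[A] Y.shift j :=
  (shiftEquiv Y j).toLinearMap ∘ₗ f ∘ₗ (shiftEquiv X j).symm.toLinearMap

theorem shiftMap_mem {f : X →ₗ[A] Y} (hf : f ∈ gHom X Y e) (j : ℤ) :
    shiftMap f j ∈ gHom (X.shift j) (Y.shift j) e :=
  gHom_comp (gHom_comp (shiftEquiv_symm_mem X j) hf rfl) (shiftEquiv_mem Y j) (by omega)

theorem SES.shift {i : X →ₗ[A] Y} {p : Y →ₗ[A] M} (h : SES i p e) (j : ℤ) :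
    SES (shiftMap i j) (shiftMap p j) e :=
  ⟨shiftMap_mem h.hi j, shiftMap_mem h.hp j, h.inj, h.surj, h.exact⟩

section ShiftSum

variable {ι : Type u} {S T R : ι → GrMod 𝒜} {δ : ι → ℤ}

variable (S δ) in
/-- The direct sum of the shifts `S i⟨-δ i⟩`. -/
def shiftSum : GrMod 𝒜 := directSum fun i => (S i).shift (-δ i)

variable (S δ) in
/-- The inclusions of the summands, as maps of degree `δ i`. -/
def ssι (i : ι) : S i →ₗ[A] shiftSum S δ :=
  dsι (fun i => (S i).shift (-δ i)) i ∘ₗ (shiftEquiv (S i) (-δ i)).toLinearMap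

variable (S δ) in
/-- The projections onto the summands, as maps of degree `-δ i`. -/
def ssπ (i : ι) : shiftSum S δ →ₗ[A] S i :=
  (shiftEquiv (S i) (-δ i)).symm.toLinearMap ∘ₗ dsπ (fun i => (S i).shift (-δ i)) i

theorem ssι_mem (i : ι) : ssι S δ i ∈ gHom (S i) (shiftSum S δ) (δ i) :=
  gHom_comp (d := - -δ i) (e := 0) (shiftEquiv_mem (S i) (-δ i))
    (dsι_mem (S := fun i => (S i).shift (-δ i)) i) (by omega)

theorem ssπ_mem (i : ι) : ssπ S δ i ∈ gHom (shiftSum S δ) (S i) (-δ i) :=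
  gHom_comp (d := 0) (dsπ_mem (S := fun i => (S i).shift (-δ i)) i)
    (shiftEquiv_symm_mem (S i) (-δ i)) (zero_add _)

theorem ssπ_ssι (i : ι) (x : S i) : ssπ S δ i (ssι S δ i x) = x :=
  dsπ_dsι_same (S := fun i => (S i).shift (-δ i)) i _

theorem ssπ_ssι_ne {i j : ι} (h : j ≠ i) (x : S i) : ssπ S δ j (ssι S δ i x) = 0 :=
  dsπ_dsι_ne (S := fun i => (S i).shift (-δ i)) h _

theorem ss_ext {x y : shiftSum S δ} (h : ∀ i, ssπ S δ i x = ssπ S δ i y) : x = y :=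
  ds_ext (S := fun i => (S i).shift (-δ i)) h

theorem ss_exists_sum (x : shiftSum S δ) :
    ∃ s : Finset ι, x = ∑ i ∈ s, ssι S δ i (ssπ S δ i x) :=
  ds_exists_sum (S := fun i => (S i).shift (-δ i)) x

theorem mem_shiftSum_deg {x : shiftSum S δ} :
    x ∈ (shiftSum S δ).deg n ↔ ∀ i, ssπ S δ i x ∈ (S i).deg (n - δ i) :=
  (mem_directSum_deg (S := fun i => (S i).shift (-δ i))).trans (forall_congr' fun i => by
    change _ ∈ (S i).deg (-δ i + n) ↔ _
    rw [neg_add_eq_sub]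
    rfl)

theorem exists_ss_desc {f : ∀ i, S i →ₗ[A] W} (hf : ∀ i, f i ∈ gHom (S i) W (d + δ i)) :
    ∃ g ∈ gHom (shiftSum S δ) W d, ∀ i x, g (ssι S δ i x) = f i x := by
  refine ⟨dsDesc fun i => f i ∘ₗ (shiftEquiv (S i) (-δ i)).symm.toLinearMap,
    dsDesc_mem fun i => gHom_comp (shiftEquiv_symm_mem (S i) (-δ i)) (hf i) (by omega),
    fun i x => ?_⟩
  exact dsDesc_dsι (S := fun i => (S i).shift (-δ i)) _ i _

theorem ss_hom_ext {f g : shiftSum S δ →ₗ[A] N} (h : ∀ i x, f (ssι S δ i x) = g (ssι S δ i x)) :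
    f = g :=
  ds_hom_ext (S := fun i => (S i).shift (-δ i)) h

theorem ss_E1 (h : ∀ i, E1 (S i) W (c + δ i)) : E1 (shiftSum S δ) W c :=
  E1.directSum fun i => (h i).of_bijective (shiftEquiv_mem _ _)
    (shiftEquiv _ _).bijective (by omega)

theorem ses_shiftSum {f : ∀ i, S i →ₗ[A] T i} {g : ∀ i, T i →ₗ[A] R i}
    (h : ∀ i, SES (f i) (g i) 0) : ∃ (κ : shiftSum S δ →ₗ[A] shiftSum T δ)
      (π : shiftSum T δ →ₗ[A] shiftSum R δ), SES κ π 0 ∧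
      (∀ i x, κ (ssι S δ i x) = ssι T δ i (f i x)) ∧ ∀ i x, π (ssι T δ i x) = ssι R δ i (g i x) :=
  ⟨_, _, ses_directSum fun i => (h i).shift (-δ i),
    fun i _ => dsMap_dsι (S := fun i => (S i).shift (-δ i)) (T := fun i => (T i).shift (-δ i)) _ i _,
    fun i _ => dsMap_dsι (S := fun i => (T i).shift (-δ i)) (T := fun i => (R i).shift (-δ i)) _ i _⟩

end ShiftSum

/-- The exact sequence `F / F' → M / F' → M / F`. -/
theorem exists_ses_subquot_quot {F' F : M.HSub} (h : F'.toSubmodule ≤ F.toSubmodule) :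
    ∃ (i : M.subquot F F' →ₗ[A] M.quot F') (p : M.quot F' →ₗ[A] M.quot F), SES i p 0 := by
  obtain ⟨i, hi, hi'⟩ := exists_factor (subquotπ_mem F F') (subquotπ_surjective F F')
    (gHom_comp (subι_mem F) (quotπ_mem F') (add_zero 0))
    (fun y hy => quotπ_eq_zero.2 (subquotπ_eq_zero.1 hy)) (add_zero 0)
  obtain ⟨p, hp, hp'⟩ := exists_factor (quotπ_mem F') (quotπ_surjective F') (quotπ_mem F)
    (fun y hy => quotπ_eq_zero.2 (h (quotπ_eq_zero.1 hy))) (add_zero 0)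
  refine ⟨i, p, hi, hp, ?_, fun z => ?_, fun y => ?_⟩
  · rw [injective_iff_map_eq_zero]
    intro x hx
    obtain ⟨x, rfl⟩ := subquotπ_surjective F F' x
    rw [hi'] at hx
    exact subquotπ_eq_zero.2 (quotπ_eq_zero.1 hx)
  · obtain ⟨x, rfl⟩ := quotπ_surjective F z
    exact ⟨quotπ F' x, hp' x⟩
  · obtain ⟨y, rfl⟩ := quotπ_surjective F' y
    rw [hp', quotπ_eq_zero]
    constructor
    · intro hy
      obtain ⟨x, rfl⟩ := exists_subι hy
      exact ⟨subquotπ F F' x, hi' x⟩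
    · rintro ⟨x, hx⟩
      obtain ⟨x, rfl⟩ := subquotπ_surjective F F' x
      rw [hi', LinearMap.comp_apply, ← sub_eq_zero, ← map_sub, quotπ_eq_zero] at hx
      have := sub_mem (subι_mem_sub x) (h hx)
      rwa [sub_sub_cancel] at this

/-- The submodule generated by the products of elements of positive degree with elements of `M`. -/
def rad (M : GrMod 𝒜) : M.HSub :=
  spanH {x | ∃ j > 0, ∃ a ∈ 𝒜 j, ∃ n, ∃ y ∈ M.deg n, x = a • y} (by
    rintro _ ⟨j, _, a, ha, n, y, hy, rfl⟩
    exact ⟨_, M.smul_mem_deg ha hy⟩)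

theorem smul_mem_rad {j : ℤ} (hj : 0 < j) {a : A} (ha : a ∈ 𝒜 j) (x : M) :
    a • x ∈ (rad M).toSubmodule := by
  induction x using homogeneous_induction with
  | h0 => rw [smul_zero]; exact zero_mem _
  | hadd x y hx hy => rw [smul_add]; exact add_mem hx hy
  | hdeg n x hx => exact Submodule.subset_span ⟨j, hj, a, ha, n, x, hx, rfl⟩

end GrMod

/-! ### Nakayama's lemma, levels and trace submodules -/

namespace PosGraded

open GrMod

variable {k A : Type u} [Field k] [Ring A] [Algebra k A] {𝒜 : ℤ → Submodule k A}
variable [GradedAlgebra 𝒜] {Λ : Type*} {E : PosGraded 𝒜 Λ}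
variable {L M N Q W X Y : GrMod 𝒜} {c d e n : ℤ}

variable (E) in
include E in
/-- Nakayama's lemma. -/
theorem eq_top_of_rad {b : ℤ} (hb : ∀ j < b, M.deg j = ⊥) {N : M.HSub}
    (h : ∀ x, ∃ y ∈ N.toSubmodule, x - y ∈ (rad M).toSubmodule) : N.toSubmodule = ⊤ := by
  have hrad : ∀ z ∈ (rad M).toSubmodule, ∀ n, (∀ m < n, ∀ x ∈ M.deg m, x ∈ N.toSubmodule) →
      M.proj n z ∈ N.toSubmodule := by
    intro z hz
    induction hz using Submodule.span_induction with
    | mem z hz =>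
      obtain ⟨j, hj, a, ha, m, y, hy, rfl⟩ := hz
      intro n hn
      have hay := M.smul_mem_deg ha hy
      by_cases hjm : j + m = n
      · subst hjm
        rw [M.proj_same hay]
        exact N.toSubmodule.smul_mem a (hn m (by omega) y hy)
      · rw [M.proj_ne hay hjm]
        exact zero_mem _
    | zero => intro n _; rw [map_zero]; exact zero_mem _
    | add x y _ _ hx hy => intro n hn; rw [map_add]; exact add_mem (hx n hn) (hy n hn)
    | smul a x _ hx =>
      intro n hn
      induction a using E.smul_induction with
      | h0 => rw [zero_smul, map_zero]; exact zero_mem _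
      | hadd a b ha hb => rw [add_smul, map_add]; exact add_mem ha hb
      | hdeg i hi a ha =>
        have := proj_smul ha (n - i) x
        rw [add_sub_cancel] at this
        rw [this]
        exact N.toSubmodule.smul_mem a (hx _ fun m hm => hn m (by omega))
  -- Induction on the degree, starting below `b`: a homogeneous component of a radical element is a
  -- combination of elements of strictly smaller degree.
  have key : ∀ (m : ℕ) (n : ℤ), n < b + m → ∀ x ∈ M.deg n, x ∈ N.toSubmodule := by
    intro m
    induction m with
    | zero =>
      intro n hn x hx
      rw [hb n (by simpa using hn), Submodule.mem_bot] at hx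
      rw [hx]
      exact zero_mem _
    | succ m ih =>
      intro n hn x hx
      obtain ⟨y, hy, hxy⟩ := h x
      have h1 := hrad _ hxy n fun m' hm' => ih m' (by push_cast at hn; omega)
      rw [map_sub, M.proj_same hx] at h1
      have := add_mem h1 (N.proj_mem n hy)
      rwa [sub_add_cancel] at this
  rw [eq_top_iff]
  intro x _
  induction x using homogeneous_induction with
  | h0 => exact zero_mem _
  | hadd x y hx hy => exact add_mem (hx trivial) (hy trivial)
  | hdeg n x hx => exact key (n - b + 1).toNat n (by omega) x hx

variable [Preorder Λ]

/-- The number of elements below `l`. -/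
def level (l : Λ) : ℕ := (Set.Iio l).ncard

section

variable [Finite Λ]

theorem level_mono {l m : Λ} (h : l ≤ m) : level l ≤ level m :=
  Set.ncard_le_ncard (Set.Iio_subset_Iio h) (Set.toFinite _)

theorem level_lt {l m : Λ} (h : l < m) : level l < level m := by
  refine Set.ncard_lt_ncard ⟨Set.Iio_subset_Iio h.le, fun h' => ?_⟩ (Set.toFinite _)
  exact lt_irrefl l (h' h)

theorem level_lt_card (l : Λ) : level l < Nat.card Λ := by
  rw [← Set.ncard_univ]
  refine Set.ncard_lt_ncard ⟨Set.subset_univ _, fun h => ?_⟩ (Set.toFinite _)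
  exact lt_irrefl l (h trivial)

end

variable (E) in
/-- The trace of the projective modules of level at least `r`. -/
def tr (M : GrMod 𝒜) (r : ℕ) : M.HSub :=
  spanH {x | (∃ n, x ∈ M.deg n) ∧ ∃ l : Λ, r ≤ level l ∧ E.e l • x = x} fun _ hx => hx.1

theorem e_smul_mem_tr {r : ℕ} {l : Λ} (hl : r ≤ level l) (x : M) :
    E.e l • x ∈ (tr E M r).toSubmodule := by
  induction x using homogeneous_induction with
  | h0 => rw [smul_zero]; exact zero_mem _
  | hadd x y hx hy => rw [smul_add]; exact add_mem hx hy
  | hdeg n x hx =>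
    exact Submodule.subset_span ⟨⟨n, E.e_smul_deg hx l⟩, l, hl, E.e_smul_e_smul l x⟩

theorem tr_le {r : ℕ} {H : Submodule A M}
    (h : ∀ l : Λ, r ≤ level l → ∀ x : M, E.e l • x ∈ H) : (tr E M r).toSubmodule ≤ H :=
  Submodule.span_le.2 fun _ ⟨_, l, hl, hx⟩ => hx ▸ h l hl _

theorem tr_anti {r s : ℕ} (h : r ≤ s) : (tr E M s).toSubmodule ≤ (tr E M r).toSubmodule :=
  tr_le fun _ hl x => e_smul_mem_tr (h.trans hl) x

theorem tr_zero : (tr E M 0).toSubmodule = ⊤ := by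
  rw [eq_top_iff]
  exact fun x _ => E.mem_of_e (p := (tr E M 0).toSubmodule.restrictScalars k)
    fun l => e_smul_mem_tr (Nat.zero_le _) x

theorem tr_eq_bot {r : ℕ} (h : ∀ l : Λ, r ≤ level l → ∀ x : M, E.e l • x = 0) :
    (tr E M r).toSubmodule = ⊥ :=
  eq_bot_iff.2 (tr_le fun l hl x => (Submodule.mem_bot A).2 (h l hl x))

theorem e_smul_quot_tr {r : ℕ} {l : Λ} (hl : r ≤ level l) (x : M.quot (tr E M r)) :
    E.e l • x = 0 := by
  obtain ⟨x, rfl⟩ := quotπ_surjective _ x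
  rw [← map_smul]
  exact quotπ_eq_zero.2 (e_smul_mem_tr hl x)

theorem tr_hom_eq_zero {r : ℕ} {f : M.sub (tr E M r) →ₗ[A] W}
    (h : ∀ l : Λ, r ≤ level l → ∀ x : W, E.e l • x = 0) : f = 0 := by
  have hle : (tr E M r).toSubmodule ≤ (LinearMap.ker f).map (subι (tr E M r)) := by
    refine Submodule.span_le.2 fun x hx => ?_
    obtain ⟨y, rfl⟩ := exists_subι (F := tr E M r) (Submodule.subset_span hx)
    obtain ⟨_, l, hl, he⟩ := hx
    refine ⟨y, ?_, rfl⟩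
    have : E.e l • y = y := subι_injective _ (by rw [map_smul, he])
    rw [SetLike.mem_coe, LinearMap.mem_ker, ← this, map_smul, h l hl]
  ext x
  obtain ⟨y, hy, hyx⟩ := hle x.2
  rw [subι_injective _ hyx] at hy
  exact hy

variable (E) in
/-- A direct sum of shifted standard modules. -/
abbrev stdSum {ι : Type u} (α : ι → Λ) (δ : ι → ℤ) : GrMod 𝒜 := shiftSum (fun i => E.Δ (α i)) δ

variable (E) in
/-- The inclusions of the summands. -/
abbrev stdι {ι : Type u} (α : ι → Λ) (δ : ι → ℤ) (i : ι) : E.Δ (α i) →ₗ[A] stdSum E α δ :=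
  ssι (fun i => E.Δ (α i)) δ i

variable (E) in
/-- The projections onto the summands. -/
abbrev stdπ {ι : Type u} (α : ι → Λ) (δ : ι → ℤ) (i : ι) : stdSum E α δ →ₗ[A] E.Δ (α i) :=
  ssπ (fun i => E.Δ (α i)) δ i

theorem exists_smul_dgen {l : Λ} {a : A} (ha : a ∈ 𝒜 0) : ∃ c : k, a • E.dgen l = c • E.dgen l := by
  have : a • E.dgen l ∈ Submodule.span k {E.dgen l} := E.smul_mem_of_e (fun m => by
    by_cases h : m = l
    · subst h; rw [e_dgen]; exact Submodule.mem_span_singleton_self _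
    · rw [E.e_smul_of_ne h (E.e_dgen l)]; exact zero_mem _) ha
  obtain ⟨c, hc⟩ := Submodule.mem_span_singleton.1 this
  exact ⟨c, hc.symm⟩

/-- A basis of the top of a module generated in level at least `r`. -/
theorem exists_top_basis {r : ℕ} (hgen : (tr E Q r).toSubmodule = ⊤) :
    ∃ (ι : Type u) (α : ι → Λ) (δ : ι → ℤ) (v : ι → Q), (∀ i, v i ∈ Q.deg (δ i)) ∧
      (∀ i, E.e (α i) • v i = v i) ∧ (∀ i, r ≤ level (α i)) ∧
      LinearIndependent k (fun i => quotπ (rad Q) (v i)) ∧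
      ⊤ ≤ Submodule.span k (Set.range fun i => quotπ (rad Q) (v i)) := by
  let G : Set (Q.quot (rad Q)) :=
    {x | ∃ n, ∃ l : Λ, r ≤ level l ∧ ∃ v ∈ Q.deg n, E.e l • v = v ∧ quotπ (rad Q) v = x}
  -- `G` generates over `A`. On the top, positive degrees act by zero and the idempotents permute `G
  -- ∪ {0}` into itself, so `G` already spans over `k`, and a basis can be chosen inside it.
  have hG : ⊤ ≤ Submodule.span k G := by
    have key : ∀ x ∈ (tr E Q r).toSubmodule, quotπ (rad Q) x ∈ Submodule.span k G := by
      intro x hx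
      induction hx using Submodule.span_induction with
      | mem x hx =>
        obtain ⟨⟨n, hn⟩, l, hl, he⟩ := hx
        exact Submodule.subset_span ⟨n, l, hl, x, hn, he, rfl⟩
      | zero => rw [map_zero]; exact zero_mem _
      | add x y _ _ hx hy => rw [map_add]; exact add_mem hx hy
      | smul a x _ hx =>
        rw [map_smul]
        induction a using E.smul_induction with
        | h0 => rw [zero_smul]; exact zero_mem _
        | hadd a b ha hb => rw [add_smul]; exact add_mem ha hb
        | hdeg i hi a ha =>
          by_cases hi0 : i = 0
          · subst hi0
            refine E.smul_mem_of_e (fun l => ?_) ha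
            clear ha
            generalize quotπ (rad Q) x = y at hx
            induction hx using Submodule.span_induction with
            | mem y hy =>
              obtain ⟨n, m, hm, v, hv, he, rfl⟩ := hy
              by_cases h : l = m
              · subst h
                rw [← map_smul, he]
                exact Submodule.subset_span ⟨n, l, hm, v, hv, he, rfl⟩
              · rw [← map_smul, E.e_smul_of_ne h he, map_zero]
                exact zero_mem _
            | zero => rw [smul_zero]; exact zero_mem _
            | add x y _ _ hx hy => rw [smul_add]; exact add_mem hx hy
            | smul c x _ hx => rw [smul_comm]; exact Submodule.smul_mem _ _ hx
          · rw [← map_smul, quotπ_eq_zero.2 (smul_mem_rad (by omega) ha x)]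
            exact zero_mem _
    intro x _
    obtain ⟨x, rfl⟩ := quotπ_surjective _ x
    exact key x (hgen ▸ trivial)
  obtain ⟨b, hbG, hspan, hli⟩ := exists_linearIndependent k G
  choose n l hl v hv he hvx using fun i : b => hbG i.2
  refine ⟨b, l, n, v, hv, he, hl, ?_, ?_⟩
  · have : (fun i => quotπ (rad Q) (v i)) = ((↑) : b → Q.quot (rad Q)) := funext hvx
    rw [this]
    exact hli
  · have : (fun i => quotπ (rad Q) (v i)) = ((↑) : b → Q.quot (rad Q)) := funext hvx
    rw [this, Subtype.range_coe, hspan]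
    exact hG

variable [Finite Λ] (hE : E.IsStandardlyStratified)
include hE

/-- For `level m ≥ r` the quotient has no weights above `m`, so extensions by ∇̄(m) vanish outright.
For `level m < r` the trace, being generated in levels at least `r`, has no nonzero maps to ∇̄(m),
and `E1.quot` applies. -/
theorem good_quot_tr (hM : Good E M) (r : ℕ) : Good E (M.quot (tr E M r)) := by
  intro m c
  by_cases hr : r ≤ level m
  · refine E.E1_nabla_of_vanish fun α hα n _ x _ he => ?_
    rw [← he]
    exact e_smul_quot_tr (hr.trans (level_mono hα)) x
  · refine (hM m c).quot (ses_sub_quot _) fun f _ => ⟨0, zero_mem _, fun x => ?_⟩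
    rw [tr_hom_eq_zero (f := f) fun l hl x => ?_]
    · rfl
    by_contra hx
    have := level_mono (nabla_weight hE hx)
    omega

/-- A module in the left orthogonal of the proper costandard modules which is concentrated in
levels at most `r` and generated in level `r` is a direct sum of standard modules. -/
theorem exists_std_decomposition {r : ℕ} (hQ : Good E Q) (hQd : Q.InDown)
    (hlev : ∀ l : Λ, r < level l → ∀ x : Q, E.e l • x = 0)
    (hgen : (tr E Q r).toSubmodule = ⊤) :
    ∃ (ι : Type u) (α : ι → Λ) (δ : ι → ℤ), ∃ φ ∈ gHom (stdSum E α δ) Q 0,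
      Function.Bijective φ ∧ ∀ i, level (α i) = r := by
  -- Each basis vector of the top lifts to a weight vector, which receives a map from a standard
  -- module because greater weights are absent. By Nakayama's lemma the sum `φ` of these maps is
  -- onto.
  obtain ⟨ι, α, δ, v, hv, he, hr, hli, hspan⟩ := exists_top_basis hgen
  have hv0 : ∀ i, v i ≠ 0 := fun i h => hli.ne_zero i (by rw [h, map_zero])
  have hlevel : ∀ i, level (α i) = r := fun i => by
    refine le_antisymm (not_lt.1 fun h => hv0 i ?_) (hr i)
    rw [← he, hlev _ h]
  have hf := fun i => E.exists_Δ_hom (hv i) (he i) fun m hm x =>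
    hlev m (by rw [← hlevel i]; exact level_lt hm) x
  choose f hf hfv using hf
  obtain ⟨φ, hφ, hφf⟩ := exists_ss_desc (d := 0) fun i => gHom_congr (hf i) (zero_add _).symm
  obtain ⟨b, hb⟩ := hQd.2
  have hδ : ∀ i, b ≤ δ i := fun i => by
    by_contra h
    have := hv i
    rw [hb _ (by omega), Submodule.mem_bot] at this
    exact hv0 i this
  have hφs : Function.Surjective φ := by
    have htop : (rangeH φ hφ).toSubmodule = ⊤ := by
      refine E.eq_top_of_rad hb fun x => ?_
      have hx := hspan (Submodule.mem_top (x := quotπ (rad Q) x))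
      have hle : Submodule.span k (Set.range fun i => quotπ (rad Q) (v i)) ≤
          ((LinearMap.range φ).restrictScalars k).map ((quotπ (rad Q)).restrictScalars k) := by
        rw [Submodule.span_le]
        rintro _ ⟨i, rfl⟩
        exact ⟨v i, ⟨stdι E α δ i (E.dgen _), by rw [hφf, hfv]⟩, rfl⟩
      obtain ⟨y, hy, hyx⟩ := hle hx
      refine ⟨y, hy, quotπ_eq_zero.1 ?_⟩
      rw [map_sub, sub_eq_zero]
      exact hyx.symm
    intro x
    have : x ∈ (rangeH φ hφ).toSubmodule := htop ▸ trivial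
    exact this
  have hDb : ∀ j < b, (stdSum E α δ).deg j = ⊥ := by
    intro j hj
    rw [eq_bot_iff]
    intro x hx
    rw [Submodule.mem_bot]
    refine ss_ext fun i => ?_
    obtain ⟨a, ha, hax⟩ := E.exists_dgen_deg (mem_shiftSum_deg.1 hx i)
    have := hδ i
    rw [E.neg _ (by omega), Submodule.mem_bot] at ha
    rw [map_zero, ← hax, ha, zero_smul]
  refine ⟨ι, α, δ, φ, hφ, ⟨?_, hφs⟩, hlevel⟩
  rw [injective_iff_map_eq_zero]
  by_contra! hker
  have hses := ses_ker hφ hφs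
  set Z := kerH φ hφ
  -- For injectivity, take a nonzero element of the kernel of lowest possible degree.
  obtain ⟨n, ⟨z, hz, hz0⟩, hmin⟩ : ∃ n : ℤ, (∃ z ∈ ((stdSum E α δ).sub Z).deg n, z ≠ 0) ∧
      ∀ m : ℤ, (∃ z ∈ ((stdSum E α δ).sub Z).deg m, z ≠ 0) → n ≤ m := by
    refine Int.exists_least_of_bdd ⟨b, fun m => ?_⟩ ?_
    · rintro ⟨z, hz, hz0⟩
      by_contra h
      have := gHom_apply₀ hses.hi hz
      rw [hDb m (by omega), Submodule.mem_bot] at this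
      exact hz0 (hses.inj (by rw [this, map_zero]))
    · obtain ⟨x, hx, hx0⟩ := hker
      obtain ⟨z, rfl⟩ := (hses.exact x).1 hx
      obtain ⟨n, hn⟩ := exists_proj_ne_zero (x := z) (fun h => hx0 (by rw [h, map_zero]))
      exact ⟨n, _, proj_mem _ n z, hn⟩
  obtain ⟨μ, hμ⟩ := E.exists_e_smul_ne_zero hz0
  obtain ⟨ψ, hψ⟩ := exists_dual_ne_zero (k := k) hμ
  -- By minimality of `n` everything else in the kernel sits above degree `n`, so a functional on
  -- its degree `n` part defines a map to ∇̄(μ). It extends to `g` on the whole sum because `Q` is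
  -- good.
  obtain ⟨f', hf', hfψ⟩ := E.exists_nabla_hom (l := μ) (d := -n) (E.component _ ψ μ n)
    (E.component_e ψ μ n) (fun m hm x hx => E.component_of_ne ψ μ hx (by omega))
    (by
      intro m _ j hj x hx _ a
      by_cases hx0 : x = 0
      · rw [hx0, smul_zero, map_zero]
      have := hmin j ⟨x, hx, hx0⟩
      induction a using E.smul_induction with
      | h0 => rw [zero_smul, map_zero]
      | hadd a b ha hb => rw [add_smul, map_add, ha, hb, add_zero]
      | hdeg i hi a ha =>
        exact E.component_of_ne ψ μ (GrMod.smul_mem_deg _ ha hx) (by omega))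
  obtain ⟨g, hg, hgf⟩ := (hQ μ (-n)).extends hses hf'
  set w := subι Z (E.e μ • z) with hw
  have hwd : w ∈ (stdSum E α δ).deg n := gHom_apply₀ hses.hi (E.e_smul_deg hz μ)
  have hwe : E.e μ • w = w := by rw [hw, ← map_smul, e_smul_e_smul]
  -- Compare `n` with the degree `δ i` of the generator. Below it the component of `w` is zero; at
  -- it, the component is a scalar multiple of the generator. Above it, the component becomes
  -- radical in `Q`, while `g` kills the generator, whose weight is at least `μ` and whose image
  -- lies outside the socle degree.
  have hcomp : ∀ i, ∃ c : k, E.ev μ (g (stdι E α δ i (stdπ E α δ i w))) =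
        c * E.ev μ (g (stdι E α δ i (E.dgen _))) ∧
      quotπ (rad Q) (φ (stdι E α δ i (stdπ E α δ i w))) = c • quotπ (rad Q) (v i) := by
    intro i
    obtain ⟨a, ha, hax⟩ := E.exists_dgen_deg (mem_shiftSum_deg.1 hwd i)
    have hsmul : φ (stdι E α δ i (stdπ E α δ i w)) = a • v i := by
      rw [← hax, map_smul, map_smul, hφf, hfv]
    rcases lt_trichotomy (n - δ i) 0 with hn | hn | hn
    · rw [E.neg _ hn, Submodule.mem_bot] at ha
      refine ⟨0, ?_, ?_⟩
      · rw [← hax, ha]; simp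
      · rw [hsmul, ha]; simp
    · rw [hn] at ha
      obtain ⟨c, hc⟩ := exists_smul_dgen (E := E) (l := α i) ha
      have hc1 : stdι E α δ i (c • E.dgen (α i)) = c • stdι E α δ i (E.dgen (α i)) :=
        ((stdι E α δ i).restrictScalars k).map_smul c _
      have hc2 : g (c • stdι E α δ i (E.dgen (α i))) = c • g (stdι E α δ i (E.dgen (α i))) :=
        (g.restrictScalars k).map_smul c _
      have hc3 : φ (c • stdι E α δ i (E.dgen (α i))) = c • φ (stdι E α δ i (E.dgen (α i))) :=
        (φ.restrictScalars k).map_smul c _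
      have hc4 : quotπ (rad Q) (c • v i) = c • quotπ (rad Q) (v i) :=
        ((quotπ (rad Q)).restrictScalars k).map_smul c _
      refine ⟨c, ?_, ?_⟩
      · rw [← hax, hc, hc1, hc2, map_smul, smul_eq_mul]
      · rw [← hax, hc, hc1, hc3, hφf, hfv, hc4]
    · refine ⟨0, ?_, ?_⟩
      · rw [zero_mul]
        by_cases h0 : stdπ E α δ i w = 0
        · rw [h0]; simp
        have hle : μ ≤ α i := Δ_weight hE (x := stdπ E α δ i w) (by rwa [← map_smul, hwe])
        have hz : g (stdι E α δ i (E.dgen (α i))) = 0 := by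
          refine E.nabla_eq_zero hle (d := 0 + δ i + -n) (by omega)
            (hg _ _ (ssι_mem i _ _ (E.dgen_mem _))) ?_
          rw [← map_smul, ← map_smul, e_dgen]
        rw [← hax, map_smul, map_smul, hz, smul_zero, map_zero]
      · rw [hsmul, zero_smul]
        exact quotπ_eq_zero.2 (smul_mem_rad hn ha _)
  choose c hc1 hc2 using hcomp
  obtain ⟨s, hs⟩ := ss_exists_sum w
  -- Since `φ w = 0`, linear independence in the top kills all coefficients, so `ev (g w) = 0`,
  -- contrary to the choice of `ψ`.
  have hsum : ∑ i ∈ s, c i • quotπ (rad Q) (v i) = 0 := by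
    rw [← Finset.sum_congr rfl fun i _ => hc2 i, ← map_sum, ← map_sum, ← hs, hw,
      hses.comp_eq_zero, map_zero]
  have hc0 := linearIndependent_iff'.1 hli s c hsum
  have h1 : E.ev μ (g w) = 0 := by
    rw [hs, map_sum, map_sum]
    exact Finset.sum_eq_zero fun i hi => by rw [hc1, hc0 i hi, zero_mul]
  rw [hw, hgf, hfψ, E.component_same ψ (E.e_smul_deg hz μ) (E.e_smul_e_smul μ z)] at h1
  exact hψ h1

end PosGraded

namespace GrMod

variable {k A : Type u} [Field k] [Ring A] [Algebra k A] {𝒜 : ℤ → Submodule k A}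
variable [GradedAlgebra 𝒜] {L M N Q W X Y Z : GrMod 𝒜} {c d e n : ℤ}

theorem bijective_of_deg_eq_bot {i : X →ₗ[A] Y} {p : Y →ₗ[A] M} (h : SES i p e)
    (hM : ∀ j, M.deg j = ⊥) : Function.Bijective i :=
  ⟨h.inj, fun y => (h.exact y).1 (eq_zero_of_proj fun n => by
    have := M.proj_mem n (p y)
    rwa [hM, Submodule.mem_bot] at this)⟩

theorem E1.of_deg_eq_bot (hM : ∀ j, M.deg j = ⊥) : E1 M W c := by
  intro X Y i p e h f hf
  obtain ⟨r, hr, hri, _⟩ := exists_inverse h.hi (bijective_of_deg_eq_bot h hM)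
  exact ⟨f ∘ₗ r, gHom_comp hr hf (by omega), fun x => congrArg f (hri x)⟩

end GrMod

/-! ### Good modules are filtered by standard modules -/

namespace PosGraded

open GrMod

variable {k A : Type u} [Field k] [Ring A] [Algebra k A] {𝒜 : ℤ → Submodule k A}
variable [GradedAlgebra 𝒜] {Λ : Type*} {E : PosGraded 𝒜 Λ} [Preorder Λ] [Finite Λ]
variable {L M N Q W X Y : GrMod 𝒜} {c d e n : ℤ} {ι : Type u} {α : ι → Λ} {δ : ι → ℤ}

theorem Good.ext {i : L →ₗ[A] M} {p : M →ₗ[A] N} (h : SES i p 0) (hL : Good E L)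
    (hN : Good E N) : Good E M := fun l c => (hL l c).ext h (hN l c)

theorem Good.of_bijective {q : M →ₗ[A] N} (hq : q ∈ gHom M N d) (hb : Function.Bijective q)
    (h : Good E M) : Good E N := fun l _ => (h l _).of_bijective hq hb rfl

theorem Good.of_bijective' {q : M →ₗ[A] N} (hq : q ∈ gHom M N d) (hb : Function.Bijective q)
    (h : Good E N) : Good E M := fun l _ => (h l _).of_bijective' hq hb rfl

theorem Perp.of_bijective' {q : M →ₗ[A] N} (hq : q ∈ gHom M N d) (hb : Function.Bijective q)
    (h : Perp E N) : Perp E M := fun l c => (h l (c + d)).target_of_bijective hq hb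

variable (E) in
/-- Kernels of epimorphisms from good modules to `N` are good. -/
def Resolving (N : GrMod 𝒜) : Prop :=
  ∀ (Q M : GrMod 𝒜) (i : Q →ₗ[A] M) (p : M →ₗ[A] N), SES i p 0 → Good E M → Good E Q

/-- The kernel of `X → M` is reached in two stages: first the kernel `F` of the composite `X → N`,
then the kernel of `F → L`. -/
theorem Resolving.ext {i₀ : L →ₗ[A] M} {p₀ : M →ₗ[A] N} (h₀ : SES i₀ p₀ 0) (hL : Resolving E L)
    (hN : Resolving E N) : Resolving E M := by
  intro Q X i p h hX
  have hq : p₀ ∘ₗ p ∈ gHom X N 0 := gHom_comp h.hp h₀.hp (add_zero _)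
  have hF := ses_ker hq (h₀.surj.comp h.surj)
  have hgood := hN _ _ _ _ hF hX
  set F := kerH _ hq
  obtain ⟨p', hp', hp'p⟩ := exists_lift h₀.hi h₀.inj (gHom_comp (subι_mem F) h.hp (zero_add 0))
    (fun y => (h₀.exact _).1 (hF.comp_eq_zero y)) (c := 0) (add_zero 0)
  obtain ⟨i', hi', hi'i⟩ := exists_lift hF.hi hF.inj h.hi
    (fun x => (hF.exact _).1 (by simp [h.comp_eq_zero])) (c := 0) (add_zero 0)
  refine hL _ _ i' p' ⟨hi', hp', fun x x' hx => h.inj ?_, fun z => ?_, fun y => ?_⟩ hgood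
  · rw [← hi'i, hx, hi'i]
  · obtain ⟨y, hy⟩ := h.surj (i₀ z)
    obtain ⟨y', hy'⟩ := (hF.exact y).1 (by simp [hy, h₀.comp_eq_zero])
    refine ⟨y', h₀.inj ?_⟩
    rw [hp'p, LinearMap.comp_apply, hy', hy]
  · rw [← map_eq_zero_iff _ h₀.inj, hp'p, LinearMap.comp_apply, h.exact]
    refine exists_congr fun x => ?_
    rw [← hi'i, hF.inj.eq_iff]

theorem Resolving.of_deg_eq_bot (hN : ∀ j, N.deg j = ⊥) : Resolving E N := fun _ _ _ _ h hM =>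
  hM.of_bijective' h.hi (bijective_of_deg_eq_bot h hN)

theorem exists_std_presentation (α : ι → Λ) (δ : ι → ℤ) :
    ∃ (κ : shiftSum (fun i => (E.P (α i)).sub (E.K (α i))) δ →ₗ[A] shiftSum (fun i => E.P (α i)) δ)
      (π : shiftSum (fun i => E.P (α i)) δ →ₗ[A] stdSum E α δ), SES κ π 0 ∧
      (∀ i x, κ (ssι _ δ i x) = ssι _ δ i (subι _ x)) ∧
      ∀ i x, π (ssι _ δ i x) = stdι E α δ i (E.Δπ _ x) :=
  ses_shiftSum fun i => E.ses_Δ (α i)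

theorem P_sum_lift {p : Y →ₗ[A] M} (hp : p ∈ gHom Y M e) (hs : Function.Surjective p)
    {f : shiftSum (fun i => E.P (α i)) δ →ₗ[A] M} (hf : f ∈ gHom _ M d) :
    ∃ g ∈ gHom (shiftSum (fun i => E.P (α i)) δ) Y (d - e), ∀ x, p (g x) = f x := by
  choose g hg hgf using fun i => E.P_lift hp hs
    (gHom_comp (ssι_mem (S := fun i => E.P (α i)) (δ := δ) i) hf (add_comm (δ i) d))
  obtain ⟨G, hG, hGg⟩ := exists_ss_desc (δ := δ) (d := d - e) (f := g) fun i => gHom_congr (hg i) (by omega)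
  refine ⟨G, hG, fun x => ?_⟩
  have : p ∘ₗ G = f := ss_hom_ext fun i x => by
    rw [LinearMap.comp_apply, hGg, hgf]; rfl
  rw [← this]; rfl

variable (hE : E.IsStandardlyStratified)
include hE

theorem perp_nabla (l : Λ) : Perp E (E.properNabla l) := fun m c => E1_Δ_nabla hE m l c

theorem good_Δ (l : Λ) : Good E (E.Δ l) := fun m c => E1_Δ_nabla hE l m c

theorem good_stdSum (α : ι → Λ) (δ : ι → ℤ) : Good E (stdSum E α δ) := fun _ _ =>
  ss_E1 fun i => good_Δ hE (α i) _ _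

/-- `E1.of_presentation` for the sum of the presentations `K → P → Δ`; the syzygy has no extensions
by ∇̄(l), by `E1_K`. -/
theorem resolving_stdSum (α : ι → Λ) (δ : ι → ℤ) : Resolving E (stdSum E α δ) := by
  intro Q M i p h hM l c
  obtain ⟨κ, π, hκ, -, -⟩ := exists_std_presentation (E := E) α δ
  obtain ⟨v, hv, hvπ⟩ := P_sum_lift h.hp h.surj hκ.hp
  rw [sub_zero] at hv
  exact E1.of_presentation h hκ hv hvπ (ss_E1 fun i => E1_K hE (α i) (perp_nabla hE l) _) (hM l c)

/-- The layer is the kernel of `M / tr (r + 1) → M / tr r`, whose source is good, so it is good when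
the target is resolving. Its levels are at most `r` and it is generated in level `r`. -/
theorem exists_layer_of_resolving (hM : Good E M) (hMd : M.InDown) {r : ℕ}
    (hres : Resolving E (M.quot (tr E M r))) : ∃ (ι : Type u) (α : ι → Λ) (δ : ι → ℤ),
      ∃ φ ∈ gHom (stdSum E α δ) (M.subquot (tr E M r) (tr E M (r + 1))) 0,
      Function.Bijective φ ∧ ∀ i, level (α i) = r := by
  obtain ⟨i, p, h⟩ := exists_ses_subquot_quot (tr_anti (E := E) (M := M) (Nat.le_succ r))
  have hd : (M.subquot (tr E M r) (tr E M (r + 1))).InDown :=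
    (hMd.of_injective (subι_mem _) (subι_injective (tr E M r))).of_surjective
      (subquotπ_mem _ (tr E M (r + 1))) (subquotπ_surjective _ _)
  refine exists_std_decomposition hE (hres _ _ _ _ h (good_quot_tr hE hM _)) hd
    (fun l hl x => h.inj ?_) ?_
  · rw [map_smul, map_zero]
    exact e_smul_quot_tr hl _
  · rw [eq_top_iff]
    intro x _
    obtain ⟨x, rfl⟩ := subquotπ_surjective _ _ x
    let H : Submodule A (M.sub (tr E M r)) :=
      (tr E (M.subquot (tr E M r) (tr E M (r + 1))) r).toSubmodule.comap
        (subquotπ (tr E M r) (tr E M (r + 1)))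
    obtain ⟨y, hy, hyx⟩ : subι _ x ∈ H.map (subι (tr E M r)) := by
      refine tr_le (fun l hl z => ?_) (subι_mem_sub x)
      obtain ⟨w, hw⟩ := exists_subι (F := tr E M r) (e_smul_mem_tr hl z)
      refine ⟨w, ?_, hw⟩
      have : w = E.e l • w := subι_injective _ (by rw [map_smul, hw, e_smul_e_smul])
      rw [this]
      change subquotπ (tr E M r) (tr E M (r + 1)) (E.e l • w) ∈
        (tr E (M.subquot (tr E M r) (tr E M (r + 1))) r).toSubmodule
      rw [map_smul]
      exact e_smul_mem_tr hl _
    rw [← subι_injective _ hyx]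
    exact hy

/-- Interleaved induction: once `M / tr r` is resolving, the next layer is a sum of standard
modules, hence resolving, and so is the extension `M / tr (r + 1)`. -/
theorem resolving_quot_tr (hM : Good E M) (hMd : M.InDown) (r : ℕ) :
    Resolving E (M.quot (tr E M r)) := by
  induction r with
  | zero =>
    refine Resolving.of_deg_eq_bot fun j => ?_
    rw [eq_bot_iff]
    rintro _ ⟨x, _, rfl⟩
    refine (Submodule.mem_bot k).2 ((quotπ_eq_zero (F := tr E M 0)).2 ?_)
    rw [tr_zero]
    trivial
  | succ r ih =>
    obtain ⟨i, p, h⟩ := exists_ses_subquot_quot (tr_anti (E := E) (M := M) (Nat.le_succ r))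
    obtain ⟨ι, α, δ, φ, hφ, hb, -⟩ := exists_layer_of_resolving hE hM hMd ih
    exact Resolving.ext h (of_bijective_of_ext (Φ := Resolving E)
      (fun _ _ _ _ _ h hL hN => Resolving.ext h hL hN)
      (fun _ hX => Resolving.of_deg_eq_bot hX) hφ hb (resolving_stdSum hE α δ)) ih

/-- The layers of the trace filtration of a good module are direct sums of standard modules. -/
theorem exists_layer (hM : Good E M) (hMd : M.InDown) (r : ℕ) :
    ∃ (ι : Type u) (α : ι → Λ) (δ : ι → ℤ),
      ∃ φ ∈ gHom (stdSum E α δ) (M.subquot (tr E M r) (tr E M (r + 1))) 0,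
      Function.Bijective φ ∧ ∀ i, level (α i) = r :=
  exists_layer_of_resolving hE hM hMd (resolving_quot_tr hE hM hMd r)

omit hE in
theorem tr_card_eq_bot : (tr E M (Nat.card Λ)).toSubmodule = ⊥ :=
  tr_eq_bot fun l hl _ => absurd (level_lt_card l) (not_lt.2 hl)

theorem Good.induction {Φ : GrMod 𝒜 → Prop}
    (hext : ∀ (L M N : GrMod 𝒜) (i : L →ₗ[A] M) (p : M →ₗ[A] N), SES i p 0 → Φ L → Φ N → Φ M)
    (h0 : ∀ X : GrMod 𝒜, (∀ j, X.deg j = ⊥) → Φ X)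
    (hS : ∀ (ι : Type u) (α : ι → Λ) (δ : ι → ℤ), Φ (stdSum E α δ))
    (hM : Good E M) (hMd : M.InDown) : Φ M := by
  refine of_filtration hext h0 (F := tr E M) (n := Nat.card Λ) tr_zero
    (h0 _ (sub_deg_eq_bot tr_card_eq_bot)) (fun i _ => tr_anti (Nat.le_succ i)) fun i _ => Or.inr ?_
  obtain ⟨ι, α, δ, φ, hφ, hb, -⟩ := exists_layer hE hM hMd i
  exact of_bijective_of_ext hext h0 hφ hb (hS ι α δ)

theorem E1_of_good_of_perp (hM : Good E M) (hMd : M.InDown) (hN : Perp E N) (c : ℤ) :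
    E1 M N c :=
  Good.induction hE (Φ := fun X => E1 X N c) (fun _ _ _ _ _ h hL hN => hL.ext h hN)
    (fun _ h => E1.of_deg_eq_bot h) (fun _ _ _ => ss_E1 fun _ => hN _ _) hM hMd

/-- The generators placed in degree `n` are nonzero and lie in different summands, so they are
linearly independent in a finite dimensional space. -/
theorem finite_stdSum_index (hd : (stdSum E α δ).InDown) (n : ℤ) : {i | δ i = n}.Finite := by
  have := hd.1 n
  let v : {i | δ i = n} → (stdSum E α δ).deg n := fun i =>
    ⟨stdι E α δ i (E.dgen _), gHom_apply (ssι_mem _) (E.dgen_mem _) (by rw [zero_add]; exact i.2)⟩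
  have hv : LinearIndependent k v := by
    refine linearIndependent_iff'.2 fun s g hg i hi => ?_
    have h1 := congrArg (fun y => stdπ E α δ i y) (congrArg Subtype.val hg)
    simp only [AddSubmonoidClass.coe_finsetSum, map_sum] at h1
    rw [Finset.sum_eq_single i] at h1
    · have h2 : stdπ E α δ i (g i • stdι E α δ i (E.dgen _)) = g i • E.dgen (α i) := by
        rw [LinearMap.map_smul_of_tower, ssπ_ssι]
      have h3 : g i • E.dgen (α i) = 0 := by rw [← h2]; exact h1.trans (map_zero _)
      exact (smul_eq_zero.1 h3).resolve_right (dgen_ne_zero hE _)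
    · intro j _ hj
      refine (LinearMap.map_smul_of_tower (stdπ E α δ i) (g j) (stdι E α δ j (E.dgen _))).trans ?_
      rw [ssπ_ssι_ne (fun h => hj (Subtype.ext h.symm)), smul_zero]
    · exact fun h => absurd hi h
  exact Set.finite_coe_iff.1 hv.finite

theorem exists_le_stdSum_index (hd : (stdSum E α δ).InDown) : ∃ b : ℤ, ∀ i, b ≤ δ i := by
  obtain ⟨b, hb⟩ := hd.2
  refine ⟨b, fun i => ?_⟩
  by_contra h
  have h1 := gHom_apply (ssι_mem (S := fun i => E.Δ (α i)) (δ := δ) i) (E.dgen_mem _)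
    (zero_add (δ i))
  rw [hb _ (by omega), Submodule.mem_bot] at h1
  have h2 := ssπ_ssι (S := fun i => E.Δ (α i)) (δ := δ) i (E.dgen (α i))
  rw [h1, map_zero] at h2
  exact dgen_ne_zero hE _ h2.symm

omit hE in
theorem Δ_eq_zero_of_neg {l : Λ} {x : E.Δ l} (hx : x ∈ (E.Δ l).deg n) (hn : n < 0) : x = 0 := by
  obtain ⟨a, ha, rfl⟩ := E.exists_dgen_deg hx
  rw [E.neg _ hn, Submodule.mem_bot] at ha
  rw [ha, zero_smul]

theorem inC_of_bijective {φ : M →ₗ[A] stdSum E α δ} (hφ : φ ∈ gHom M (stdSum E α δ) 0)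
    (hb : Function.Bijective φ) (hM : M.InDown) : InC E.Δ M := by
  have hd : (stdSum E α δ).InDown := hM.of_surjective hφ hb.2
  obtain ⟨b, hδ⟩ := exists_le_stdSum_index hE hd
  let p : M.sub (topH M) →ₗ[A] stdSum E α δ := φ ∘ₗ subι (topH M)
  have hp : p ∈ gHom _ (stdSum E α δ) 0 := gHom_comp (subι_mem _) hφ (add_zero 0)
  have hps : Function.Surjective p := hb.2.comp (subι_bijective rfl).2
  -- Summands are removed in the order of the degrees of their generators: finitely many at a time,
  -- and what remains after `m` rounds starts in degree at least `b + m`.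
  let s : ℕ → Set ι := fun m => {i | b + m ≤ δ i}
  let F : ℕ → M.HSub := fun m => partPreimage (T := fun i => (E.Δ (α i)).shift (-δ i)) hp (s m)
  have hF : ∀ m (x : M.sub (topH M)), subι _ x ∈ (F m).toSubmodule ↔
      ∀ i ∉ s m, stdπ E α δ i (p x) = 0 := fun m x => mem_partPreimage
  refine InC.of_chain hM (F := F) ?_ (fun m => ?_) fun n => ⟨(n - b).toNat, fun j hj => ?_⟩
  · rw [eq_top_iff]
    intro x _
    obtain ⟨x, rfl⟩ := exists_subι (F := topH M) (x := x) trivial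
    exact (hF 0 x).2 fun i hi => absurd (show b + (0 : ℕ) ≤ δ i by simpa using hδ i) hi
  · have hst : s m = {i | δ i = b + m} ∪ s (m + 1) := by
      ext i
      simp only [s, Set.mem_ofPred_eq, Set.mem_union]
      push_cast
      omega
    have := steps_partPreimage (S := E.Δ) (T := fun i => (E.Δ (α i)).shift (-δ i)) hp hps
      (fun i => ⟨α i, _, _, shiftEquiv_symm_mem _ _, (shiftEquiv _ _).symm.bijective⟩) (s (m + 1))
      (finite_stdSum_index hE hd (b + m))
    rw [← hst] at this
    exact this
  · rw [eq_bot_iff]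
    intro x hx
    obtain ⟨y, hy⟩ := exists_subι (F := topH M) (x := subι _ x) trivial
    have hmem := subι_mem_sub x
    rw [← hy, hF] at hmem
    have hyd : y ∈ (M.sub (topH M)).deg j := mem_sub_deg.2 (by rw [hy]; exact mem_sub_deg.1 hx)
    have h0 : p y = 0 := ss_ext fun i => by
      rw [map_zero]
      by_cases hi : i ∈ s (n - b).toNat
      · have hi' : b + ((n - b).toNat : ℤ) ≤ δ i := hi
        exact Δ_eq_zero_of_neg (mem_shiftSum_deg.1 (gHom_apply₀ hp hyd) i) (by omega)
      · exact hmem i hi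
    have h1 : y = 0 := (hb.1.comp (subι_injective (topH M))) (h0.trans (map_zero p).symm)
    rw [h1, map_zero] at hy
    exact (Submodule.mem_bot k).2 (subι_injective _ (hy.symm.trans (map_zero _).symm))

theorem inF_of_good (hM : Good E M) (hMd : M.InDown) : InF E.Δ M := by
  refine ⟨hMd, Nat.card Λ, tr E M, tr_zero, tr_card_eq_bot, fun i _ =>
    ⟨tr_anti (Nat.le_succ i), ?_⟩⟩
  obtain ⟨ι, α, δ, φ, hφ, hb, -⟩ := exists_layer hE hM hMd i
  obtain ⟨ψ, hψ, h1, h2⟩ := exists_inverse hφ hb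
  refine inC_of_bijective hE (φ := ψ) hψ ⟨Function.LeftInverse.injective h2,
    Function.RightInverse.surjective h1⟩ ?_
  exact (hMd.of_injective (subι_mem _) (subι_injective (tr E M i))).of_surjective
    (subquotπ_mem _ (tr E M (i + 1))) (subquotπ_surjective _ _)

end PosGraded

/-! ### Submodules avoiding prescribed graded weights -/

namespace PosGraded

open GrMod

variable {k A : Type u} [Field k] [Ring A] [Algebra k A] {𝒜 : ℤ → Submodule k A}
variable [GradedAlgebra 𝒜] {Λ : Type*} {E : PosGraded 𝒜 Λ}
variable {L M N Q W X Y : GrMod 𝒜} {c d e m n : ℤ} {S S' : Λ → ℤ → Prop}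

variable (E S) in
/-- The graded weight spaces of `M` indexed by `S` vanish. -/
def Avoids (M : GrMod 𝒜) : Prop := ∀ l n, S l n → ∀ x ∈ M.deg n, E.e l • x = 0

variable (E S) in
/-- Every nonzero submodule of `M` has a nonzero weight space indexed by `S`. -/
def Detects (M : GrMod 𝒜) : Prop :=
  ∀ x : M, (∀ (a : A) l n, S l n → M.proj n (E.e l • a • x) = 0) → x = 0

theorem Avoids.of_surjective {p : X →ₗ[A] Y} (hp : p ∈ gHom X Y 0) (hs : Function.Surjective p)
    (h : Avoids E S X) : Avoids E S Y := fun l n hS y hy => by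
  obtain ⟨x, hx, rfl⟩ := exists_deg_preimage hp hs (add_zero n) hy
  rw [← map_smul, h l n hS x hx, map_zero]

theorem Avoids.proj_eq_zero (h : Avoids E S M) {l : Λ} (hS : S l n) (x : M) :
    M.proj n (E.e l • x) = 0 := by
  rw [proj_e_smul, h l n hS _ (M.proj_mem n x)]

theorem Avoids.e_smul_eq_zero (h : Avoids E S M) {l : Λ} (hS : ∀ n, S l n) (x : M) :
    E.e l • x = 0 := eq_zero_of_proj fun n => h.proj_eq_zero (hS n) x

variable (E S) in
/-- The largest submodule all of whose graded weight spaces indexed by `S` vanish. -/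
def av (M : GrMod 𝒜) : M.HSub :=
  HSub.mk' M
    { carrier := {x | ∀ (a : A) l n, S l n → M.proj n (E.e l • a • x) = 0}
      zero_mem' := fun a l n _ => by simp
      add_mem' := fun hx hy a l n hS => by
        rw [smul_add, smul_add, map_add, hx a l n hS, hy a l n hS, add_zero]
      smul_mem' := fun b x hx a l n hS => by rw [smul_smul a b]; exact hx _ l n hS } <| by
    intro x hx n a l m hS
    induction a using E.smul_induction with
    | h0 => simp
    | hadd a b ha hb => rw [add_smul, smul_add, map_add, ha, hb, add_zero]
    | hdeg i hi a ha =>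
      by_cases h : i + n = m
      · subst h
        have := hx a l (i + n) hS
        rw [proj_e_smul, proj_smul ha] at this ⊢
        rwa [proj_same _ (proj_mem _ _ _)]
      · rw [proj_e_smul, proj_ne _ (smul_mem_deg _ ha (proj_mem _ _ _)) h, smul_zero]

theorem mem_av {x : M} : x ∈ (av E S M).toSubmodule ↔
    ∀ (a : A) l n, S l n → M.proj n (E.e l • a • x) = 0 := Iff.rfl

theorem av_avoids (S : Λ → ℤ → Prop) (M : GrMod 𝒜) : Avoids E S (M.sub (av E S M)) := by
  intro l n hS x hx
  have := mem_av.1 (subι_mem_sub x) 1 l n hS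
  rw [one_smul, proj_same _ (E.e_smul_deg (mem_sub_deg.1 hx) l)] at this
  exact subι_injective _ (by rw [map_smul, this, map_zero])

theorem av_anti (h : ∀ l n, S l n → S' l n) (M : GrMod 𝒜) :
    (av E S' M).toSubmodule ≤ (av E S M).toSubmodule :=
  fun _ hx a l n hS => hx a l n (h l n hS)

theorem av_eq_top (h : Avoids E S M) : (av E S M).toSubmodule = ⊤ :=
  eq_top_iff.2 fun x _ a _ _ hS => h.proj_eq_zero hS (a • x)

theorem Detects.av_eq_bot (h : Detects E S M) : (av E S M).toSubmodule = ⊥ :=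
  eq_bot_iff.2 fun x hx => (Submodule.mem_bot A).2 (h x hx)

theorem detects_subquot_av (F : M.HSub) : Detects E S (M.subquot F (av E S M)) := by
  intro x hx
  obtain ⟨x, rfl⟩ := subquotπ_surjective _ _ x
  refine subquotπ_eq_zero.2 (mem_av.2 fun a l n hS => ?_)
  have := hx a l n hS
  rw [← map_smul, ← map_smul, map_proj₀ (subquotπ_mem _ _), subquotπ_eq_zero,
    ← map_proj₀ (subι_mem _)] at this
  have h := mem_av.1 this 1 l n hS
  rwa [one_smul, proj_e_smul, proj_same _ (proj_mem _ _ _), ← proj_e_smul,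
    (subι F).map_smul, e_smul_e_smul, (subι F).map_smul] at h

theorem detects_of_avoids {T : Λ → ℤ → Prop} (hS : Detects E S M) (h : Avoids E S' M)
    (hT : ∀ l n, S l n → S' l n ∨ T l n) : Detects E T M := fun x hx =>
  hS x fun a l n hS => (hT l n hS).elim (fun h' => h.proj_eq_zero h' _) (hx a l n)

end PosGraded

namespace GrMod

variable {k A : Type u} [Field k] [Ring A] [Algebra k A] {𝒜 : ℤ → Submodule k A}
variable [GradedAlgebra 𝒜] {L M N Q W X Y Z : GrMod 𝒜} {c d e n : ℤ}

/-- Lifting along an epimorphism, if the extensions by the kernel vanish. -/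
theorem E1.lift {i : L →ₗ[A] M} {p : M →ₗ[A] N} (h : SES i p 0) (hX : E1 X L c)
    {f : X →ₗ[A] N} (hf : f ∈ gHom X N c) : ∃ g ∈ gHom X M c, ∀ x, p (g x) = f x := by
  have hs := shiftEquiv_symm_mem X (-c)
  obtain ⟨V, i', a, b, h', ha, hai, hab, hext, huniv⟩ := exists_pullback h
    (gHom_comp (shiftEquiv_symm_mem X (-c)) hf (neg_add_cancel c))
  have hX' : E1 (X.shift (-c)) L 0 := hX.of_bijective (shiftEquiv_mem X (-c))
    (shiftEquiv X (-c)).bijective (by omega)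
  obtain ⟨r, hr, hri⟩ := hX' _ _ _ _ _ h' LinearMap.id (gHom_congr id_mem_gHom (add_zero 0).symm)
  obtain ⟨g, hg, hgb⟩ := exists_factor h'.hp h'.surj
    (sub_mem ha (gHom_comp (gHom_congr hr (add_zero 0)) h.hi (add_zero 0))) (fun v hv => by
      obtain ⟨y, rfl⟩ := (h'.exact v).1 hv
      simp [hri, hai]) (add_zero 0)
  refine ⟨g ∘ₗ (shiftEquiv X (-c)).toLinearMap,
    gHom_comp (shiftEquiv_mem X (-c)) hg (by omega), fun x => ?_⟩
  obtain ⟨v, hv⟩ := h'.surj (shiftEquiv X (-c) x)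
  rw [LinearMap.comp_apply, LinearEquiv.coe_coe, ← hv, hgb, LinearMap.sub_apply, map_sub, hab, hv,
    LinearMap.comp_apply, LinearMap.comp_apply, h.comp_eq_zero]
  simp

end GrMod

/-! ### Stability of `Perp`, and a degree bound from finite filtrations -/

namespace PosGraded

open GrMod

variable {k A : Type u} [Field k] [Ring A] [Algebra k A] {𝒜 : ℤ → Submodule k A}
variable [GradedAlgebra 𝒜] {Λ : Type*} {E : PosGraded 𝒜 Λ} [Preorder Λ] [Finite Λ]
variable {L M N Q R W X Y : GrMod 𝒜} {c d e m n : ℤ} {S S' : Λ → ℤ → Prop}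

variable (hE : E.IsStandardlyStratified)
include hE

/-- A map `K(l) → N` lifts to `M` because Ext¹(K(l), L) = 0; the lift extends to `P(l)` and is
projected back to `N`. -/
theorem Perp.quot {i : L →ₗ[A] M} {p : M →ₗ[A] N} (h : SES i p 0) (hL : Perp E L)
    (hM : Perp E M) : Perp E N := by
  intro l c
  refine E.E1_Δ_of_extends fun f hf => ?_
  obtain ⟨g, hg, hgf⟩ := E1.lift h (E1_K hE l hL c) hf
  obtain ⟨g', hg', hgg'⟩ := (hM l c).extends (E.ses_Δ l) hg
  exact ⟨p ∘ₗ g', gHom_comp hg' h.hp (add_zero c), fun x => by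
    rw [LinearMap.comp_apply, hgg', hgf]⟩

/-- In the first case the weights generating `K(l)` are all avoided, so there is no nonzero map from
`K(l)`. In the second case a map extends to `P(l) → M`, and the extension stays in the submodule:
vectors of weight in `S` are not seen by Δ(l), so they lie in `K(l)`, where the map is already
controlled. -/
theorem Perp.av (hM : Perp E M)
    (hS : ∀ l : Λ, (∀ m n, level l < level m → S m n) ∨ ∀ m n, S m n → level l < level m) :
    Perp E (M.sub (av E S M)) := by
  intro l c
  refine E.E1_Δ_of_extends fun f hf => ?_
  rcases hS l with h | h
  · refine ⟨0, zero_mem _, fun x => ?_⟩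
    rw [E.K_hom_eq_zero (f := f) fun m hm y =>
      (av_avoids S M).e_smul_eq_zero (fun n => h m n (level_lt hm)) y]
    rfl
  · obtain ⟨g, hg, hgf⟩ := (hM l c).extends (E.ses_Δ l) (gHom_comp hf (subι_mem _) (add_zero c))
    have hmem : ∀ x, g x ∈ (PosGraded.av E S M).toSubmodule := fun x => mem_av.2 fun a m n hm => by
      have hx : E.Δπ l (E.e m • a • x) = 0 := by
        rw [map_smul]
        by_contra hx
        exact (level_mono (Δ_weight hE hx)).not_gt (h m n hm)
      obtain ⟨y, hy⟩ := ((E.ses_Δ l).exact _).1 hx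
      rw [← map_smul, ← map_smul, ← e_smul_e_smul, ← hy, map_smul, hgf, LinearMap.comp_apply,
        ← map_smul, map_proj₀ (subι_mem _), (av_avoids S M).proj_eq_zero hm, map_zero]
    obtain ⟨g', hg', hgg'⟩ := exists_lift (subι_mem (PosGraded.av E S M)) (subι_injective _) hg
      (fun x => exists_subι (hmem x)) (add_zero c)
    exact ⟨g', hg', fun x => subι_injective _ (by rw [hgg', hgf]; rfl)⟩

/-- Modules concentrated in level at most `s` whose weight spaces of level `s` vanish in degrees up
to `n`. -/
theorem exists_level_bound (l : Λ) (s : ℕ) : ∃ B : ℤ, ∀ (Y : GrMod 𝒜) (c n : ℤ),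
    Avoids E (fun m j => s < level m ∨ level m = s ∧ j ≤ n) Y → c + B ≤ n →
    ∀ f ∈ gHom (E.P l) Y c, ∀ m, s ≤ level m → ∀ x, E.e m • f x = 0 := by
  let Φ : GrMod 𝒜 → Prop := fun X => ∃ B : ℤ, ∀ (Y : GrMod 𝒜) (c n : ℤ),
    Avoids E (fun m j => s < level m ∨ level m = s ∧ j ≤ n) Y → c + B ≤ n →
    ∀ f ∈ gHom X Y c, ∀ m, s ≤ level m → ∀ x, E.e m • f x = 0
  have hext : ∀ (L M N : GrMod 𝒜) (i : L →ₗ[A] M) (p : M →ₗ[A] N), SES i p 0 → Φ L → Φ N → Φ M := by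
    rintro L M N i p h ⟨B, hB⟩ ⟨B', hB'⟩
    refine ⟨max B B', fun Y c n hY hc f hf m hm x => ?_⟩
    have hi := gHom_comp h.hi hf (zero_add c)
    obtain ⟨g, hg, hgf⟩ := exists_factor h.hp h.surj
      (gHom_comp hf (quotπ_mem (rangeH _ hi)) (add_zero c)) (fun y hy => by
        obtain ⟨z, rfl⟩ := (h.exact y).1 hy
        exact quotπ_eq_zero.2 ⟨z, rfl⟩) (zero_add c)
    have h1 := hB' _ c n (hY.of_surjective (quotπ_mem _) (quotπ_surjective _)) (by omega) g hg m hm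
      (p x)
    rw [hgf, LinearMap.comp_apply, ← map_smul] at h1
    obtain ⟨z, hz⟩ := quotπ_eq_zero.1 h1
    rw [← e_smul_e_smul, ← hz]
    exact hB Y c n hY (by omega) _ hi m hm z
  have h0 : ∀ X : GrMod 𝒜, (∀ j, X.deg j = ⊥) → Φ X := fun X hX => ⟨0, fun Y c n _ _ f _ m _ x => by
    rw [eq_zero_of_proj (x := x) fun j => by
      have := X.proj_mem j x
      rwa [hX, Submodule.mem_bot] at this, map_zero, smul_zero]⟩
  have hΔ : ∀ (X : GrMod 𝒜) (l : Λ) (j : ℤ), ∀ q ∈ gHom X (E.Δ l) j, Function.Bijective q → Φ X := by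
    intro X l j q hq hb
    obtain ⟨q', hq', h1, h2⟩ := exists_inverse hq hb
    refine ⟨-j, fun Y c n hY hc f hf m hm x => ?_⟩
    have hm' := hq' _ _ (E.dgen_mem l)
    obtain ⟨a, ha⟩ := E.exists_dgen (q x)
    have hx : x = a • q' (E.dgen l) := by rw [← map_smul, ha, h1]
    have he : E.e l • f (q' (E.dgen l)) = f (q' (E.dgen l)) := by
      rw [← map_smul, ← map_smul, e_dgen]
    -- A standard module of level at least `s` has its generator sent to an avoided weight space,
    -- hence to zero, once `c - j ≤ n`; one of lower level has no weights of level at least `s` to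
    -- begin with.
    by_cases hl : s ≤ level l
    · have hz : f (q' (E.dgen l)) = 0 := by
        rw [← he]
        exact hY l _ (hl.lt_or_eq.imp id fun h => ⟨h.symm, by omega⟩) _ (hf _ _ hm')
      rw [hx, map_smul, hz, smul_zero, smul_zero]
    · have : E.e m • q x = 0 := by
        by_contra h
        have := level_mono (Δ_weight hE h)
        omega
      rw [← map_smul, ← h1 x, ← map_smul, this, map_zero, map_zero]
  have hK : Φ ((E.P l).sub (E.K l)) := (hE.filtration l).induction hext h0 hΔ
  exact hext _ _ _ _ _ (E.ses_Δ l) hK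
    (hΔ _ l 0 LinearMap.id id_mem_gHom Function.bijective_id)

end PosGraded

/-! ### Perpendicular modules are filtered by proper costandard modules -/

namespace PosGraded

open GrMod

variable {k A : Type u} [Field k] [Ring A] [Algebra k A] {𝒜 : ℤ → Submodule k A}
variable [GradedAlgebra 𝒜] {Λ : Type*} {E : PosGraded 𝒜 Λ}
variable {L M N Q R W X Y : GrMod 𝒜} {c d e m n : ℤ} {S S' : Λ → ℤ → Prop}

variable (E M) in
/-- The weight space `e_l M_n`. -/
def wt (l : Λ) (n : ℤ) : Submodule k M :=
  M.deg n ⊓ LinearMap.eqLocus (DistribSMul.toLinearMap k M (E.e l)) LinearMap.id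

variable [Preorder Λ] [Finite Λ]

/-- Bases of the weight spaces of degree `n` indexed by a set of weights, with dual functionals. -/
theorem exists_wt_basis (hM : FiniteDimensional k (M.deg n)) (p : Λ → Prop) :
    ∃ (ι : Type u) (_ : Finite ι) (α : ι → Λ) (v : ι → M) (φ : ι → M →ₗ[k] k),
      (∀ i, p (α i)) ∧ (∀ i, v i ∈ M.deg n) ∧
      (∀ i x, φ i (E.e (α i) • x) = φ i x) ∧ (∀ i m, m ≠ n → ∀ x ∈ M.deg m, φ i x = 0) ∧
      (∀ i, φ i (v i) = 1) ∧ (∀ i j, i ≠ j → φ i (v j) = 0) ∧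
      ∀ l, p l → ∀ x ∈ M.deg n, E.e l • x ≠ 0 → ∃ i, φ i (E.e l • x) ≠ 0 := by
  classical
  have hf : ∀ l, FiniteDimensional k (wt E M l n) := fun l =>
    Submodule.finiteDimensional_of_le inf_le_left
  let b : ∀ l : Λ, Module.Basis _ k (wt E M l n) := fun l => Module.finBasis k (wt E M l n)
  let T := Σ l : {l // p l}, Fin (Module.finrank k (wt E M l.1 n))
  have : Small.{u} T := Countable.toSmall T
  choose φ' hφ' using fun t : T => LinearMap.exists_extend ((b t.1.1).coord t.2)
  have hφ : ∀ (t : T) (x : M) (hx : x ∈ wt E M t.1.1 n),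
      E.component M (φ' t) t.1.1 n x = (b t.1.1).coord t.2 ⟨x, hx⟩ := fun t x hx => by
    rw [E.component_same _ hx.1 hx.2, ← hφ' t]; rfl
  let q : T ≃ Shrink.{u} T := equivShrink T
  have hw : ∀ t : T, (b t.1.1 t.2 : M) ∈ wt E M t.1.1 n := fun t => (b t.1.1 t.2).2
  have hφ0 : ∀ t t' : T, t ≠ t' →
      E.component M (φ' t) t.1.1 n (b t'.1.1 t'.2) = 0 := by
    rintro ⟨l, a⟩ ⟨l', a'⟩ h
    by_cases hl : l = l'
    · subst hl
      have ha : a ≠ a' := fun ha => h (by rw [ha])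
      rw [hφ ⟨l, a⟩ _ (hw ⟨l, a'⟩)]
      simp [ha.symm]
    · rw [component_apply, proj_same _ (hw ⟨l', a'⟩).1, E.e_smul_of_ne (fun h => hl (Subtype.ext h))
        (hw ⟨l', a'⟩).2, map_zero]
  refine ⟨Shrink.{u} T, inferInstance, fun i => (q.symm i).1.1,
    fun i => b (q.symm i).1.1 (q.symm i).2, fun i => E.component M (φ' (q.symm i)) (q.symm i).1.1 n,
    fun i => (q.symm i).1.2, fun i => (hw _).1, fun i x => E.component_e _ _ _ _,
    fun i m hm x hx => E.component_of_ne _ _ hx hm, fun i => ?_,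
    fun i j hij => hφ0 _ _ fun h => hij (q.symm.injective h), fun l hl x hx hx0 => ?_⟩
  · rw [hφ _ _ (hw _)]
    simp
  · have hxw : E.e l • x ∈ wt E M l n := ⟨E.e_smul_deg hx l, E.e_smul_e_smul l x⟩
    have : (⟨_, hxw⟩ : wt E M l n) ≠ 0 := fun h => hx0 (congrArg Subtype.val h)
    obtain ⟨a, ha⟩ : ∃ a, (b l).coord a ⟨_, hxw⟩ ≠ 0 := by
      by_contra! h
      exact this ((b l).ext_elem fun a => by simpa using h a)
    refine ⟨q ⟨⟨l, hl⟩, a⟩, ?_⟩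
    simp only [Equiv.symm_apply_apply]
    rw [hφ ⟨⟨l, hl⟩, a⟩ _ hxw]
    exact ha

variable (hE : E.IsStandardlyStratified)
include hE

/-- A module in the right orthogonal of the standard modules, which is concentrated in levels at
most `s` and whose socle has level `s` and degree `n + 1`, is a direct sum of proper costandard
modules. -/
theorem exists_nabla_decomposition {s : ℕ} (hR : Perp E R) (hRd : R.InDown)
    (hav : Avoids E (fun l j => s < level l ∨ level l = s ∧ j ≤ n) R)
    (hdet : Detects E (fun l j => level l = s ∧ j = n + 1) R) :
    ∃ (ι : Type u) (_ : Finite ι) (α : ι → Λ),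
      ∃ ψ ∈ gHom R (shiftSum (fun i => E.properNabla (α i)) fun _ => n + 1) 0,
      Function.Bijective ψ := by
  classical
  obtain ⟨ι, hι, α, v, φ, hα, hv, hφe, hφd, hφ1, hφ0, hφx⟩ :=
    exists_wt_basis (E := E) (hRd.1 (n + 1)) fun l => level l = s
  have := Fintype.ofFinite ι
  have hf := fun i => E.exists_nabla_hom (d := -(n + 1)) (φ i) (hφe i)
    (fun j hj x hx => hφd i j (by omega) x hx) (fun m hm j hj x hx he a => by
      have hms : s ≤ level m := (hα i).symm.le.trans (level_mono hm)
      by_cases hx0 : x = 0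
      · rw [hx0, smul_zero, map_zero]
      have hjn : n < j := by
        by_contra hjn
        refine hx0 (he.symm.trans (hav m j ?_ x hx))
        rcases hms.lt_or_eq with h | h
        · exact Or.inl h
        · exact Or.inr ⟨h.symm, by omega⟩
      induction a using E.smul_induction with
      | h0 => rw [zero_smul, map_zero]
      | hadd a b ha hb => rw [add_smul, map_add, ha, hb, add_zero]
      | hdeg i' hi' a ha => exact hφd i _ (by omega) _ (smul_mem_deg _ ha hx))
  choose f hf hfφ using hf
  let D := shiftSum (fun i => E.properNabla (α i)) fun _ => n + 1
  let I : ∀ i, E.properNabla (α i) →ₗ[A] D := fun i => ssι (fun i => E.properNabla (α i)) (fun _ => n + 1) i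
  let P : ∀ i, D →ₗ[A] E.properNabla (α i) := fun i => ssπ (fun i => E.properNabla (α i)) (fun _ => n + 1) i
  have hI : ∀ i, I i ∈ gHom (E.properNabla (α i)) D (n + 1) := fun i =>
    ssι_mem (S := fun i => E.properNabla (α i)) (δ := fun _ => n + 1) i
  have hP : ∀ i, P i ∈ gHom D (E.properNabla (α i)) (-(n + 1)) := fun i =>
    ssπ_mem (S := fun i => E.properNabla (α i)) (δ := fun _ => n + 1) i
  let ψ : R →ₗ[A] D := ∑ i, I i ∘ₗ f i
  have hψ : ψ ∈ gHom R D 0 :=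
    sum_mem fun i _ => gHom_comp (hf i) (hI i) (neg_add_cancel _)
  have hPψ : ∀ i x, P i (ψ x) = f i x := fun i x => by
    have : ψ x = ∑ j, I j (f j x) := by simp [ψ]
    rw [this, map_sum, Finset.sum_eq_single i (fun j _ hj => ssπ_ssι_ne hj.symm _)
      (fun h => absurd (Finset.mem_univ i) h)]
    exact ssπ_ssι i _
  refine ⟨ι, hι, α, ψ, hψ, ?_⟩
  have hinj : Function.Injective ψ := by
    rw [injective_iff_map_eq_zero]
    intro x hx
    refine hdet x fun a l j hlj => ?_
    obtain ⟨hl, rfl⟩ := hlj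
    by_contra h0
    rw [proj_e_smul] at h0
    obtain ⟨i, hi⟩ := hφx l hl _ (proj_mem _ _ _) h0
    refine hi ?_
    have hφp : ∀ y, φ i (R.proj (n + 1) y) = φ i y := fun y => by
      induction y using homogeneous_induction with
      | h0 => simp
      | hadd x y hx hy => simp [hx, hy]
      | hdeg m y hy =>
        by_cases hm : m = n + 1
        · subst hm; rw [proj_same _ hy]
        · rw [proj_ne _ hy hm, map_zero, hφd i m hm y hy]
    rw [← proj_e_smul, hφp, ← hfφ, (f i).map_smul, (f i).map_smul, ← hPψ, hx, map_zero, smul_zero,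
      smul_zero, map_zero]
  refine ⟨hinj, ?_⟩
  -- If `ψ` is not onto, choose a weight of maximal level in the cokernel. Greater weights being
  -- absent, a vector of that weight receives a map from a standard module.
  let C := D.quot (rangeH ψ hψ)
  by_contra hsurj
  obtain ⟨y₀, hy₀⟩ : ∃ y, y ∉ (rangeH ψ hψ).toSubmodule := by
    by_contra! h
    exact hsurj h
  have hne : {l : Λ | ∃ x : C, E.e l • x ≠ 0}.Nonempty :=
    (E.exists_e_smul_ne_zero (x := quotπ (rangeH ψ hψ) y₀) fun h => hy₀ (quotπ_eq_zero.1 h)).imp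
      fun l hl => ⟨_, hl⟩
  obtain ⟨l, ⟨z, hz⟩, hmax⟩ := Set.exists_max_image _ level (Set.toFinite _) hne
  obtain ⟨j, hj⟩ := exists_proj_ne_zero hz
  rw [proj_e_smul] at hj
  obtain ⟨g, hg, hgz⟩ := E.exists_Δ_hom (E.e_smul_deg (proj_mem _ j z) l) (E.e_smul_e_smul l _)
    fun m hm x => by
      by_contra h
      exact (level_lt hm).not_ge (hmax m ⟨x, h⟩)
  -- Because `R` is in `Perp`, the map `Δ(l) → C` lifts to `D`: lift it to `P(l) → D`, and subtract
  -- an extension to `P(l)` of the resulting map `K(l) → R`.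
  obtain ⟨p, hp, hpg⟩ := E.P_lift (quotπ_mem (rangeH ψ hψ)) (quotπ_surjective _)
    (gHom_comp (E.ses_Δ l).hp hg (zero_add j))
  rw [sub_zero] at hp
  obtain ⟨t, ht, htψ⟩ := exists_lift hψ hinj (gHom_comp (subι_mem (E.K l)) hp (zero_add j))
    (fun x => quotπ_eq_zero (F := rangeH ψ hψ).1 (by
      rw [LinearMap.comp_apply, hpg, LinearMap.comp_apply, (E.ses_Δ l).comp_eq_zero, map_zero]))
    (add_zero j)
  obtain ⟨r, hr, hrt⟩ := (hR l j).extends (E.ses_Δ l) ht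
  obtain ⟨h, hh, hhp⟩ := E.exists_Δ_hom_of_P (sub_mem hp (gHom_comp hr hψ (add_zero j)))
    (fun x => by
      rw [LinearMap.sub_apply, LinearMap.comp_apply, hrt, htψ, LinearMap.comp_apply, sub_self])
  set y := h (E.dgen l) with hy
  have hyp : y = p (E.pgen l) - ψ (r (E.pgen l)) := hhp (E.pgen l)
  have hyz : quotπ (rangeH ψ hψ) y = E.e l • C.proj j z := by
    rw [hyp, map_sub, hpg, quotπ_eq_zero.2 (⟨_, rfl⟩ : ψ _ ∈ (rangeH ψ hψ).toSubmodule), sub_zero,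
      ← hgz]
    rfl
  refine hj ?_
  rw [← hyz, quotπ_eq_zero]
  -- A map from a standard module sends the generator into the socle of each ∇̄, and the socle is
  -- hit by the `v i`. So `y` lies in the image of `ψ`, contradicting its choice.
  refine ⟨∑ i, E.ev _ (P i y) • v i, ss_ext fun i => ?_⟩
  change P i (ψ _) = P i y
  rw [hPψ, ← sub_eq_zero]
  have hPh : P i ∘ₗ h ∈ gHom (E.Δ l) (E.properNabla (α i)) (j + -(n + 1)) :=
    gHom_comp hh (hP i) rfl
  have hPy : P i y ∈ (E.properNabla (α i)).deg 0 := by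
    by_cases h0 : P i y = 0
    · rw [h0]; exact zero_mem _
    · have := (hom_Δ_nabla hE hPh h0).2
      exact gHom_apply hPh (E.dgen_mem l) (by omega)
  refine E.nabla_eq_zero_of_deg_zero (sub_mem (gHom_apply (n := n + 1) (hf i)
    (Submodule.sum_mem _ fun i _ => Submodule.smul_mem _ _ (hv i)) (add_neg_cancel _)) hPy) ?_
  rw [map_sub, hfφ, map_sum, Finset.sum_eq_single i, map_smul, hφ1, smul_eq_mul, mul_one, sub_self]
  · intro i' _ hi'
    rw [map_smul, hφ0 _ _ hi'.symm, smul_zero]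
  · exact fun h => absurd (Finset.mem_univ i) h

/-- The weight spaces of level `s` are removed one degree at a time. Each layer has its socle in
level `s` and a single degree, so it is a finite sum of proper costandard modules. -/
theorem inC_nabla_of_detects {s : ℕ} (hN : Perp E N) (hNd : N.InDown)
    (hav : Avoids E (fun l _ => s < level l) N) (hdet : Detects E (fun l _ => level l = s) N) :
    InC E.properNabla N := by
  obtain ⟨b, hb⟩ := hNd.2
  -- The offset `b - 1` makes the condition vacuous in level `s` for `i = 0`, since `N` vanishes
  -- below `b`. The `i`-th layer then has its socle in degree `b + i`.
  let S : ℕ → Λ → ℤ → Prop := fun i l j => s < level l ∨ level l = s ∧ j ≤ b - 1 + i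
  let F : ℕ → N.HSub := fun i => av E (S i) N
  have hF : ∀ i, Perp E (N.sub (F i)) := fun i => hN.av hE fun l => by
    rcases le_or_gt s (level l) with h | h
    · exact Or.inl fun m n hm => Or.inl (by omega)
    · exact Or.inr fun m n hm => hm.elim (fun h' => by omega) fun h' => by omega
  have hle : ∀ i, (F (i + 1)).toSubmodule ≤ (F i).toSubmodule := fun i =>
    av_anti (fun l n h => h.imp id fun h => ⟨h.1, by push_cast; omega⟩) N
  refine InC.of_chain hNd (F := F) (av_eq_top fun l n h x hx => ?_) (fun i => ?_) fun n => ?_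
  · rcases h with h | h
    · exact hav l n h x hx
    · rw [hb n (by simpa using h.2), Submodule.mem_bot] at hx
      rw [hx, smul_zero]
  · have h := ses_subquot (hle i)
    have havi : Avoids E (S i) (N.subquot (F i) (F (i + 1))) :=
      (av_avoids _ N).of_surjective h.hp h.surj
    obtain ⟨ι, hι, α, ψ, hψ, hb⟩ := exists_nabla_decomposition hE (n := b - 1 + i)
      ((hF (i + 1)).quot hE h (hF i)) ((hNd.of_injective (subι_mem _) (subι_injective (F i))).of_surjective
        h.hp h.surj) havi
      (detects_of_avoids (detects_subquot_av (F i)) havi fun l n h => by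
        rcases h with h | h
        · exact Or.inl (Or.inl h)
        · have h2 := h.2
          push_cast at h2
          by_cases hn : n ≤ b - 1 + i
          · exact Or.inl (Or.inr ⟨h.1, hn⟩)
          · exact Or.inr ⟨h.1, by omega⟩)
    let T : ι → GrMod 𝒜 := fun j => (E.properNabla (α j)).shift (-(b - 1 + i + 1))
    let p : N.sub (F i) →ₗ[A] directSum T := ψ ∘ₗ subquotπ (F i) (F (i + 1))
    have hp : p ∈ gHom (N.sub (F i)) (directSum T) 0 := gHom_comp (subquotπ_mem _ _) hψ (add_zero 0)
    have hsteps := steps_partPreimage (S := E.properNabla) hp (hb.2.comp (subquotπ_surjective _ _))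
      (fun j => ⟨α j, _, _, shiftEquiv_symm_mem _ _, (shiftEquiv _ _).symm.bijective⟩) ∅
      (Set.toFinite Set.univ)
    have h1 : partPreimage hp (Set.univ ∪ ∅) = F i := by
      refine HomogeneousSubmodule.ext 𝒜 N.deg (le_antisymm partPreimage_le fun x hx => ?_)
      obtain ⟨x, rfl⟩ := exists_subι hx
      exact mem_partPreimage.2 fun j hj => absurd (Or.inl trivial) hj
    have h2 : partPreimage hp ∅ = F (i + 1) := by
      refine HomogeneousSubmodule.ext 𝒜 N.deg ?_
      ext x
      constructor
      · intro hx
        obtain ⟨x, rfl⟩ := exists_subι (partPreimage_le hx)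
        have h0 : p x = 0 := ds_ext fun j => by
          rw [map_zero]
          exact mem_partPreimage.1 hx j (Set.notMem_empty j)
        exact subquotπ_eq_zero.1 (hb.1 (h0.trans (map_zero ψ).symm))
      · intro hx
        obtain ⟨x, rfl⟩ := exists_subι (hle i hx)
        refine mem_partPreimage.2 fun j _ => ?_
        have h0 : p x = 0 :=
          (congrArg ψ (subquotπ_eq_zero.2 hx)).trans (map_zero ψ)
        rw [h0, map_zero]
    rwa [h1, h2] at hsteps
  -- For `i` this large, an element of `F i` of degree below `n` generates a submodule without
  -- weights of level `s`, by `exists_level_bound`. Such a submodule is zero by `hdet`.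
  · choose B hB using fun l => exists_level_bound hE l s
    obtain ⟨B₀, hB₀⟩ := (Set.finite_range B).bddAbove
    refine ⟨(n + B₀ - b + 1).toNat, fun j hj => ?_⟩
    rw [eq_bot_iff]
    intro x hx
    rw [Submodule.mem_bot]
    refine E.eq_zero_of_e fun l => subι_injective _ ?_
    rw [map_zero]
    refine hdet _ fun a m j' hm => ?_
    obtain ⟨f, hf, hfx⟩ := E.exists_P_hom (E.e_smul_deg hx l) (E.e_smul_e_smul l x)
    have hBl : B l ≤ B₀ := hB₀ ⟨l, rfl⟩
    have := hB l _ j (b - 1 + (n + B₀ - b + 1).toNat) (av_avoids _ N) (by omega) f hf m hm.ge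
      (a • E.pgen l)
    rw [map_smul, hfx] at this
    rw [← map_smul, ← map_smul, this, map_zero, map_zero]

/-- Coarse filtration by level, with the forbidden levels growing downward from the top; each layer
has its levels bounded by, and its submodules detected in, a single level. -/
theorem inF_of_perp (hN : Perp E N) (hNd : N.InDown) : InF E.properNabla N := by
  let S : ℕ → Λ → ℤ → Prop := fun s l _ => s ≤ level l
  let F : ℕ → N.HSub := fun i => av E (S (Nat.card Λ - i)) N
  have hF : ∀ i, Perp E (N.sub (F i)) := fun i => hN.av hE fun l => by
    rcases le_or_gt (Nat.card Λ - i) (level l) with h | h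
    · exact Or.inl fun m n hm => h.trans hm.le
    · exact Or.inr fun m n hm => h.trans_le hm
  refine ⟨hNd, Nat.card Λ, F, av_eq_top fun l n h => absurd (level_lt_card l) (not_lt.2 h),
    Detects.av_eq_bot fun x hx => E.eq_zero_of_e fun l => eq_zero_of_proj fun n => ?_,
    fun i hi => ?_⟩
  · have := hx 1 l n (by simp [S])
    rwa [one_smul] at this
  · have hle : (F (i + 1)).toSubmodule ≤ (F i).toSubmodule :=
      av_anti (fun l n (h : _ ≤ _) => by change _ ≤ _; omega) N
    have h := ses_subquot hle
    have hav : Avoids E (fun l _ => Nat.card Λ - (i + 1) < level l) (N.subquot (F i) (F (i + 1))) :=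
      Avoids.of_surjective h.hp h.surj fun l n hl => av_avoids (S (Nat.card Λ - i)) N l n
        (show Nat.card Λ - i ≤ level l by omega)
    refine ⟨hle, inC_nabla_of_detects hE ((hF (i + 1)).quot hE h (hF i))
      ((hNd.of_injective (subι_mem _) (subι_injective (F i))).of_surjective h.hp h.surj) hav
      (detects_of_avoids (detects_subquot_av (F i)) hav fun l n (hl : _ ≤ _) => ?_)⟩
    exact hl.lt_or_eq.imp id fun h => h.symm

end PosGraded

/-! ### Fitting's lemma and indecomposable summands -/

namespace GrMod

variable {k A : Type u} [Field k] [Ring A] [Algebra k A] {𝒜 : ℤ → Submodule k A}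
variable [GradedAlgebra 𝒜] {L M N Q W X Y Z : GrMod 𝒜} {c d e n : ℤ}

theorem Hom.mem_gHom (f : Hom M N) : f.toLinearMap ∈ gHom M N 0 := fun n x hx => by
  rw [add_zero]; exact f.map_deg n x hx

/-- A homogeneous linear map of degree zero as a morphism. -/
def homOf (f : M →ₗ[A] N) (hf : f ∈ gHom M N 0) : Hom M N := ⟨f, fun _ _ hx => gHom_apply₀ hf hx⟩

theorem directSum_inDown {ι : Type u} {S : ι → GrMod 𝒜} (hS : ∀ i, (S i).InDown)
    (hb : ∃ b : ℤ, ∀ i, ∀ j < b, (S i).deg j = ⊥) (hf : ∀ n, {i | (S i).deg n ≠ ⊥}.Finite) :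
    (directSum S).InDown := by
  refine ⟨fun n => ?_, hb.imp fun b hb j hj => ?_⟩
  · have := (hf n).to_subtype
    have := fun i => (hS i).1 n
    let φ : (directSum S).deg n →ₗ[k] ∀ i : {i | (S i).deg n ≠ ⊥}, (S i).deg n :=
      LinearMap.pi fun i => ((dsπ S i).restrictScalars k).restrict fun x hx =>
        gHom_apply₀ (dsπ_mem i.1) hx
    refine FiniteDimensional.of_injective φ fun x y h => Subtype.ext (ds_ext fun i => ?_)
    by_cases hi : (S i).deg n = ⊥
    · have hx := gHom_apply₀ (dsπ_mem (S := S) i) x.2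
      have hy := gHom_apply₀ (dsπ_mem (S := S) i) y.2
      rw [hi, Submodule.mem_bot] at hx hy
      rw [hx, hy]
    · exact congrArg Subtype.val (congrFun h ⟨i, hi⟩)
  · rw [eq_bot_iff]
    intro x hx
    refine (Submodule.mem_bot k).2 (ds_ext fun i => ?_)
    have hx := gHom_apply₀ (dsπ_mem (S := S) i) hx
    rw [hb i j hj, Submodule.mem_bot] at hx
    rw [hx, map_zero]

theorem directSum_inDown_of_finite {ι : Type u} [Finite ι] {S : ι → GrMod 𝒜}
    (hS : ∀ i, (S i).InDown) : (directSum S).InDown := by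
  choose b hb using fun i => (hS i).2
  obtain ⟨B, hB⟩ := (Set.finite_range b).bddBelow
  exact directSum_inDown hS ⟨B, fun i j hj => hb i j (hj.trans_le (hB ⟨i, rfl⟩))⟩
    fun n => Set.toFinite _

theorem inDown_shift (h : M.InDown) (j : ℤ) : (M.shift j).InDown :=
  h.of_injective (shiftEquiv_symm_mem M j) (shiftEquiv M j).symm.injective

/-- Maps from a finitely generated module to a direct sum. -/
theorem exists_finite_support {ι : Type u} {S : ι → GrMod 𝒜} (h : Module.Finite A M)
    (f : M →ₗ[A] directSum S) : ∃ J : Finset ι, ∀ i ∉ J, dsπ S i ∘ₗ f = 0 := by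
  classical
  obtain ⟨s, hs⟩ := h.fg_top
  refine ⟨s.biUnion fun x => (ds_finite (f x)).toFinset, fun i hi => ?_⟩
  refine LinearMap.ext_on hs fun x hx => ?_
  by_contra h0
  exact hi (Finset.mem_biUnion.2 ⟨x, hx, by simpa using h0⟩)

theorem shift_indecomposable (h : M.Indecomposable) (j : ℤ) : (M.shift j).Indecomposable := by
  refine ⟨h.1, fun N N' hc => ?_⟩
  have key : ∀ N : (M.shift j).HSub, ∃ F : M.HSub, F.toSubmodule = N.toSubmodule := fun N =>
    ⟨comapH _ (shiftEquiv_mem M j) N, rfl⟩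
  obtain ⟨F, hF⟩ := key N
  obtain ⟨F', hF'⟩ := key N'
  exact (h.2 F F' (by rw [hF, hF']; exact hc)).imp hF.symm.trans hF'.symm.trans

/-- Fitting's lemma. -/
theorem Indecomposable.bijective (h : M.Indecomposable) (hd : M.InDown) {φ : M →ₗ[A] M}
    (hφ : φ ∈ gHom M M 0) {v : M} (hv : v ≠ 0) (hφv : φ v = v) : Function.Bijective φ := by
  have hpow : ∀ n : ℕ, φ ^ n ∈ gHom M M 0 := fun n => by
    induction n with
    | zero => exact id_mem_gHom
    | succ n ih => rw [pow_succ]; exact gHom_comp hφ ih (add_zero 0)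
  -- The union of the kernels and the intersection of the images of the powers of `φ` are
  -- complementary, since they are so in each finite dimensional component.
  let F : M.HSub := HSub.mk' M (⨆ n : ℕ, LinearMap.ker (φ ^ n)) (by
    intro x hx n
    induction hx using Submodule.iSup_induction' with
    | mem i x hx =>
      refine Submodule.mem_iSup_of_mem i ?_
      rw [LinearMap.mem_ker] at hx ⊢
      rw [← map_proj₀ (hpow i), hx, map_zero]
    | zero => rw [map_zero]; exact zero_mem _
    | add x y _ _ hx hy => rw [map_add]; exact add_mem hx hy)
  let F' : M.HSub := HSub.mk' M (⨅ n : ℕ, LinearMap.range (φ ^ n)) (by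
    intro x hx n
    rw [Submodule.mem_iInf] at hx ⊢
    intro i
    obtain ⟨y, rfl⟩ := hx i
    exact ⟨M.proj n y, (map_proj₀ (hpow i) n y).symm⟩)
  have hFm : ∀ {x}, x ∈ F.toSubmodule ↔ ∃ i : ℕ, (φ ^ i) x = 0 := fun {x} =>
    (Submodule.mem_iSup_of_directed _ (LinearMap.iterateKer φ).monotone.directed_le).trans Iff.rfl
  have hFm' : ∀ {x}, x ∈ F'.toSubmodule ↔ ∀ i : ℕ, ∃ y, (φ ^ i) y = x := fun {x} =>
    (Submodule.mem_iInf _).trans Iff.rfl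
  let ψ : ∀ n, M.deg n →ₗ[k] M.deg n := fun n =>
    (φ.restrictScalars k).restrict fun x hx => gHom_apply₀ hφ hx
  have hψ : ∀ n (i : ℕ) (x : M.deg n), ((ψ n ^ i) x : M) = (φ ^ i) x := fun n i x => by
    induction i with
    | zero => rfl
    | succ i ih =>
      rw [pow_succ', pow_succ', Module.End.mul_apply, Module.End.mul_apply, ← ih]
      rfl
  have hψm : ∀ {n} {x : M.deg n}, x ∈ (⨆ i : ℕ, LinearMap.ker (ψ n ^ i)) ↔ (x : M) ∈ F.toSubmodule :=
    fun {n x} => by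
      refine (Submodule.mem_iSup_of_directed _
        (LinearMap.iterateKer (ψ n)).monotone.directed_le).trans ?_
      rw [hFm]
      refine exists_congr fun i => ?_
      rw [← hψ, ZeroMemClass.coe_eq_zero]
      rfl
  have hψm' : ∀ {n} {x : M.deg n}, x ∈ (⨅ i : ℕ, LinearMap.range (ψ n ^ i)) ↔
      (x : M) ∈ F'.toSubmodule := fun {n x} => by
    rw [hFm', Submodule.mem_iInf]
    refine forall_congr' fun i => ⟨fun ⟨y, hy⟩ => ⟨y, by rw [← hψ, hy]⟩, fun ⟨y, hy⟩ =>
      ⟨⟨M.proj n y, M.proj_mem n y⟩, Subtype.ext ?_⟩⟩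
    rw [hψ, ← map_proj₀ (hpow i), hy, proj_same _ x.2]
  have hfit : ∀ n, IsCompl (⨆ i : ℕ, LinearMap.ker (ψ n ^ i)) (⨅ i : ℕ, LinearMap.range (ψ n ^ i)) :=
    fun n => by
      have := hd.1 n
      exact LinearMap.isCompl_iSup_ker_pow_iInf_range_pow (ψ n)
  have hc : IsCompl F.toSubmodule F'.toSubmodule := by
    refine ⟨Submodule.disjoint_def.2 fun x hx hx' => eq_zero_of_proj fun n => ?_,
      codisjoint_iff_le_sup.2 fun x _ => ?_⟩
    · exact congrArg Subtype.val (Submodule.disjoint_def.1 (hfit n).1 ⟨M.proj n x, M.proj_mem n x⟩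
        (hψm.2 (F.proj_mem n hx)) (hψm'.2 (F'.proj_mem n hx')))
    · induction x using homogeneous_induction with
      | h0 => exact zero_mem _
      | hadd x y hx hy => exact add_mem (hx trivial) (hy trivial)
      | hdeg n x hx =>
        obtain ⟨a, ha, b, hb, hab⟩ := Submodule.mem_sup.1
          ((hfit n).2.top_le (Submodule.mem_top (x := (⟨x, hx⟩ : M.deg n))))
        exact Submodule.mem_sup.2 ⟨a, hψm.1 ha, b, hψm'.1 hb, congrArg Subtype.val hab⟩
  -- The fixed vector lies in the image of every power, so `F'` is nonzero and indecomposability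
  -- forces `F = 0`.
  have hvF' : v ∈ F'.toSubmodule := (Submodule.mem_iInf _).2 fun n => ⟨v, by
    induction n with
    | zero => rfl
    | succ n ih => rw [pow_succ, Module.End.mul_apply, hφv, ih]⟩
  have hbot : F.toSubmodule = ⊥ := (h.2 F F' hc).resolve_right fun h' => hv (by
    rw [h', Submodule.mem_bot] at hvF'
    exact hvF')
  have htop : F'.toSubmodule = ⊤ := by
    have := hc.sup_eq_top
    rwa [hbot, bot_sup_eq] at this
  refine ⟨(injective_iff_map_eq_zero φ).2 fun x hx => ?_, fun x => ?_⟩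
  · have : x ∈ F.toSubmodule := Submodule.mem_iSup_of_mem 1 (by simpa using hx)
    rwa [hbot, Submodule.mem_bot] at this
  · have : x ∈ F'.toSubmodule := htop ▸ trivial
    obtain ⟨y, hy⟩ := (Submodule.mem_iInf _).1 this 1
    exact ⟨y, by simpa using hy⟩

/-- An indecomposable summand containing a given element, if the summands of the whole module
cannot split this element. -/
theorem exists_indecomposable_summand (hd : M.InDown) {v : M} (hv : v ≠ 0)
    (hsplit : ∀ N N' N'' : M.HSub, Disjoint N.toSubmodule N'.toSubmodule →
      N.toSubmodule ⊔ N'.toSubmodule = N''.toSubmodule → v ∈ N''.toSubmodule →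
      v ∈ N.toSubmodule ∨ v ∈ N'.toSubmodule) :
    ∃ N N' : M.HSub, IsCompl N.toSubmodule N'.toSubmodule ∧ v ∈ N.toSubmodule ∧
      (M.sub N).Indecomposable := by
  -- Zorn's lemma for decompositions with `v` in the first summand, ordered by shrinking the first
  -- and enlarging the second.
  let T := {t : M.HSub × M.HSub // IsCompl t.1.toSubmodule t.2.toSubmodule ∧ v ∈ t.1.toSubmodule}
  let r : T → T → Prop := fun s t => t.1.1.toSubmodule ≤ s.1.1.toSubmodule ∧
    s.1.2.toSubmodule ≤ t.1.2.toSubmodule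
  have hub : ∀ C, IsChain r C → ∃ ub, ∀ a ∈ C, r a ub := by
    intro C hC
    rcases C.eq_empty_or_nonempty with rfl | hne
    · exact ⟨⟨(topH M, HSub.mk' M ⊥ fun x hx n => by
        rw [(Submodule.mem_bot A).1 hx, map_zero]; exact zero_mem _), isCompl_top_bot, trivial⟩,
        fun a ha => absurd ha (Set.notMem_empty a)⟩
    have htot : ∀ s t : C, r s t ∨ r t s := fun s t => by
      by_cases h : (s : T) = t
      · rw [h]; exact Or.inl ⟨le_rfl, le_rfl⟩
      · exact hC s.2 t.2 h
    have := hne.to_subtype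
    let N₁ : M.HSub := HSub.inter fun t : C => t.1.1.1
    let N₂ : M.HSub := HSub.sum fun t : C => t.1.1.2
    have hN₁ : ∀ {x}, x ∈ N₁.toSubmodule ↔ ∀ t : C, x ∈ t.1.1.1.toSubmodule :=
      fun {x} => Submodule.mem_iInf _
    have hN₂ : ∀ {x}, x ∈ N₂.toSubmodule ↔ ∃ t : C, x ∈ t.1.1.2.toSubmodule := fun {x} =>
      Submodule.mem_iSup_of_directed _ fun s t =>
        (htot s t).elim (fun h => ⟨t, h.2, le_rfl⟩) fun h => ⟨s, le_rfl, h.2⟩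
    refine ⟨⟨(N₁, N₂), ⟨Submodule.disjoint_def.2 fun x hx hx' => ?_,
      codisjoint_iff_le_sup.2 fun x _ => ?_⟩, hN₁.2 fun t => t.1.2.2⟩, fun t ht =>
        ⟨fun x hx => hN₁.1 hx ⟨t, ht⟩, fun x hx => hN₂.2 ⟨⟨t, ht⟩, hx⟩⟩⟩
    · obtain ⟨t, ht⟩ := hN₂.1 hx'
      exact Submodule.disjoint_def.1 t.1.2.1.disjoint x (hN₁.1 hx t) ht
    · induction x using homogeneous_induction with
      | h0 => exact zero_mem _
      | hadd x y hx hy => exact add_mem (hx trivial) (hy trivial)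
      | hdeg n x hx =>
        have := hd.1 n
        let U : C → Submodule k M := fun t =>
          t.1.1.1.toSubmodule.restrictScalars k ⊓ M.deg n
        have hU : ∀ t, FiniteDimensional k (U t) := fun t =>
          Submodule.finiteDimensional_of_le inf_le_right
        -- In a fixed degree the first summands of a chain are finite dimensional, so their
        -- intersection is attained at some `t`; the decomposition at `t` then works for the limit
        -- in that degree.
        obtain ⟨t, ht⟩ := Nat.sInf_mem (Set.range_nonempty fun t => Module.finrank k (U t))
        have hmin : ∀ s, U t ≤ U s := fun s => by
          rcases htot t s with h | h
          · have hle : U s ≤ U t := inf_le_inf_right _ h.1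
            refine (Submodule.eq_of_le_of_finrank_le hle ?_).ge
            exact ht.le.trans (Nat.sInf_le ⟨s, rfl⟩)
          · exact inf_le_inf_right _ h.1
        obtain ⟨a, ha, b, hb, hab⟩ := Submodule.mem_sup.1
          (t.1.2.1.sup_eq_top.ge (Submodule.mem_top (x := x)))
        refine Submodule.mem_sup.2 ⟨M.proj n a, hN₁.2 fun s => (hmin s ⟨t.1.1.1.proj_mem n ha,
          M.proj_mem n a⟩).1, M.proj n b, hN₂.2 ⟨t, t.1.1.2.proj_mem n hb⟩, ?_⟩
        rw [← map_add, hab, proj_same _ hx]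
  obtain ⟨⟨⟨N, N'⟩, hc, hvN⟩, hmax⟩ := exists_maximal_of_chains_bounded hub
    fun {a b c} h h' => ⟨h'.1.trans h.1, h.2.trans h'.2⟩
  -- If `N = U ⊕ W` with `v` in `U`, then `(U, W ⊕ N')` is a decomposition above `(N, N')`, so
  -- maximality gives `W = 0`.
  have key : ∀ U W : (M.sub N).HSub, IsCompl U.toSubmodule W.toSubmodule →
      v ∈ U.toSubmodule.map (subι N) → W.toSubmodule = ⊥ := by
    intro U W hUW hvU
    let U' := mapH (subι N) (subι_mem N) U
    let W' := mapH (subι N) (subι_mem N) W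
    let V : M.HSub := HSub.mk' M (W'.toSubmodule ⊔ N'.toSubmodule) (by
      intro x hx n
      obtain ⟨a, ha, b, hb, rfl⟩ := Submodule.mem_sup.1 hx
      rw [map_add]
      exact Submodule.add_mem_sup (W'.proj_mem n ha) (N'.proj_mem n hb))
    have hsup : U'.toSubmodule ⊔ W'.toSubmodule = N.toSubmodule := by
      change U.toSubmodule.map (subι N) ⊔ W.toSubmodule.map (subι N) = N.toSubmodule
      rw [← Submodule.map_sup, hUW.sup_eq_top, Submodule.map_top]
      exact Submodule.range_subtype _
    have hdis : Disjoint U'.toSubmodule W'.toSubmodule :=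
      Submodule.disjoint_map (subι_injective N) hUW.disjoint
    have hV : IsCompl U'.toSubmodule V.toSubmodule := by
      refine ⟨hdis.disjoint_sup_right_of_disjoint_sup_left (by rw [hsup]; exact hc.disjoint),
        codisjoint_iff.2 ?_⟩
      change U'.toSubmodule ⊔ (W'.toSubmodule ⊔ N'.toSubmodule) = ⊤
      rw [← sup_assoc, hsup, hc.sup_eq_top]
    have hle : N.toSubmodule ≤ U'.toSubmodule := (hmax ⟨(U', V), hV, hvU⟩
      ⟨hsup ▸ le_sup_left, le_sup_right⟩).1
    have hW' : W'.toSubmodule = ⊥ := hdis.eq_bot_of_ge ((hsup ▸ le_sup_right).trans hle)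
    refine eq_bot_iff.2 fun w hw => (Submodule.mem_bot A).2 (subι_injective N ?_)
    have : subι N w ∈ W'.toSubmodule := ⟨w, hw, rfl⟩
    rwa [hW', Submodule.mem_bot, ← map_zero (subι N)] at this
  refine ⟨N, N', hc, hvN, ⟨(⟨v, hvN⟩ : N.toSubmodule), (0 : N.toSubmodule),
    fun h => hv (congrArg Subtype.val h)⟩, ?_⟩
  intro U W hUW
  refine (hsplit (mapH (subι N) (subι_mem N) U) (mapH (subι N) (subι_mem N) W) N
    (Submodule.disjoint_map (subι_injective N) hUW.disjoint) ?_ hvN).symm.imp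
    (key W U hUW.symm) (key U W hUW)
  change U.toSubmodule.map (subι N) ⊔ W.toSubmodule.map (subι N) = N.toSubmodule
  rw [← Submodule.map_sup, hUW.sup_eq_top, Submodule.map_top]
  exact Submodule.range_subtype _

end GrMod

/-! ### Tilting modules: closure, uniqueness, existence -/

namespace PosGraded

open GrMod

variable {k A : Type u} [Field k] [Ring A] [Algebra k A] {𝒜 : ℤ → Submodule k A}
variable [GradedAlgebra 𝒜] {Λ : Type*} {E : PosGraded 𝒜 Λ} [Preorder Λ] [Finite Λ]
variable {L M N Q R T W X Y : GrMod 𝒜} {c d e m n : ℤ} {l : Λ}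

theorem perp_summand {i : N →ₗ[A] M} {p : M →ₗ[A] N} (hi : i ∈ gHom N M 0)
    (hp : p ∈ gHom M N 0) (hpi : ∀ x, p (i x) = x) (hM : Perp E M) : Perp E N := by
  intro l c
  refine E.E1_Δ_of_extends fun f hf => ?_
  obtain ⟨g, hg, hgf⟩ := (hM l c).extends (E.ses_Δ l) (gHom_comp hf hi (add_zero c))
  exact ⟨p ∘ₗ g, gHom_comp hg hp (add_zero c), fun x => by
    rw [LinearMap.comp_apply, hgf, LinearMap.comp_apply, hpi]⟩

theorem Perp.shift (hM : Perp E M) (j : ℤ) : Perp E (M.shift j) :=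
  hM.of_bijective' (shiftEquiv_symm_mem M j) (shiftEquiv M j).symm.bijective

theorem Good.shift (hM : Good E M) (j : ℤ) : Good E (M.shift j) :=
  hM.of_bijective (shiftEquiv_mem M j) (shiftEquiv M j).bijective

variable (hE : E.IsStandardlyStratified)
include hE

/-- `K(l)` is finitely generated, so a map from it to the sum meets only finitely many summands and
can be extended summand by summand. -/
theorem perp_directSum {ι : Type u} {S : ι → GrMod 𝒜} (hS : ∀ i, Perp E (S i)) :
    Perp E (directSum S) := by
  classical
  intro l c
  refine E.E1_Δ_of_extends fun f hf => ?_
  obtain ⟨J, hJ⟩ := exists_finite_support (finite_K hE l) f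
  choose g hg hgf using fun i => (hS i l c).extends (E.ses_Δ l)
    (gHom_comp hf (dsπ_mem i) (add_zero c))
  refine ⟨∑ i ∈ J, dsι S i ∘ₗ g i, sum_mem fun i _ => gHom_comp (hg i) (dsι_mem i) (add_zero c),
    fun x => ds_ext fun i => ?_⟩
  rw [LinearMap.sum_apply, map_sum]
  by_cases hi : i ∈ J
  · rw [Finset.sum_eq_single_of_mem i hi fun j _ hj => dsπ_dsι_ne hj.symm _]
    simp [hgf]
  · rw [Finset.sum_eq_zero fun j hj => dsπ_dsι_ne (ne_of_mem_of_not_mem hj hi).symm _]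
    exact (LinearMap.congr_fun (hJ i hi) x).symm

theorem isTilting_iff : E.IsTilting M ↔ M.InDown ∧ Good E M ∧ Perp E M :=
  ⟨fun h => ⟨h.1.1, good_of_inF hE h.1, perp_of_inF hE h.2⟩,
    fun h => ⟨inF_of_good hE h.2.1 h.1, inF_of_perp hE h.2.2 h.1⟩⟩

theorem isTilting_directSum {ι : Type u} {S : ι → GrMod 𝒜} (hS : ∀ i, E.IsTilting (S i))
    (hd : (directSum S).InDown) : E.IsTilting (directSum S) :=
  (isTilting_iff hE).2 ⟨hd, fun l c => E1.directSum fun i => ((isTilting_iff hE).1 (hS i)).2.1 l c,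
    perp_directSum hE fun i => ((isTilting_iff hE).1 (hS i)).2.2⟩

theorem isTilting_summand {i : N →ₗ[A] M} {p : M →ₗ[A] N} (hi : i ∈ gHom N M 0)
    (hp : p ∈ gHom M N 0) (hpi : ∀ x, p (i x) = x) (hM : E.IsTilting M) : E.IsTilting N := by
  obtain ⟨hd, hg, hperp⟩ := (isTilting_iff hE).1 hM
  exact (isTilting_iff hE).2 ⟨hd.of_injective hi (Function.LeftInverse.injective hpi),
    fun l c => (hg l c).summand hi hp hpi, perp_summand hi hp hpi hperp⟩

theorem isTilting_shift (hM : E.IsTilting M) (j : ℤ) : E.IsTilting (M.shift j) := by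
  obtain ⟨hd, hg, hp⟩ := (isTilting_iff hE).1 hM
  exact (isTilting_iff hE).2 ⟨inDown_shift hd j, hg.shift j, hp.shift j⟩

/-- Inside A^↓-gmod membership in ℱ^↓(Δ) is the same as being good, and the cokernel only matters up
to isomorphism. -/
theorem hasStandardSub_iff (hM : M.InDown) : E.HasStandardSub l M ↔
    ∃ (N : GrMod 𝒜) (f : E.Δ l →ₗ[A] M) (p : M →ₗ[A] N), SES f p 0 ∧ Good E N := by
  constructor
  · rintro ⟨f, hf, hc⟩
    exact ⟨_, f.toLinearMap, _, ses_quot_range f.mem_gHom hf, good_of_inF hE hc⟩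
  · rintro ⟨N, f, p, h, hN⟩
    refine ⟨homOf f h.hi, h.inj, inF_of_good hE ?_ (hM.of_surjective (quotπ_mem _)
      (quotπ_surjective _))⟩
    have hs := ses_quot_range h.hi h.inj
    obtain ⟨q, hq, hqp⟩ := exists_factor hs.hp hs.surj h.hp (fun y hy => by
      obtain ⟨x, rfl⟩ := (hs.exact y).1 hy
      exact h.comp_eq_zero x) (add_zero 0)
    refine hN.of_bijective' hq ⟨(injective_iff_map_eq_zero q).2 fun y hy => ?_, fun z => ?_⟩
    · obtain ⟨y, rfl⟩ := hs.surj y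
      rw [hqp, h.exact] at hy
      exact (hs.exact y).2 hy
    · obtain ⟨y, rfl⟩ := h.surj z
      exact ⟨_, hqp y⟩

/-- The cokernel of Δ(l) in one module is good and the other module is in `Perp`, so each inclusion
of Δ(l) extends along the other. Both composites fix the image of the generator, hence are bijective
by Fitting's lemma. -/
theorem isIsomorphic_of_hasStandardSub (hM : E.IsTilting M) (hMi : M.Indecomposable)
    (hMs : E.HasStandardSub l M) (hN : E.IsTilting N) (hNi : N.Indecomposable)
    (hNs : E.HasStandardSub l N) : M.IsIsomorphic N := by
  have key : ∀ {M N : GrMod 𝒜}, E.IsTilting M → E.IsTilting N →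
      ∀ {Q : GrMod 𝒜} {f : E.Δ l →ₗ[A] M} {p : M →ₗ[A] Q}, SES f p 0 → Good E Q →
      ∀ g ∈ gHom (E.Δ l) N 0, ∃ φ ∈ gHom M N 0, ∀ x, φ (f x) = g x := by
    intro M N hM hN Q f p h hQ g hg
    obtain ⟨hMd, -, -⟩ := (isTilting_iff hE).1 hM
    obtain ⟨-, -, hNp⟩ := (isTilting_iff hE).1 hN
    exact (E1_of_good_of_perp hE hQ (hMd.of_surjective h.hp h.surj) hNp 0).extends h hg
  obtain ⟨Q, f, p, h, hQ⟩ := (hasStandardSub_iff hE hM.1.1).1 hMs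
  obtain ⟨Q', f', p', h', hQ'⟩ := (hasStandardSub_iff hE hN.1.1).1 hNs
  obtain ⟨φ, hφ, hφf⟩ := key hM hN h hQ f' h'.hi
  obtain ⟨ψ, hψ, hψf⟩ := key hN hM h' hQ' f h.hi
  have h1 := hMi.bijective hM.1.1 (gHom_comp hφ hψ (add_zero 0)) (v := f (E.dgen l))
    (fun h0 => dgen_ne_zero hE l (h.inj (h0.trans (map_zero f).symm))) (by
      rw [LinearMap.comp_apply, hφf, hψf])
  have h2 := hNi.bijective hN.1.1 (gHom_comp hψ hφ (add_zero 0)) (v := f' (E.dgen l))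
    (fun h0 => dgen_ne_zero hE l (h'.inj (h0.trans (map_zero f').symm))) (by
      rw [LinearMap.comp_apply, hψf, hφf])
  exact isIsomorphic_of_bijective hφ
    ⟨Function.Injective.of_comp h1.1, Function.Surjective.of_comp h2.2⟩

/-- Every nonzero good module contains a standard module with good quotient. -/
theorem exists_std_submodule (hM : Good E M) (hMd : M.InDown) [Nontrivial M] :
    ∃ (l : Λ) (j : ℤ) (N : GrMod 𝒜) (f : E.Δ l →ₗ[A] M) (p : M →ₗ[A] N),
      f ∈ gHom (E.Δ l) M j ∧ p ∈ gHom M N 0 ∧ Function.Injective f ∧ Function.Surjective p ∧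
      (∀ y, p y = 0 ↔ ∃ x, f x = y) ∧ Good E N := by
  classical
  -- Take the last nonzero term of the trace filtration: it equals its own layer, hence is a sum of
  -- standard modules, and any one summand will do.
  have hex : ∃ r, (tr E M r).toSubmodule = ⊥ := ⟨_, tr_card_eq_bot⟩
  obtain ⟨r, hr, hbot⟩ : ∃ r, (tr E M r).toSubmodule ≠ ⊥ ∧ (tr E M (r + 1)).toSubmodule = ⊥ := by
    have h0 : Nat.find hex ≠ 0 := fun h => by
      have := Nat.find_spec hex
      rw [h, tr_zero] at this
      exact top_ne_bot this
    obtain ⟨r, hr⟩ := Nat.exists_eq_succ_of_ne_zero h0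
    have := Nat.find_spec hex
    rw [hr] at this
    exact ⟨r, Nat.find_min hex (by omega), this⟩
  obtain ⟨ι, α, δ, φ, hφ, hb, -⟩ := exists_layer hE hM hMd r
  have hsb : Function.Bijective (subquotπ (tr E M r) (tr E M (r + 1))) :=
    ⟨(injective_iff_map_eq_zero _).2 fun x hx => by
      rw [subquotπ_eq_zero, hbot, Submodule.mem_bot] at hx
      exact subι_injective _ (hx.trans (map_zero _).symm), subquotπ_surjective _ _⟩
  obtain ⟨ρ, hρ, hρ1, hρ2⟩ := exists_inverse (subquotπ_mem _ _) hsb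
  obtain ⟨φ', hφ', hφ1, hφ2⟩ := exists_inverse hφ hb
  let θ := ρ ∘ₗ φ
  have hθ : θ ∈ gHom (stdSum E α δ) (M.sub (tr E M r)) 0 := gHom_comp hφ hρ (by omega)
  let θ' := φ' ∘ₗ subquotπ (tr E M r) (tr E M (r + 1))
  have hθ' : θ' ∈ gHom (M.sub (tr E M r)) (stdSum E α δ) 0 :=
    gHom_comp (subquotπ_mem _ _) hφ' (by omega)
  have hθ1 : ∀ x, θ' (θ x) = x := fun x => by simp [θ, θ', hρ2, hφ1]
  have hθ2 : ∀ x, θ (θ' x) = x := fun x => by simp [θ, θ', hρ1, hφ2]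
  obtain ⟨i⟩ : Nonempty ι := by
    by_contra hemp
    rw [not_nonempty_iff] at hemp
    refine hr (eq_bot_iff.2 fun x hx => ?_)
    obtain ⟨x, rfl⟩ := exists_subι hx
    have : θ' x = 0 := ss_ext fun i => hemp.elim i
    rw [← hθ2 x, this, map_zero, map_zero]
    exact zero_mem _
  let f : E.Δ (α i) →ₗ[A] M := subι (tr E M r) ∘ₗ θ ∘ₗ stdι E α δ i
  have hf : f ∈ gHom (E.Δ (α i)) M (δ i) :=
    gHom_comp (gHom_comp (ssι_mem i) hθ (add_zero _)) (subι_mem _) (add_zero _)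
  have hfinj : Function.Injective f := fun x y h => by
    have h1 := congrArg θ' (subι_injective _ h)
    have h2 := congrArg (stdπ E α δ i) h1
    simpa only [LinearMap.comp_apply, hθ1, ssπ_ssι] using h2
  refine ⟨α i, δ i, _, f, quotπ (rangeH f hf), hf, quotπ_mem _, hfinj, quotπ_surjective _,
    fun y => quotπ_eq_zero, fun m c => (hM m c).quot (ses_sub_quot _) fun h hh => ?_⟩
  obtain ⟨f₀, hf₀, hff₀⟩ := exists_lift (subι_mem (rangeH f hf)) (subι_injective _) hf
    (fun x => exists_subι ⟨x, rfl⟩) (add_zero _)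
  -- A map from the chosen summand to ∇̄(m) extends to the whole trace submodule by projection, and
  -- then to `M` because `M / tr` is good; so `E1.quot` applies.
  obtain ⟨g, hg, hgh⟩ := (good_quot_tr hE hM r m c).extends (ses_sub_quot (tr E M r))
    (gHom_comp (gHom_comp (gHom_comp hθ' (ssπ_mem i) (zero_add _)) hf₀ (neg_add_cancel _)) hh
      (zero_add c))
  refine ⟨g, hg, fun x => ?_⟩
  obtain ⟨z, hz⟩ := subι_mem_sub x
  have hx : x = f₀ z := subι_injective _ (by rw [hff₀, hz])
  rw [hx, hff₀]
  have hfz : f z = subι (tr E M r) (θ (stdι E α δ i z)) := rfl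
  rw [hfz, hgh]
  simp only [LinearMap.comp_apply, hθ1, ssπ_ssι]

variable (l) in
/-- One step of the construction of tilting modules. -/
theorem exists_universal_extension (r : ℕ) (hX : X.InDown)
    (hXr : ∀ m : Λ, r < level m → ∀ c, E1 (E.Δ m) X c) :
    ∃ (Y S : GrMod 𝒜) (i : X →ₗ[A] Y) (p : Y →ₗ[A] S), SES i p 0 ∧ Good E S ∧ S.InDown ∧
      (∀ m : Λ, r < level m → ∀ x : S, E.e m • x = 0) ∧
      ∀ m : Λ, r ≤ level m → ∀ c, E1 (E.Δ m) Y c := by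
  classical
  have hK := fun m => finite_K hE m
  have hfin := fun m c => finiteDimensional_gHom (hK m) hX.1 c
  let B := fun (m : Λ) (c : ℤ) => Module.finBasis k (gHom ((E.P m).sub (E.K m)) X c)
  -- One summand Δ(m) for every basis element of the maps `K(m) → X` of each degree, with `m` of
  -- level `r`. This set is countable, so it can be moved to the universe of the modules.
  let T := Σ (m : {m : Λ // level m = r}) (c : ℤ),
    Fin (Module.finrank k (gHom ((E.P m.1).sub (E.K m.1)) X c))
  have : Countable {m : Λ // level m = r} := Finite.to_countable
  have : Small.{u} T := Countable.toSmall T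
  let q : T ≃ Shrink.{u} T := equivShrink T
  let α : Shrink.{u} T → Λ := fun i => (q.symm i).1.1
  let δ : Shrink.{u} T → ℤ := fun i => (q.symm i).2.1
  obtain ⟨κ, π, hκ, hκι, hπι⟩ := exists_std_presentation (E := E) α δ
  obtain ⟨F, hF, hFι⟩ := exists_ss_desc (d := 0) (δ := δ)
    (S := fun i => (E.P (α i)).sub (E.K (α i)))
    (f := fun i => (B (α i) (δ i) (q.symm i).2.2).1)
    fun i => gHom_congr (B (α i) (δ i) (q.symm i).2.2).2 (zero_add _).symm
  -- Pushing out along the universal map `F : ⨁ K → X` makes each basis element, and so every map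
  -- `K(m) → X` with `m` of level `r`, extend to a map `P(m) → Y`.
  obtain ⟨Y, i', Q, p', h, hQ, hQκ, hQp⟩ := exists_pushout hκ hF
  have hlev : ∀ i, level (α i) = r := fun i => (q.symm i).1.2
  have hS : ∀ m : Λ, r < level m → ∀ x : stdSum E α δ, E.e m • x = 0 := fun m hm x =>
    ss_ext fun i => by
      rw [map_smul, map_zero]
      by_contra hx
      have := level_mono (Δ_weight hE hx)
      have := hlev i
      omega
  have hext : ∀ m : Λ, r ≤ level m → ∀ c, E1 (E.Δ m) (stdSum E α δ) c := fun m hm c =>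
    E.E1_Δ_of_extends fun f hf => ⟨0, zero_mem _, fun x => by
      rw [E.K_hom_eq_zero (f := f) fun ν hν y => hS ν (hm.trans_lt (level_lt hν)) y]; rfl⟩
  -- `K(m)` is finitely generated and `X` is bounded below, so there are no maps of very negative
  -- degree. With finite dimensional Hom spaces this keeps the sum in A^↓-gmod.
  obtain ⟨b, hb⟩ : ∃ b : ℤ, ∀ i, b ≤ δ i := by
    choose β hβ using fun m => exists_bound_gHom_eq_zero (hK m)
    obtain ⟨b₀, hb₀⟩ := hX.2
    obtain ⟨β₀, hβ₀⟩ := (Set.finite_range β).bddAbove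
    refine ⟨b₀ - β₀, fun i => ?_⟩
    by_contra hlt
    have hm : β (α i) ≤ β₀ := hβ₀ ⟨_, rfl⟩
    have hzero := hβ (α i) X (δ i) (fun j hj => hb₀ j (by omega))
    exact (B (α i) (δ i)).ne_zero (q.symm i).2.2 (Subtype.ext (hzero _ (Subtype.prop _)))
  have hΔ : ∀ i j, j < δ i → ((E.Δ (α i)).shift (-δ i)).deg j = ⊥ := fun i j hj =>
    eq_bot_iff.2 fun x hx => (Submodule.mem_bot k).2
      (Δ_eq_zero_of_neg (n := -δ i + j) (l := α i) hx (by omega))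
  have hd : (stdSum E α δ).InDown := by
    refine directSum_inDown (fun i => inDown_shift (Δ_inDown _) _)
      ⟨b, fun i j hj => hΔ i j (hj.trans_le (hb i))⟩ fun n => ?_
    let e : (Σ (m : {m : Λ // level m = r}) (c : Set.Icc b n),
        Fin (Module.finrank k (gHom ((E.P m.1).sub (E.K m.1)) X c))) → T :=
      fun s => ⟨s.1, s.2.1.1, s.2.2⟩
    refine ((Set.finite_range e).preimage q.symm.injective.injOn).subset fun i hi => ?_
    have hle : δ i ≤ n := not_lt.1 fun hlt => hi (hΔ i n hlt)
    exact ⟨⟨(q.symm i).1, ⟨δ i, hb i, hle⟩, (q.symm i).2.2⟩, rfl⟩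
  refine ⟨Y, stdSum E α δ, i', p', h, good_stdSum hE α δ, hd, hS, fun m hm c => ?_⟩
  rcases hm.lt_or_eq with hm | hm
  · exact E1_Δ_ext_right h (hXr m hm c) (hext m hm.le c)
  have hbasis : ∀ f ∈ gHom ((E.P m).sub (E.K m)) X c, ∃ g ∈ gHom (E.P m) Y c, ∀ x,
      g (subι (E.K m) x) = i' (f x) := by
    have hT : ∀ t : T, ∃ g ∈ gHom (E.P t.1.1) Y t.2.1, ∀ x,
        g (subι (E.K t.1.1) x) = i' ((B t.1.1 t.2.1 t.2.2).1 x) := by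
      intro t
      rw [← q.symm_apply_apply t]
      refine ⟨Q ∘ₗ ssι (fun i => E.P (α i)) δ (q t), ?_, fun x => ?_⟩
      · exact gHom_comp (ssι_mem (q t)) hQ (add_zero _)
      · refine (?_ : Q (ssι (fun i => E.P (α i)) δ (q t) (subι _ x)) = i' (F (ssι _ δ (q t) x))).trans
          (congrArg i' (hFι (q t) x))
        rw [← hQκ, hκι]
    suffices H : ∀ f' : gHom ((E.P m).sub (E.K m)) X c, ∃ g ∈ gHom (E.P m) Y c, ∀ x,
        g (subι (E.K m) x) = i' (f'.1 x) from fun f hf => H ⟨f, hf⟩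
    intro f'
    have hspan := (B m c).mem_span f'
    induction hspan using Submodule.span_induction with
    | mem f hf =>
      obtain ⟨a, rfl⟩ := hf
      exact hT ⟨⟨m, hm.symm⟩, c, a⟩
    | zero => exact ⟨0, zero_mem _, fun x => (map_zero i').symm⟩
    | add f₁ f₂ _ _ h₁ h₂ =>
      obtain ⟨g₁, hg₁, h₁⟩ := h₁
      obtain ⟨g₂, hg₂, h₂⟩ := h₂
      exact ⟨g₁ + g₂, add_mem hg₁ hg₂, fun x => by
        rw [LinearMap.add_apply, h₁, h₂, ← map_add]; rfl⟩
    | smul a f _ hf =>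
      obtain ⟨g, hg, hgf⟩ := hf
      exact ⟨a • g, Submodule.smul_mem _ a hg, fun x => by
        rw [LinearMap.smul_apply, hgf, ← LinearMap.map_smul_of_tower]; rfl⟩
  refine E.E1_Δ_of_extends fun f hf => ?_
  -- `K(m)` is generated in levels above `r`, which the cokernel does not have; so every map `K(m) →
  -- Y` takes values in `X`, where `hbasis` extends it.
  have hpf : p' ∘ₗ f = 0 := E.K_hom_eq_zero fun ν hν y => hS ν (hm.trans_lt (level_lt hν)) y
  obtain ⟨f₀, hf₀, hff₀⟩ := exists_lift h.hi h.inj hf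
    (fun y => (h.exact _).1 (LinearMap.congr_fun hpf y)) (add_zero c)
  obtain ⟨g, hg, hgf⟩ := hbasis f₀ hf₀
  exact ⟨g, hg, fun x => by rw [hgf, hff₀]⟩

omit hE in
-- The cokernel of a composite of injections is an extension of the second cokernel by the first;
-- this tracks the quotient by Δ(l) through successive universal extensions.
theorem exists_ses_comp {j : L →ₗ[A] X} {p : X →ₗ[A] N} (h : SES j p 0) {i : X →ₗ[A] Y}
    {q : Y →ₗ[A] R} (h' : SES i q 0) : ∃ (N' : GrMod 𝒜) (π : Y →ₗ[A] N') (a : N →ₗ[A] N')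
      (b : N' →ₗ[A] R), SES (i ∘ₗ j) π 0 ∧ SES a b 0 := by
  have hij := gHom_comp h.hi h'.hi (add_zero 0)
  have hs := ses_quot_range hij (h'.inj.comp h.inj)
  obtain ⟨a, ha, hap⟩ := exists_factor h.hp h.surj (gHom_comp h'.hi hs.hp (add_zero 0))
    (fun y hy => by
      obtain ⟨x, rfl⟩ := (h.exact y).1 hy
      exact hs.comp_eq_zero x) (add_zero 0)
  obtain ⟨b, hb, hbq⟩ := exists_factor hs.hp hs.surj h'.hp (fun y hy => by
    obtain ⟨x, rfl⟩ := (hs.exact y).1 hy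
    exact h'.comp_eq_zero _) (add_zero 0)
  refine ⟨_, _, a, b, hs, ha, hb, (injective_iff_map_eq_zero a).2 fun n hn => ?_, fun z => ?_,
    fun y => ?_⟩
  · obtain ⟨x, rfl⟩ := h.surj n
    rw [hap, LinearMap.comp_apply, hs.exact] at hn
    obtain ⟨z, hz⟩ := hn
    rw [← h'.inj hz, h.comp_eq_zero]
  · obtain ⟨y, rfl⟩ := h'.surj z
    exact ⟨_, hbq y⟩
  · obtain ⟨y, rfl⟩ := hs.surj y
    rw [hbq]
    constructor
    · intro hy
      obtain ⟨x, rfl⟩ := (h'.exact y).1 hy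
      exact ⟨p x, hap x⟩
    · rintro ⟨n, hn⟩
      obtain ⟨x, rfl⟩ := h.surj n
      rw [hap, LinearMap.comp_apply, ← sub_eq_zero, ← map_sub, hs.exact] at hn
      obtain ⟨z, hz⟩ := hn
      rw [← h'.comp_eq_zero (x - j z), map_sub i, map_sub q, ← LinearMap.comp_apply i j, hz, map_sub]
      simp

variable (l) in
/-- The standard module embeds in a tilting module, with cokernel filtered by standard modules of
lower level. -/
theorem exists_tilting_extension : ∃ (X N : GrMod 𝒜) (j : E.Δ l →ₗ[A] X) (p : X →ₗ[A] N),
    SES j p 0 ∧ Good E N ∧ N.InDown ∧ (∀ m : Λ, level l ≤ level m → ∀ x : N, E.e m • x = 0) ∧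
    Perp E X := by
  -- After `n` steps the extensions by standard modules of level at least `level l - n` vanish.
  -- Nothing is needed at the start: for `level m ≥ level l` the weights generating `K(m)` do not
  -- occur in Δ(l).
  have key : ∀ n ≤ level l, ∃ (X N : GrMod 𝒜) (j : E.Δ l →ₗ[A] X) (p : X →ₗ[A] N),
      SES j p 0 ∧ Good E N ∧ N.InDown ∧ (∀ m : Λ, level l ≤ level m → ∀ x : N, E.e m • x = 0) ∧
      ∀ m : Λ, level l - n ≤ level m → ∀ c, E1 (E.Δ m) X c := by
    intro n
    induction n with
    | zero =>
      intro _
      have h0 : ∀ x : (E.Δ l).quot (topH _), x = 0 := fun x => by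
        obtain ⟨x, rfl⟩ := quotπ_surjective _ x
        exact (quotπ_eq_zero (F := topH (E.Δ l))).2 trivial
      have hbot : ∀ j, ((E.Δ l).quot (topH _)).deg j = ⊥ := fun j =>
        eq_bot_iff.2 fun x _ => (Submodule.mem_bot k).2 (h0 x)
      refine ⟨E.Δ l, (E.Δ l).quot (topH _), LinearMap.id, quotπ _, ⟨id_mem_gHom, quotπ_mem _,
        Function.injective_id, quotπ_surjective _, fun y => ⟨fun _ => ⟨y, rfl⟩, fun _ => h0 _⟩⟩,
        fun _ _ => E1.of_deg_eq_bot hbot,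
        (Δ_inDown l).of_surjective (quotπ_mem _) (quotπ_surjective _), fun _ _ x => h0 _,
        fun m hm c => E.E1_Δ_of_extends fun f hf => ⟨0, zero_mem _, fun x => ?_⟩⟩
      rw [E.K_hom_eq_zero (f := f) fun ν hν y => ?_]
      · rfl
      · by_contra hy
        have := level_mono (Δ_weight hE hy)
        have := level_lt hν
        omega
    | succ n ih =>
      intro hn
      obtain ⟨X, N, j, p, h, hN, hNd, hNw, hX⟩ := ih (by omega)
      obtain ⟨Y, S, i, q, h', hS, hSd, hSw, hY⟩ := exists_universal_extension hE
        (level l - (n + 1)) (InDown.ext h (Δ_inDown l) hNd) fun m hm => hX m (by omega)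
      obtain ⟨N', π, a, b, hπ, hab⟩ := exists_ses_comp h h'
      refine ⟨Y, N', i ∘ₗ j, π, hπ, hN.ext hab hS, InDown.ext hab hNd hSd, fun m hm x => ?_, hY⟩
      have hbx : b (E.e m • x) = 0 := by rw [map_smul, hSw m (by omega)]
      obtain ⟨z, hz⟩ := (hab.exact _).1 hbx
      rw [← e_smul_e_smul, ← hz, ← map_smul, hNw m hm, map_zero]
  obtain ⟨X, N, j, p, h, hN, hNd, hNw, hX⟩ := key (level l) le_rfl
  exact ⟨X, N, j, p, h, hN, hNd, hNw, fun m c => hX m (by omega) c⟩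

omit hE in
theorem exists_proj_of_isCompl {F F' : M.HSub} (h : IsCompl F.toSubmodule F'.toSubmodule) :
    ∃ p ∈ gHom M (M.sub F) 0, ∀ x, p (subι F x) = x := by
  let p : M →ₗ[A] M.sub F := Submodule.projectionOnto F.toSubmodule F'.toSubmodule h
  have hp : ∀ x, p (subι F x) = x := fun x => Submodule.projectionOnto_apply_left h x
  have hp' : ∀ x ∈ F'.toSubmodule, p x = 0 := fun x hx =>
    (Submodule.projectionOnto_apply_eq_zero_iff h).2 hx
  refine ⟨p, fun n x hx => ?_, hp⟩
  obtain ⟨a, ha, b, hb, hab⟩ := Submodule.mem_sup.1 (h.sup_eq_top.ge (Submodule.mem_top (x := x)))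
  obtain ⟨y, hy, hya⟩ := exists_subι_deg (F.proj_mem n ha) (M.proj_mem n a)
  have : x = subι F y + M.proj n b := by rw [hya, ← map_add, hab, proj_same _ hx]
  rw [this, map_add, hp, hp' _ (F'.proj_mem n hb), add_zero, add_zero]
  exact hy

variable (l) in
-- The cokernel of Δ(l) has no weight `l`, so in degree 0 the weight space of `l` is the line
-- spanned by the generator of Δ(l). A line cannot be split, so some indecomposable summand contains
-- the generator.
theorem exists_indecomposable_tilting :
    ∃ T : GrMod 𝒜, E.IsTilting T ∧ T.Indecomposable ∧ E.HasStandardSub l T := by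
  obtain ⟨X, N, j, p, h, hN, hNd, hNw, hX⟩ := exists_tilting_extension l hE
  have hXd := InDown.ext h (Δ_inDown l) hNd
  have hXt : E.IsTilting X := (isTilting_iff hE).2 ⟨hXd, (good_Δ hE l).ext h hN, hX⟩
  have hv : j (E.dgen l) ≠ 0 := fun h0 => dgen_ne_zero hE l (h.inj (h0.trans (map_zero j).symm))
  obtain ⟨F, F', hc, hvF, hind⟩ := exists_indecomposable_summand hXd hv fun U U' U'' _ hsup hv' => by
    obtain ⟨a, ha, b, hb, hab⟩ := Submodule.mem_sup.1 (hsup.ge hv')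
    have hv0 := gHom_apply₀ h.hi (E.dgen_mem l)
    have hsum : E.e l • X.proj 0 a + E.e l • X.proj 0 b = j (E.dgen l) := by
      rw [← smul_add, ← map_add, hab, proj_same _ hv0, ← map_smul, e_dgen]
    have haU : E.e l • X.proj 0 a ∈ U.toSubmodule := U.toSubmodule.smul_mem _ (U.proj_mem 0 ha)
    have hbU : E.e l • X.proj 0 b ∈ U'.toSubmodule := U'.toSubmodule.smul_mem _ (U'.proj_mem 0 hb)
    -- The part of `a` of weight `l` and degree 0 is a scalar multiple `t` of the generator: if `t`
    -- is nonzero the generator lies in `U`, otherwise it lies in `U'`.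
    obtain ⟨z, hz⟩ := (h.exact (E.e l • X.proj 0 a)).1 (by rw [map_smul, hNw l le_rfl])
    obtain ⟨a', ha', rfl⟩ := E.exists_dgen_deg (deg_of_map_deg h.hi h.inj (add_zero 0) (x := z)
      (by rw [hz]; exact E.e_smul_deg (X.proj_mem 0 a) l))
    obtain ⟨t, ht⟩ := exists_smul_dgen (E := E) (l := l) ha'
    rw [ht, LinearMap.map_smul_of_tower] at hz
    by_cases ht0 : t = 0
    · rw [ht0, zero_smul] at hz
      rw [← hz, zero_add] at hsum
      exact Or.inr (hsum ▸ hbU)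
    · left
      rw [← hz] at haU
      have := (U.toSubmodule.restrictScalars k).smul_mem t⁻¹ haU
      rwa [smul_smul, inv_mul_cancel₀ ht0, one_smul] at this
  obtain ⟨r, hr, hr1⟩ := exists_proj_of_isCompl hc
  have hT : E.IsTilting (X.sub F) := isTilting_summand hE (subι_mem F) hr hr1 hXt
  refine ⟨X.sub F, hT, hind, (hasStandardSub_iff hE hT.1.1).2 ?_⟩
  obtain ⟨f, hf, hfj⟩ := exists_lift (subι_mem F) (subι_injective F) h.hi (fun x => by
    obtain ⟨a, rfl⟩ := E.exists_dgen x
    rw [map_smul]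
    exact exists_subι (F.toSubmodule.smul_mem a hvF)) (add_zero 0)
  have hfinj : Function.Injective f := fun x y hxy => h.inj (by rw [← hfj, hxy, hfj])
  have hs := ses_quot_range hf hfinj
  obtain ⟨a, ha, haq⟩ := exists_factor hs.hp hs.surj (gHom_comp (subι_mem F) h.hp (add_zero 0))
    (fun y hy => by
      obtain ⟨x, rfl⟩ := (hs.exact y).1 hy
      rw [LinearMap.comp_apply, hfj, h.comp_eq_zero]) (add_zero 0)
  obtain ⟨b, hb, hbp⟩ := exists_factor h.hp h.surj (gHom_comp hr hs.hp (add_zero 0))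
    (fun y hy => by
      obtain ⟨x, rfl⟩ := (h.exact y).1 hy
      rw [LinearMap.comp_apply, ← hfj, hr1, hs.comp_eq_zero]) (add_zero 0)
  -- Inclusion of and projection to the summand both respect Δ(l), so the new cokernel is a direct
  -- summand of `N`.
  refine ⟨_, f, _, hs, fun m c => (hN m c).summand ha hb fun x => ?_⟩
  obtain ⟨x, rfl⟩ := hs.surj x
  rw [haq, LinearMap.comp_apply, hbp, LinearMap.comp_apply, hr1]

/-- Every indecomposable tilting module contains, up to shift, a standard module with cokernel
filtered by standard modules. -/
theorem exists_shift_hasStandardSub (hM : E.IsTilting M) (hMi : M.Indecomposable) :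
    ∃ (l : Λ) (j : ℤ), E.HasStandardSub l (M.shift j) := by
  have := hMi.1
  obtain ⟨hMd, hMg, -⟩ := (isTilting_iff hE).1 hM
  obtain ⟨l, j, N, f, p, hf, hp, hinj, hsurj, hex, hN⟩ := exists_std_submodule hE hMg hMd
  refine ⟨l, j, (hasStandardSub_iff hE (inDown_shift hMd j)).2 ⟨N.shift j,
    (shiftEquiv M j).toLinearMap ∘ₗ f, shiftMap p j, ⟨gHom_comp hf (shiftEquiv_mem M j)
    (add_neg_cancel j), shiftMap_mem hp j, hinj, hsurj, hex⟩, hN.shift j⟩⟩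

end PosGraded

end StratTilting

end

open StratTilting StratTilting.GrMod StratTilting.PosGraded in
theorem mainTheorem4 {k A : Type u} [Field k] [IsAlgClosed k] [Ring A] [Algebra k A]
    (𝒜 : ℤ → Submodule k A) [GradedAlgebra 𝒜]
    {Λ : Type*} [Finite Λ] [Nonempty Λ] [Preorder Λ]
    (E : StratTilting.PosGraded 𝒜 Λ) (hE : E.IsStandardlyStratified) :
    -- closure under finite direct sums, and under all direct sums that exist in the category
    (∀ (ι : Type u) [Finite ι] (M : ι → StratTilting.GrMod 𝒜), (∀ i, E.IsTilting (M i)) →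
      E.IsTilting (StratTilting.GrMod.directSum M)) ∧
    (∀ (ι : Type u) (M : ι → StratTilting.GrMod 𝒜), (∀ i, E.IsTilting (M i)) →
      (StratTilting.GrMod.directSum M).InDown → E.IsTilting (StratTilting.GrMod.directSum M)) ∧
    -- closure under direct summands
    (∀ X M : StratTilting.GrMod 𝒜, E.IsTilting M → X.IsSummand M → E.IsTilting X) ∧
    ∃ T : Λ → StratTilting.GrMod 𝒜,
      -- existence and uniqueness (up to isomorphism) of `T l`
      (∀ l, E.IsTilting (T l) ∧ (T l).Indecomposable ∧ E.HasStandardSub l (T l) ∧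
        ∀ M : StratTilting.GrMod 𝒜, E.IsTilting M → M.Indecomposable → E.HasStandardSub l M →
          M.IsIsomorphic (T l)) ∧
      -- classification of indecomposable objects
      (∀ M : StratTilting.GrMod 𝒜, E.IsTilting M → M.Indecomposable →
        ∃ (l : Λ) (j : ℤ), M.IsIsomorphic ((T l).shift j)) := by
  choose T hT hTi hTs using fun l => exists_indecomposable_tilting l hE
  have huniq : ∀ (l : Λ) (M : GrMod 𝒜), E.IsTilting M → M.Indecomposable → E.HasStandardSub l M →
      M.IsIsomorphic (T l) := fun l M h hi hs =>
    isIsomorphic_of_hasStandardSub hE h hi hs (hT l) (hTi l) (hTs l)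
  refine ⟨fun ι _ M hM => isTilting_directSum hE hM (directSum_inDown_of_finite fun i => (hM i).1.1),
    fun ι M hM hd => isTilting_directSum hE hM hd, ?_, T,
    fun l => ⟨hT l, hTi l, hTs l, huniq l⟩, fun M hM hMi => ?_⟩
  · rintro X M hM ⟨i, p, hpi⟩
    exact isTilting_summand hE i.mem_gHom p.mem_gHom hpi hM
  · obtain ⟨l, j, hs⟩ := exists_shift_hasStandardSub hE hM hMi
    obtain ⟨f, hf⟩ := huniq l _ (isTilting_shift hE hM j) (shift_indecomposable hMi j) hs
    have hfm : f.toLinearMap ∈ gHom (M.shift j) (T l) 0 := fun n x hx => by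
      rw [add_zero]; exact (hf n x).1 hx
    -- From `M⟨j⟩ ≅ T(l)` one obtains `M ≅ T(l)⟨-j⟩`.
    exact ⟨l, -j, isIsomorphic_of_bijective
      (gHom_comp (gHom_comp (shiftEquiv_mem M j) hfm (add_zero _)) (shiftEquiv_mem (T l) (-j))
        (by omega)) ((shiftEquiv (T l) (-j)).bijective.comp
          (f.bijective.comp (shiftEquiv M j).bijective))⟩
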